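/- Let $N\ge 1$, $\alpha\in(0,1)$, $0<T<\infty$, and let $\Omega\subset\mathbb R^N$ be a bounded domain of class $\mathcal C^{2+\alpha}$. *Kernel.* Let $J:\mathbb R^N\to[0,\infty)$ be radial, continuous and compactly supported with $\int J=1$; put $C(J)=\int_{\mathbb R^N}J(z)z_N^2\,dz$ and, for $\varepsilon>0$, $J_\varepsilon(z)=\varepsilon^{-N}J(z/\varepsilon)$ and $\Omega_{J_\varepsilon}=\Omega+\operatorname{supp}J_\varepsilon$. *Nonlinearity.* Let $\mathcal G:\Omega\times\mathbb R\to\mathbb R$ be a Carathéodory function such that for some $\alpha_2\ge\alpha_1>0$ and a.e. $x\in\Omega$ $$\alpha_1\le\frac{\mathcal G(x,s)s-\mathcal G(x,\sigma)\sigma}{s-\sigma}\le\alpha_2\qquad\text{for all } s\ne\sigma ,$$ and such that for a.e. $x\in\Omega$ the function $\mathcal G(x,\cdot)$ is $\mathcal C^{1}$ with derivative $\mathcal G'_s(x,\cdot)$ that is $\alpha$-Hölder on every bounded interval, with a constant independent of $x$. Let $\mu:\Omega\to\mathbb R$ satisfy $\mu(x)=2\mathcal G_s'(x,0)/\mathcal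 G(x,0)$ for a.e. $x\in\Omega$, and let $C(x)^{-1}=\tfrac12C(J)\mathcal G(x,0)$. *Local problem.* Let $v_0\in\mathcal C^{1+\alpha}(\overline\Omega)$ and let $v\in\mathcal C(\overline\Omega\times[0,T])\cap\mathcal C^{2+\alpha,1+\alpha/2}_{\rm loc}(\Omega\times(0,T))$ be a classical solution of $$v_t=\Delta v+\mu(x)|\nabla v|^2\ \text{ in }\Omega\times(0,T),\qquad v=h_0\ \text{ on }\partial\Omega\times(0,T),\qquad v(\cdot,0)=v_0\ \text{ in }\Omega .$$ *Nonlocal problems.* Let $\varepsilon_0>0$ and let $h$ be continuous on $E\times(0,T]$, where $E=\bigcup_{0<\varepsilon\le\varepsilon_0}\Omega_{J_\varepsilon}\setminus\Omega$, with $h(\cdot,t)\in\mathcal C^{1+\alpha}(E)$ bounded in that space uniformly for $t\in(0,T]$, and $h=h_0$ on $\partial\Omega\times(0,T)$. For $0<\varepsilon\le\varepsilon_0$ let $u^\varepsilon$ be a solution of $$u^\varepsilon_t(x,t)=\frac{C(x)}{\varepsilon^2}\int_{\Omega_{J_\varepsilon}}J_\varepsilon(x-y)\,\big(u^\varepsilon(y,t)-u^\varepsilon(x,t)\big)\,\mathcal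 G\big(x,u^\varepsilon(y,t)-u^\varepsilon(x,t)\big)\,dy,$$ $0<t<T$, with exterior datum $u^\varepsilon=h$ and initial datum $u^\varepsilon(\cdot,0)=v_0$, the equation being understood integrated in time, in either of the following senses: *weak*, i.e. $u^\varepsilon\in\mathcal C([0,T];L^1(\Omega))$, the equation holds for a.e. $x\in\Omega$, and $u^\varepsilon=h$ a.e. in $\Omega_{J_\varepsilon}\setminus\Omega$; or *regular*, i.e. $u^\varepsilon\in\mathcal C([0,T];\mathcal C(\overline\Omega))$, the equation holds for every $x\in\overline\Omega$, and $u^\varepsilon=h$ in $\Omega_{J_\varepsilon}\setminus\overline\Omega$. Then $$\lim_{\varepsilon\to0^+}\ \sup_{t\in[0,T]}\|u^\varepsilon(\cdot,t)-v(\cdot,t)\|_{L^\infty(\Omega)}=0 .$$ If moreover $v$ has finite $\mathcal C^{2+\alpha,1+\alpha/2}$ norm on the whole cylinder $\Omega\times(0,T)$ (that is, $v,\nabla v,D^2v,v_t$ are bounded there and $D^2v$, $v_t$ are $\alpha$-Hölder for the parabolic distance $|x-y|+|t-s|^{1/2}$), then there is a constant $K$ such that for all sufficiently small $\varepsilon>0$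 $$\sup_{t\in[0,T]}\|u^\varepsilon(\cdot,t)-v(\cdot,t)\|_{L^\infty(\Omega)}\le K\varepsilon^\alpha .$$ -/

import Mathlib

open MeasureTheory Filter Topology Set
open scoped Pointwise Laplacian ENNReal

noncomputable section

/-- The space `ℝ^N` with its Euclidean norm, where `N = n + 1 ≥ 1`. -/
abbrev Eucl (n : ℕ) : Type := EuclideanSpace ℝ (Fin (n + 1))

/-! ### Function spaces and domains -/

/-- `f ∈ C^{1+α}(S)` with norm at most `M` (up to a numerical factor): `f` is on `S` the
restriction of a `C^1` function on `ℝ^N` that is bounded by `M`, with gradient bounded by `M` and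
`α`-Hölder with constant `M`. -/
def C1HolderOn {n : ℕ} (α M : ℝ) (f : Eucl n → ℝ) (S : Set (Eucl n)) : Prop :=
  ∃ g : Eucl n → ℝ, EqOn f g S ∧ ContDiff ℝ 1 g ∧
    (∀ x, |g x| ≤ M) ∧ (∀ x, ‖fderiv ℝ g x‖ ≤ M) ∧
    (∀ x y, ‖fderiv ℝ g x - fderiv ℝ g y‖ ≤ M * ‖x - y‖ ^ α)

/-- A bounded open set with boundary of class `C^{2+α}`: near each boundary point it is the
sublevel set `{ρ < 0}` of a `C^{2+α}` function with non-vanishing gradient. -/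
structure IsC2HolderDomain {n : ℕ} (α : ℝ) (Ω : Set (Eucl n)) : Prop where
  isOpen : IsOpen Ω
  isBounded : Bornology.IsBounded Ω
  boundary : ∀ p ∈ frontier Ω, ∃ r > 0, ∃ ρ : Eucl n → ℝ,
    ContDiffOn ℝ 2 ρ (Metric.ball p r) ∧
    (∃ L : ℝ, ∀ x ∈ Metric.ball p r, ∀ y ∈ Metric.ball p r,
      ‖iteratedFDeriv ℝ 2 ρ x - iteratedFDeriv ℝ 2 ρ y‖ ≤ L * ‖x - y‖ ^ α) ∧
    fderiv ℝ ρ p ≠ 0 ∧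
    ∀ x ∈ Metric.ball p r, (x ∈ Ω ↔ ρ x < 0)

/-- `v ∈ C^{2+α,1+α/2}(Q)` with finite parabolic Hölder norm on `Q`: `v`, `D_x v`, `D_x^2 v` and
`v_t` are bounded on `Q`, and `D_x^2 v` and `v_t` are `α`-Hölder on `Q` for the parabolic distance
`|x - y| + |t - s|^{1/2}`. -/
def ParabolicHolderOn {n : ℕ} (α : ℝ) (v : Eucl n → ℝ → ℝ) (Q : Set (Eucl n × ℝ)) : Prop :=
  (∀ p ∈ Q, ContDiffAt ℝ 2 (fun y => v y p.2) p.1 ∧ DifferentiableAt ℝ (v p.1) p.2) ∧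
  ∃ L : ℝ,
    (∀ p ∈ Q, |v p.1 p.2| ≤ L ∧ ‖fderiv ℝ (fun y => v y p.2) p.1‖ ≤ L ∧
      ‖iteratedFDeriv ℝ 2 (fun y => v y p.2) p.1‖ ≤ L ∧ |deriv (v p.1) p.2| ≤ L) ∧
    (∀ p ∈ Q, ∀ q ∈ Q,
      ‖iteratedFDeriv ℝ 2 (fun y => v y p.2) p.1 - iteratedFDeriv ℝ 2 (fun y => v y q.2) q.1‖
        ≤ L * (‖p.1 - q.1‖ + √|p.2 - q.2|) ^ α ∧
      |deriv (v p.1) p.2 - deriv (v q.1) q.2| ≤ L * (‖p.1 - q.1‖ + √|p.2 - q.2|) ^ α)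

/-- `v ∈ C^{2+α,1+α/2}_loc(Q)`: every point of `Q` has a neighbourhood in `Q` on which the
parabolic Hölder norm is finite. -/
def LocParabolicHolderOn {n : ℕ} (α : ℝ) (v : Eucl n → ℝ → ℝ) (Q : Set (Eucl n × ℝ)) : Prop :=
  ∀ p ∈ Q, ∃ U ∈ 𝓝 p, ParabolicHolderOn α v (U ∩ Q)

/-! ### The local problem -/

/-- Classical solutions of `v_t = Δv + μ(x)|∇v|²` in `Ω × (0,T)`, `v = h₀` on `∂Ω × (0,T)`,
`v(·,0) = v₀` in `Ω`. -/
structure IsClassicalSolution {n : ℕ} (α : ℝ) (Ω : Set (Eucl n)) (T : ℝ) (μ : Eucl n → ℝ)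
    (h₀ : Eucl n → ℝ → ℝ) (v₀ : Eucl n → ℝ) (v : Eucl n → ℝ → ℝ) : Prop where
  continuousOn : ContinuousOn (fun p : Eucl n × ℝ => v p.1 p.2) (closure Ω ×ˢ Icc 0 T)
  regular : LocParabolicHolderOn α v (Ω ×ˢ Ioo 0 T)
  equation : ∀ x ∈ Ω, ∀ t ∈ Ioo 0 T,
    deriv (v x) t = Δ (fun y => v y t) x + μ x * ‖gradient (fun y => v y t) x‖ ^ 2
  boundary : ∀ x ∈ frontier Ω, ∀ t ∈ Ioo 0 T, v x t = h₀ x t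
  initial : ∀ x ∈ Ω, v x 0 = v₀ x

/-! ### The nonlocal problem -/

/-- Admissible kernels: nonnegative, radial, continuous with compact support, of unit mass.
The second moment is then automatically finite. -/
structure IsKernel {n : ℕ} (J : Eucl n → ℝ) : Prop where
  nonneg : ∀ z, 0 ≤ J z
  radial : ∀ z w, ‖z‖ = ‖w‖ → J z = J w
  continuous : Continuous J
  hasCompactSupport : HasCompactSupport J
  integral_eq_one : ∫ z, J z = 1

/-- `C(J) = ∫ J(z) z_N² dz`. -/
def secondMoment {n : ℕ} (J : Eucl n → ℝ) : ℝ := ∫ z, J z * z (Fin.last n) ^ 2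

/-- `J_ε(z) = ε^{-N} J(z/ε)`. -/
def rescaledKernel {n : ℕ} (J : Eucl n → ℝ) (ε : ℝ) (z : Eucl n) : ℝ :=
  (ε ^ (n + 1))⁻¹ * J (ε⁻¹ • z)

/-- `Ω_J = Ω + supp J`. -/
def reach {n : ℕ} (Ω : Set (Eucl n)) (J : Eucl n → ℝ) : Set (Eucl n) := Ω + tsupport J

/-- Carathéodory functions on `Ω × ℝ`. -/
structure IsCaratheodory {n : ℕ} (Ω : Set (Eucl n)) (G : Eucl n → ℝ → ℝ) : Prop where
  measurable : ∀ s, AEMeasurable (fun x => G x s) (volume.restrict Ω)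
  continuous : ∀ᵐ x ∂volume.restrict Ω, Continuous (G x)

/-- The strong monotonicity condition
`α₁ ≤ (G(x,s)s - G(x,σ)σ)/(s - σ) ≤ α₂` for all `s ≠ σ` and a.e. `x ∈ Ω`. -/
def StronglyMonotone {n : ℕ} (Ω : Set (Eucl n)) (G : Eucl n → ℝ → ℝ) : Prop :=
  ∃ α₁ α₂ : ℝ, 0 < α₁ ∧ α₁ ≤ α₂ ∧ ∀ᵐ x ∂volume.restrict Ω, ∀ s σ : ℝ, s ≠ σ →
    α₁ ≤ (G x s * s - G x σ * σ) / (s - σ) ∧ (G x s * s - G x σ * σ) / (s - σ) ≤ α₂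

/-- `G(x,·) ∈ C^{1+α}`, with `s`-derivative `α`-Hölder on bounded intervals uniformly for a.e.
`x ∈ Ω`. -/
def C1HolderInS {n : ℕ} (α : ℝ) (Ω : Set (Eucl n)) (G : Eucl n → ℝ → ℝ) : Prop :=
  (∀ᵐ x ∂volume.restrict Ω, ContDiff ℝ 1 (G x)) ∧
  ∀ R > 0, ∃ L : ℝ, ∀ᵐ x ∂volume.restrict Ω, ∀ s ∈ Icc (-R) R, ∀ σ ∈ Icc (-R) R,
    |deriv (G x) s - deriv (G x) σ| ≤ L * |s - σ| ^ α

/-- `∫_{Ω_J} J(x-y) (w(y)-w(x)) G(x, w(y)-w(x)) dy`. -/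
def nonlocalOp {n : ℕ} (Ω : Set (Eucl n)) (J : Eucl n → ℝ) (G : Eucl n → ℝ → ℝ)
    (w : Eucl n → ℝ) (x : Eucl n) : ℝ :=
  ∫ y in reach Ω J, J (x - y) * ((w y - w x) * G x (w y - w x))

/-- Weak solutions on `[0,T]` of the nonlocal Dirichlet problem with kernel `J`, nonlinearity `G`,
exterior datum `h` on `Ω_J \ Ω` and initial datum `u₀` in `Ω`: `u ∈ C([0,T]; L¹(Ω))`, represented
by a function measurable in `(x,t)`, and the equation holds integrated in time. -/
structure IsWeakSolution {n : ℕ} (Ω : Set (Eucl n)) (T : ℝ) (J : Eucl n → ℝ)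
    (G : Eucl n → ℝ → ℝ) (h : Eucl n → ℝ → ℝ) (u₀ : Eucl n → ℝ) (u : Eucl n → ℝ → ℝ) :
    Prop where
  measurable : AEStronglyMeasurable (fun p : Eucl n × ℝ => u p.1 p.2)
    (volume.restrict (Ω ×ˢ Ioo 0 T))
  integrable : ∀ t ∈ Icc 0 T, IntegrableOn (fun x => u x t) Ω
  continuous : ∀ t ∈ Icc 0 T,
    Tendsto (fun s => ∫ x in Ω, |u x s - u x t|) (𝓝[Icc 0 T] t) (𝓝 0)
  equation : ∀ t ∈ Ioo 0 T, ∀ᵐ x ∂volume.restrict Ω,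
    u x t = (∫ τ in (0 : ℝ)..t, nonlocalOp Ω J G (fun y => u y τ) x) + u₀ x
  exterior : ∀ t ∈ Ioo 0 T, ∀ᵐ y ∂volume.restrict (reach Ω J \ Ω), u y t = h y t
  initial : Tendsto (fun t => ∫ x in Ω, |u x t - u₀ x|) (𝓝[>] 0) (𝓝 0)

/-- Regular solutions on `[0,T]` of the same problem: `u ∈ C([0,T]; C(Ω̄))`, the equation holds at
every point of the closure of `Ω`, and `h` is prescribed outside the closure. -/
structure IsRegularSolution {n : ℕ} (Ω : Set (Eucl n)) (T : ℝ) (J : Eucl n → ℝ)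
    (G : Eucl n → ℝ → ℝ) (h : Eucl n → ℝ → ℝ) (u₀ : Eucl n → ℝ) (u : Eucl n → ℝ → ℝ) :
    Prop where
  continuousOn : ContinuousOn (fun p : Eucl n × ℝ => u p.1 p.2) (closure Ω ×ˢ Icc 0 T)
  equation : ∀ t ∈ Ioo 0 T, ∀ x ∈ closure Ω,
    u x t = (∫ τ in (0 : ℝ)..t, nonlocalOp Ω J G (fun y => u y τ) x) + u₀ x
  exterior : ∀ t ∈ Ioo 0 T, ∀ y ∈ reach Ω J \ closure Ω, u y t = h y t
  initial : TendstoUniformlyOn (fun t x => u x t) u₀ (𝓝[>] 0) (closure Ω)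

/-- The rescaled nonlinearity `(C(x)/ε²) G(x,s)`, where `C(x)⁻¹ = ½ C(J) G(x,0)`. -/
def rescaledG {n : ℕ} (J : Eucl n → ℝ) (G : Eucl n → ℝ → ℝ) (ε : ℝ) (x : Eucl n) (s : ℝ) : ℝ :=
  (1 / 2 * secondMoment J * G x 0)⁻¹ / ε ^ 2 * G x s

/-- The exterior region `⋃_{0 < ε ≤ ε₀} Ω_{J_ε} \ Ω` on which the exterior datum is needed. -/
def exteriorCollar {n : ℕ} (Ω : Set (Eucl n)) (J : Eucl n → ℝ) (ε₀ : ℝ) : Set (Eucl n) :=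
  (⋃ ε ∈ Ioc 0 ε₀, reach Ω (rescaledKernel J ε)) \ Ω

/-- `sup_{t ∈ [0,T]} ‖u(·,t) - v(·,t)‖_{L^∞(Ω)}`, with values in `[0,∞]`. -/
def supDist {n : ℕ} (Ω : Set (Eucl n)) (T : ℝ) (u v : Eucl n → ℝ → ℝ) : ℝ≥0∞ :=
  ⨆ t ∈ Icc (0 : ℝ) T, eLpNorm (fun x => u x t - v x t) ⊤ (volume.restrict Ω)

end

/-! The right-hand side of the nonlocal equation integrates the flux s ↦ C(x)G(x,s)s of the jumps of
u against the kernel ε⁻²J_ε (`flux`, `diffusiveKernel`, `jumpOp`). By `exists_fluxBounds` the flux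
is increasing and Lipschitz in s, and equals (2/C(J))(s + (μ/2)s²) up to O(|s|^(2+α)), uniformly for
a.e. x. On a function with a second-order Taylor expansion and remainder of order 2+α, symmetry of J
kills the first moment and turns the second-order terms into Δv + μ|∇v|², so the operator is
consistent with error O(ε^α) (`abs_jump_sub_le`). As the flux is monotone, a comparison principle
holds (`comparison`), and the theorem becomes the construction of supersolutions close to v. Lower
bounds need no separate argument: changing the signs of u, v, h and μ and replacing Φ(x,s) by
-Φ(x,-s) preserves all hypotheses (`LimitSetting.neg`).

The function equal to v inside and h outside fails to be such a barrier in the strip of width of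
order ε where jumps leave Ω: there it is at best Lipschitz across the boundary, and the operator is
only O(1/ε). If v is regular up to the parabolic boundary, this defect is absorbed by κε times a
profile that rises from the boundary at scale ε and jumps there (`exists_layer`). The profile lowers
the operator by a multiple of 1/ε in the strip and costs only O(ε) in the estimate. Together with a
term Cε^α t this gives the rate (`exists_rate`).

Without that regularity, the parabolic boundary is treated by a Hopf–Cole device. For small jumps
the flux lies below (2/C(J))(e^(ms) - 1)/m with m large (`exists_flux_le_exp`), so m⁻¹ log(1 + Aq)
is a supersolution whenever q is one for the linear nonlocal heat equation (`le_log_barrier`).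
Taking q quadratic around an arbitrary point carries an upper bound forward over a short time
(`exists_forward`); taking q from a Gaussian centred in an exterior ball controls a neighbourhood of
the lateral boundary (`exists_boundary`). On the remaining compact part of the cylinder consistency
is uniform (`exists_middle`). Since v is regular only for times in the open interval, the last
stretch before T is again covered by `exists_forward`; `exists_upper` assembles the pieces.

Comparison needs a bounded solution that, for almost every x, satisfies the equation at all times at
once. `IsL1Solution.exists_mild` extracts one from a weak solution, and regular solutions are a
special case because the frontier of Ω is null (`HasExteriorBalls.volume_frontier`). -/

/-! ### Moments of the kernel -/

namespace IsKernel

variable {n : ℕ} {J : Eucl n → ℝ}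

theorem map_neg (hJ : IsKernel J) (z : Eucl n) : J (-z) = J z := hJ.radial _ _ (norm_neg z)

theorem exists_radius (hJ : IsKernel J) : ∃ R > 0, ∀ z, R ≤ ‖z‖ → J z = 0 := by
  obtain ⟨R, hR⟩ := hJ.hasCompactSupport.isCompact.isBounded.exists_norm_le
  refine ⟨max R 0 + 1, by positivity, fun z hz => ?_⟩
  by_contra hne
  have := hR z (subset_tsupport J hne)
  have := le_max_left R 0
  linarith

theorem integrable_mul (hJ : IsKernel J) {g : Eucl n → ℝ} (hg : Continuous g) :
    Integrable (fun z => J z * g z) :=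
  (hJ.continuous.mul hg).integrable_of_hasCompactSupport hJ.hasCompactSupport.mul_right

theorem integrable (hJ : IsKernel J) : Integrable J :=
  hJ.continuous.integrable_of_hasCompactSupport hJ.hasCompactSupport

theorem integral_mul_odd (hJ : IsKernel J) {g : Eucl n → ℝ} (hg : ∀ z, g (-z) = -g z) :
    ∫ z, J z * g z = 0 := by
  have h := integral_neg_eq_self (fun z => J z * g z) (volume : Measure (Eucl n))
  simp only [hJ.map_neg, hg, mul_neg, integral_neg] at h
  linarith

theorem integral_comp_isometry (hJ : IsKernel J) (e : Eucl n ≃ₗᵢ[ℝ] Eucl n) (g : Eucl n → ℝ) :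
    ∫ z, J z * g (e z) = ∫ z, J z * g z := by
  have h := e.measurePreserving.integral_comp e.toHomeomorph.measurableEmbedding
    (fun z => J z * g z)
  rw [← h]
  congr 1 with z
  rw [hJ.radial (e z) z (e.norm_map z)]

/-- Both cases are invariance under isometries: a transposition carries the index i to the last one,
and reversing the sign of the i-th coordinate reverses the mixed moment, which must therefore
vanish. -/
theorem integral_mul_coord (hJ : IsKernel J) (i j : Fin (n + 1)) :
    ∫ z, J z * (z i * z j) = if i = j then secondMoment J else 0 := by
  split_ifs with hij
  · subst hij
    have h := hJ.integral_comp_isometry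
      (LinearIsometryEquiv.piLpCongrLeft 2 ℝ ℝ (Equiv.swap i (Fin.last n)))
      (fun z => z i * z i)
    rw [← h, secondMoment]
    congr 1 with z
    simp [LinearIsometryEquiv.piLpCongrLeft_apply, sq]
  · have h := hJ.integral_comp_isometry
      (LinearIsometryEquiv.piLpCongrRight 2
        (fun k => if k = i then LinearIsometryEquiv.neg ℝ else LinearIsometryEquiv.refl ℝ ℝ))
      (fun z => z i * z j)
    have h2 : ∀ z : Eucl n, (LinearIsometryEquiv.piLpCongrRight 2
        (fun k => if k = i then LinearIsometryEquiv.neg ℝ else LinearIsometryEquiv.refl ℝ ℝ) z) i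
          * (LinearIsometryEquiv.piLpCongrRight 2
        (fun k => if k = i then LinearIsometryEquiv.neg ℝ else LinearIsometryEquiv.refl ℝ ℝ) z) j
        = -(z i * z j) := by
      intro z
      have hji : j ≠ i := fun h => hij h.symm
      simp [LinearIsometryEquiv.piLpCongrRight_apply, hji]
    simp only [h2, mul_neg, integral_neg] at h
    linarith

/-- Only the diagonal second moments survive, and they are all equal, so a quadratic form averages
to a multiple of its trace. This is the source of the Laplacian. -/
theorem integral_mul_bilin (hJ : IsKernel J) (B : Eucl n →L[ℝ] Eucl n →L[ℝ] ℝ) :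
    ∫ z, J z * B z z = secondMoment J *
      ∑ i, B (EuclideanSpace.single i 1) (EuclideanSpace.single i 1) := by
  have hz : ∀ z : Eucl n, J z * B z z = ∑ i, ∑ j, (J z * (z i * z j)) *
      B (EuclideanSpace.single i 1) (EuclideanSpace.single j 1) := by
    intro z
    have h1 : z = ∑ i, z i • EuclideanSpace.single i (1 : ℝ) := by
      have := (EuclideanSpace.basisFun (Fin (n + 1)) ℝ).sum_repr z
      simpa using this.symm
    have : B z z = ∑ i, ∑ j, z i * z j *
      B (EuclideanSpace.single i 1) (EuclideanSpace.single j 1) := by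
      conv_lhs => rw [h1]
      simp only [map_sum, map_smul, sum_apply, smul_apply,
        smul_eq_mul, Finset.mul_sum]
      rw [Finset.sum_comm]
      refine Finset.sum_congr rfl fun i _ => Finset.sum_congr rfl fun j _ => by ring
    rw [this, Finset.mul_sum]
    refine Finset.sum_congr rfl fun i _ => ?_
    rw [Finset.mul_sum]
    refine Finset.sum_congr rfl fun j _ => by ring
  have hintg : ∀ i j : Fin (n + 1), Integrable (fun z : Eucl n => (J z * (z i * z j)) *
      B (EuclideanSpace.single i 1) (EuclideanSpace.single j 1)) := fun i j =>
    (hJ.integrable_mul (by fun_prop)).mul_const _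
  simp only [hz]
  rw [integral_finsetSum _ fun i _ => integrable_finsetSum _ fun j _ => hintg i j]
  simp only [integral_finsetSum _ fun j _ => hintg _ j, integral_mul_const, hJ.integral_mul_coord]
  simp [Finset.mul_sum]

theorem integral_mul_inner_sq (hJ : IsKernel J) (a : Eucl n) :
    ∫ z, J z * (inner ℝ a z) ^ 2 = secondMoment J * ‖a‖ ^ 2 := by
  have h := hJ.integral_mul_bilin ((innerSL ℝ a).smulRight (innerSL ℝ a))
  simp only [ContinuousLinearMap.smulRight_apply, smul_apply, innerSL_apply_apply,
    smul_eq_mul] at h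
  simp only [sq]
  rw [h, ← sq, EuclideanSpace.norm_sq_eq]
  simp [EuclideanSpace.inner_single_right, sq]

theorem integral_mul_norm_sq (hJ : IsKernel J) :
    ∫ z, J z * ‖z‖ ^ 2 = (n + 1) * secondMoment J := by
  have h1 : ∀ z : Eucl n, J z * ‖z‖ ^ 2 = ∑ i, J z * (z i * z i) := by
    intro z
    rw [EuclideanSpace.norm_sq_eq, Finset.mul_sum]
    simp [sq]
  simp only [h1]
  rw [integral_finsetSum _ fun i _ => hJ.integrable_mul (by fun_prop)]
  simp [hJ.integral_mul_coord]

/-- Otherwise J(z)|z|² would integrate to zero, so J would vanish almost everywhere, against its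
unit mass. -/
theorem secondMoment_pos (hJ : IsKernel J) : 0 < secondMoment J := by
  have h0 : 0 ≤ (n + 1) * secondMoment J := by
    rw [← hJ.integral_mul_norm_sq]
    exact integral_nonneg fun z => mul_nonneg (hJ.nonneg z) (by positivity)
  have hn : (0 : ℝ) < n + 1 := by positivity
  refine lt_of_le_of_ne (nonneg_of_mul_nonneg_right h0 hn) fun hzero => ?_
  have h1 : ∫ z, J z * ‖z‖ ^ 2 = 0 := by rw [hJ.integral_mul_norm_sq, ← hzero, mul_zero]
  have h2 := (integral_eq_zero_iff_of_nonneg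
    (fun z => mul_nonneg (hJ.nonneg z) (by positivity)) (hJ.integrable_mul (by fun_prop))).1 h1
  have h3 : J =ᵐ[volume] 0 := by
    have h4 : ∀ᵐ z : Eucl n, z ≠ 0 := by
      simp [ae_iff]
    filter_upwards [h2, h4] with z hz hz0
    have : ‖z‖ ^ 2 ≠ 0 := by positivity
    simpa [hz0] using hz
  have h5 := hJ.integral_eq_one
  rw [integral_congr_ae h3] at h5
  simp at h5

end IsKernel

/-! ### The rescaled kernel -/

section Rescaled

variable {n : ℕ} {J : Eucl n → ℝ} {ε : ℝ}

/-- The substitution y = x + εz: its Jacobian cancels the factor in the rescaled kernel, and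
evenness of J removes the sign. -/
theorem integral_rescaledKernel (hJ : IsKernel J) (hε : 0 < ε) (x : Eucl n) (f : Eucl n → ℝ) :
    ∫ y, rescaledKernel J ε (x - y) * f y = ∫ z, J z * f (x + ε • z) := by
  have h1 := Measure.integral_comp_smul (volume : Measure (Eucl n))
    (fun y => rescaledKernel J ε y * f (x + y)) ε
  have h2 : ∫ y, rescaledKernel J ε (x - y) * f y
      = ∫ y, rescaledKernel J ε y * f (x + y) := by
    rw [← integral_add_left_eq_self (fun y => rescaledKernel J ε (x - y) * f y) x]
    congr 1 with y
    simp [rescaledKernel, hJ.map_neg]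
  have h3 : ∀ z, rescaledKernel J ε (ε • z) * f (x + ε • z)
      = (ε ^ (n + 1))⁻¹ * (J z * f (x + ε • z)) := by
    intro z
    simp [rescaledKernel, smul_smul, hε.ne', mul_assoc]
  have hp : 0 < (ε ^ (n + 1))⁻¹ := by positivity
  simp only [h3, integral_const_mul, finrank_euclideanSpace, Fintype.card_fin, smul_eq_mul,
    abs_of_pos hp] at h1
  rw [h2]
  exact (mul_left_cancel₀ hp.ne' h1).symm

theorem tsupport_rescaledKernel (hε : 0 < ε) :
    tsupport (rescaledKernel J ε) = {z | ε⁻¹ • z ∈ tsupport J} := by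
  have h1 : Function.support (rescaledKernel J ε) = (fun z => ε⁻¹ • z) ⁻¹' Function.support J := by
    ext z
    simp [rescaledKernel, hε.ne']
  have h2 : (fun z : Eucl n => ε⁻¹ • z) = (Homeomorph.smulOfNeZero ε⁻¹ (inv_ne_zero hε.ne')) := rfl
  rw [tsupport, h1, h2, ← Homeomorph.preimage_closure]
  rfl

theorem add_mem_reach (hε : 0 < ε) {Ω : Set (Eucl n)} {x z : Eucl n}
    (hx : x ∈ Ω) (hz : J z ≠ 0) : x + ε • z ∈ reach Ω (rescaledKernel J ε) := by
  refine Set.add_mem_add hx ?_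
  rw [tsupport_rescaledKernel hε, mem_ofPred_eq, smul_smul, inv_mul_cancel₀ hε.ne', one_smul]
  exact subset_tsupport J hz

theorem mem_reach_of_ne_zero (hJ : IsKernel J) {Ω : Set (Eucl n)} {x y : Eucl n}
    (hx : x ∈ Ω) (hy : rescaledKernel J ε (x - y) ≠ 0) : y ∈ reach Ω (rescaledKernel J ε) := by
  have : y = x + (y - x) := by abel
  rw [this]
  refine Set.add_mem_add hx (subset_tsupport _ ?_)
  rw [Function.mem_support]
  convert hy using 1
  simp only [rescaledKernel]
  rw [← hJ.map_neg, ← smul_neg, neg_sub]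

theorem exists_of_mem_reach {R : ℝ} (hε : 0 < ε) (hR : ∀ z, R ≤ ‖z‖ → J z = 0)
    {Ω : Set (Eucl n)} {y : Eucl n} (hy : y ∈ reach Ω (rescaledKernel J ε)) :
    ∃ x ∈ Ω, ‖y - x‖ ≤ ε * R := by
  obtain ⟨x, hx, z, hz, rfl⟩ := hy
  refine ⟨x, hx, ?_⟩
  rw [tsupport_rescaledKernel hε, mem_ofPred_eq] at hz
  have hsub : tsupport J ⊆ Metric.closedBall 0 R := by
    refine closure_minimal (fun w hw => ?_) Metric.isClosed_closedBall
    rw [mem_closedBall_zero_iff]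
    by_contra hlt
    exact hw (hR w (not_le.1 hlt).le)
  have := hsub hz
  rw [mem_closedBall_zero_iff, norm_smul, norm_inv, Real.norm_of_nonneg hε.le,
    inv_mul_le_iff₀ hε] at this
  simpa using this

theorem isOpen_reach {Ω : Set (Eucl n)} (hΩ : IsOpen Ω) (k : Eucl n → ℝ) : IsOpen (reach Ω k) :=
  hΩ.add_right

theorem continuous_rescaledKernel (hJ : IsKernel J) : Continuous (rescaledKernel J ε) := by
  have := hJ.continuous
  unfold rescaledKernel
  fun_prop

theorem rescaledKernel_nonneg (hJ : IsKernel J) (hε : 0 < ε) (z : Eucl n) :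
    0 ≤ rescaledKernel J ε z :=
  mul_nonneg (by positivity) (hJ.nonneg _)

theorem hasCompactSupport_rescaledKernel (hJ : IsKernel J) (hε : 0 < ε) :
    HasCompactSupport (rescaledKernel J ε) := by
  rw [HasCompactSupport, tsupport_rescaledKernel hε]
  exact (Homeomorph.smulOfNeZero ε⁻¹ (inv_ne_zero hε.ne')).isCompact_preimage.2
    hJ.hasCompactSupport

end Rescaled

/-! ### The normalised nonlinearity -/

noncomputable section

/-- The flux `s ↦ C(x) G(x,s) s`, where `C(x)⁻¹ = ½ C(J) G(x,0)`. -/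
def flux {n : ℕ} (J : Eucl n → ℝ) (G : Eucl n → ℝ → ℝ) (x : Eucl n) (s : ℝ) : ℝ :=
  (1 / 2 * secondMoment J * G x 0)⁻¹ * G x s * s

end

/-- Slopes in `[l₁, l₂]`, and a quadratic expansion `c₀ (s + (m/2) s²)` at the origin with an error
of order `2 + α`. -/
structure FluxBounds (c₀ α l₁ l₂ K m₀ : ℝ) (Φ : ℝ → ℝ) (m : ℝ) : Prop where
  map_zero : Φ 0 = 0
  lower : ∀ s σ, s ≤ σ → l₁ * (σ - s) ≤ Φ σ - Φ s
  upper : ∀ s σ, s ≤ σ → Φ σ - Φ s ≤ l₂ * (σ - s)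
  expansion : ∀ s, |s| ≤ 1 → |Φ s - c₀ * (s + m / 2 * s ^ 2)| ≤ K * |s| ^ (2 + α)
  abs_le : |m| ≤ m₀

namespace FluxBounds

variable {c₀ α l₁ l₂ K m₀ m : ℝ} {Φ : ℝ → ℝ}

/-- The reflection that reduces every lower bound on solutions to an upper bound: it preserves the
slopes and changes the sign of the quadratic coefficient only. -/
theorem neg (h : FluxBounds c₀ α l₁ l₂ K m₀ Φ m) :
    FluxBounds c₀ α l₁ l₂ K m₀ (fun s => -Φ (-s)) (-m) where
  map_zero := by simp [h.map_zero]
  lower s σ hs := by have := h.lower (-σ) (-s) (by linarith); linarith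
  upper s σ hs := by have := h.upper (-σ) (-s) (by linarith); linarith
  expansion s hs := by
    have := h.expansion (-s) (by rwa [abs_neg])
    rw [abs_neg] at this
    rw [← abs_neg]
    convert this using 2
    ring
  abs_le := by rw [abs_neg]; exact h.abs_le

theorem monotone (h : FluxBounds c₀ α l₁ l₂ K m₀ Φ m) (hl : 0 ≤ l₁) : Monotone Φ := by
  intro s σ hs
  have := h.lower s σ hs
  nlinarith [mul_nonneg hl (sub_nonneg.2 hs)]

theorem abs_sub_le (h : FluxBounds c₀ α l₁ l₂ K m₀ Φ m) (hl : 0 ≤ l₁) (s σ : ℝ) :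
    |Φ σ - Φ s| ≤ l₂ * |σ - s| := by
  rcases le_total s σ with hs | hs
  · rw [abs_of_nonneg (sub_nonneg.2 (h.monotone hl hs)), abs_of_nonneg (sub_nonneg.2 hs)]
    exact h.upper s σ hs
  · rw [abs_of_nonpos (sub_nonpos.2 (h.monotone hl hs)), abs_of_nonpos (sub_nonpos.2 hs)]
    have := h.upper σ s hs
    linarith

theorem l₂_nonneg (h : FluxBounds c₀ α l₁ l₂ K m₀ Φ m) (hl : 0 ≤ l₁) : 0 ≤ l₂ := by
  have := h.abs_sub_le hl 0 1
  have h2 := abs_nonneg (Φ 1 - Φ 0)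
  norm_num at this
  linarith

theorem continuous (h : FluxBounds c₀ α l₁ l₂ K m₀ Φ m) (hl : 0 ≤ l₁) : Continuous Φ := by
  have : LipschitzWith l₂.toNNReal Φ := by
    refine LipschitzWith.of_dist_le_mul fun s σ => ?_
    rw [Real.dist_eq, Real.dist_eq, Real.coe_toNNReal _ (h.l₂_nonneg hl)]
    exact h.abs_sub_le hl σ s
  exact this.continuous

theorem abs_apply_le (h : FluxBounds c₀ α l₁ l₂ K m₀ Φ m) (hl : 0 ≤ l₁) (s : ℝ) :
    |Φ s| ≤ l₂ * |s| := by
  simpa [h.map_zero] using h.abs_sub_le hl 0 s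

end FluxBounds

theorem abs_taylor_one_le {f : ℝ → ℝ} (hf : ContDiff ℝ 1 f) {α L : ℝ} (hα : 0 < α) (hL : 0 ≤ L)
    (hH : ∀ s ∈ Icc (-1 : ℝ) 1, ∀ σ ∈ Icc (-1 : ℝ) 1,
      |deriv f s - deriv f σ| ≤ L * |s - σ| ^ α) {s : ℝ} (hs : |s| ≤ 1) :
    |f s - f 0 - deriv f 0 * s| ≤ L * |s| ^ α * |s| := by
  have hd : ∀ t, HasDerivAt f (deriv f t) t := fun t =>
    (hf.differentiable one_ne_zero t).hasDerivAt
  have hsub : ∀ t ∈ uIcc 0 s, |t| ≤ |s| := fun t ht => by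
    have := abs_sub_left_of_mem_uIcc ht
    simpa using this
  have key := (convex_uIcc 0 s).norm_image_sub_le_of_norm_hasDerivWithin_le
    (f := fun t => f t - deriv f 0 * t) (f' := fun t => deriv f t - deriv f 0 * 1)
    (C := L * |s| ^ α) (x := 0) (y := s)
    (fun t _ => ((hd t).sub ((hasDerivAt_id t).const_mul _)).hasDerivWithinAt)
    (fun t ht => by
      have h1 := hsub t ht
      have h2 := hH t (abs_le.1 (h1.trans hs)) 0 (by simp)
      rw [Real.norm_eq_abs, mul_one]
      refine h2.trans ?_
      rw [sub_zero]
      gcongr) left_mem_uIcc right_mem_uIcc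
  simp only [Real.norm_eq_abs, mul_zero, sub_zero] at key
  convert key using 2
  ring

/-- The normalisation C(x)G(x,0) = 2/C(J) makes the linear coefficient independent of x, and μ is
exactly the ratio that makes the quadratic coefficient μ/2 times the linear one. Slopes of the flux
are those of s ↦ G(x,s)s times C(x), which is itself bounded above and below. -/
theorem exists_fluxBounds {n : ℕ} {α : ℝ} (hα : 0 < α) {Ω : Set (Eucl n)} {J : Eucl n → ℝ}
    (hJ : IsKernel J) {G : Eucl n → ℝ → ℝ} (hGm : StronglyMonotone Ω G) (hGs : C1HolderInS α Ω G)
    {μ : Eucl n → ℝ} (hμ : ∀ᵐ x ∂volume.restrict Ω, μ x = 2 * deriv (G x) 0 / G x 0) :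
    ∃ l₁ > 0, ∃ l₂ ≥ 0, ∃ K ≥ 0, ∃ m₀ ≥ 0, ∀ᵐ x ∂volume.restrict Ω,
      FluxBounds (2 / secondMoment J) α l₁ l₂ K m₀ (flux J G x) (μ x) := by
  obtain ⟨α₁, α₂, hα₁, hα₁₂, hmon⟩ := hGm
  obtain ⟨hC1, hH⟩ := hGs
  obtain ⟨L, hL⟩ := hH 1 one_pos
  have hc := hJ.secondMoment_pos
  set c := secondMoment J with hcdef
  have hα₂ : 0 < α₂ := by linarith
  refine ⟨2 / (c * α₂) * α₁, by positivity, 2 / (c * α₁) * α₂, by positivity,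
    2 / (c * α₁) * |L|, by positivity, 2 * (α₂ - α₁ + |L|) / α₁,
    div_nonneg (by have := abs_nonneg L; linarith) hα₁.le, ?_⟩
  filter_upwards [hmon, hC1, hL, hμ] with x hx1 hx2 hx3 hx4
  -- Strong monotonicity with σ = 0 bounds G(x,s) for s ≠ 0; the value at 0 follows by continuity.
  have hG : ∀ s, G x s ∈ Icc α₁ α₂ := by
    have h1 : ∀ s, s ≠ 0 → G x s ∈ Icc α₁ α₂ := by
      intro s hs
      have := hx1 s 0 hs
      simpa [mul_div_assoc, div_self hs] using this
    intro s
    have hd : Dense ({0}ᶜ : Set ℝ) := dense_compl_singleton 0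
    have := hd.closure_eq ▸ mem_univ s
    exact closure_minimal (fun t ht => h1 t ht) (isClosed_Icc.preimage hx2.continuous) this
  have hG0 := hG 0
  have hG0p : 0 < G x 0 := hα₁.trans_le hG0.1
  have hCl : 2 / (c * α₂) ≤ (1 / 2 * c * G x 0)⁻¹ := by
    rw [show 2 / (c * α₂) = (1 / 2 * c * α₂)⁻¹ by field_simp]
    gcongr
    exact hG0.2
  have hCu : (1 / 2 * c * G x 0)⁻¹ ≤ 2 / (c * α₁) := by
    rw [show 2 / (c * α₁) = (1 / 2 * c * α₁)⁻¹ by field_simp]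
    gcongr
    exact hG0.1
  have hC0 : 0 < (1 / 2 * c * G x 0)⁻¹ := by positivity
  have hslope : ∀ s σ, s ≤ σ → α₁ * (σ - s) ≤ G x σ * σ - G x s * s ∧
      G x σ * σ - G x s * s ≤ α₂ * (σ - s) := by
    intro s σ hs
    rcases hs.eq_or_lt with rfl | hs
    · simp
    · have h := hx1 σ s hs.ne'
      have hp : 0 < σ - s := by linarith
      rwa [le_div_iff₀ hp, div_le_iff₀ hp] at h
  have hH' : ∀ s ∈ Icc (-1 : ℝ) 1, ∀ σ ∈ Icc (-1 : ℝ) 1,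
      |deriv (G x) s - deriv (G x) σ| ≤ |L| * |s - σ| ^ α := fun s hs σ hσ =>
    (hx3 s hs σ hσ).trans (by gcongr; exact le_abs_self L)
  have hT := fun {s : ℝ} (hs : |s| ≤ 1) => abs_taylor_one_le hx2 hα (abs_nonneg L) hH' hs
  refine ⟨by simp [flux], fun s σ hs => ?_, fun s σ hs => ?_, fun s hs => ?_, ?_⟩
  · have := (hslope s σ hs).1
    have e : flux J G x σ - flux J G x s
        = (1 / 2 * c * G x 0)⁻¹ * (G x σ * σ - G x s * s) := by simp only [flux]; ring
    rw [e, mul_assoc (2 / (c * α₂))]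
    exact mul_le_mul hCl this (mul_nonneg hα₁.le (sub_nonneg.2 hs)) hC0.le
  · have h1 := (hslope s σ hs).1
    have h2 := (hslope s σ hs).2
    have e : flux J G x σ - flux J G x s
        = (1 / 2 * c * G x 0)⁻¹ * (G x σ * σ - G x s * s) := by simp only [flux]; ring
    rw [e, mul_assoc (2 / (c * α₁))]
    exact mul_le_mul hCu h2 ((mul_nonneg hα₁.le (sub_nonneg.2 hs)).trans h1) (by positivity)
  · have e : flux J G x s - 2 / c * (s + μ x / 2 * s ^ 2)
        = (1 / 2 * c * G x 0)⁻¹ * s * (G x s - G x 0 - deriv (G x) 0 * s) := by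
      simp only [flux, hx4, ← hcdef]
      field_simp
      ring
    rw [e, abs_mul, abs_mul, abs_of_pos hC0]
    rcases eq_or_ne s 0 with rfl | hs0
    · simp [Real.zero_rpow (by linarith : 2 + α ≠ 0)]
    have hsp : 0 < |s| := abs_pos.2 hs0
    rw [Real.rpow_add hsp, Real.rpow_two]
    calc _ ≤ 2 / (c * α₁) * |s| * (|L| * |s| ^ α * |s|) := by
          gcongr
          exact hT hs
      _ = _ := by ring
  -- The Taylor estimate at s = 1 bounds the derivative at 0, because both values of G lie in [α₁,
  -- α₂]; this bounds μ.
  · have h1 := hT (s := 1) (by simp)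
    simp only [abs_one, Real.one_rpow, mul_one] at h1
    have hG1 := hG 1
    have h2 : |deriv (G x) 0| ≤ α₂ - α₁ + |L| := by
      rw [abs_le] at h1 ⊢
      constructor <;> linarith [hG1.1, hG1.2, hG0.1, hG0.2, h1.1, h1.2]
    rw [hx4, abs_div, abs_mul, abs_two, abs_of_pos hG0p]
    gcongr
    exact hG0.1

/-! ### Consistency of the nonlocal operator -/

/-- `w` has at `x` the second-order Taylor polynomial with gradient `a` and Hessian `B`, with all
quantities, including the remainder of order `2 + α` on the ball of radius `r`, bounded by `L`. -/
structure HasTaylorBound {n : ℕ} (α r L : ℝ) (w : Eucl n → ℝ) (x a : Eucl n)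
    (B : Eucl n →L[ℝ] Eucl n →L[ℝ] ℝ) : Prop where
  norm_le : ‖a‖ ≤ L
  norm_hess_le : ‖B‖ ≤ L
  remainder : ∀ z, ‖z‖ < r →
    |w (x + z) - w x - inner ℝ a z - 1 / 2 * B z z| ≤ L * ‖z‖ ^ (2 + α)

/-- Here ρ is the length of a jump, p and b are the first- and second-order terms of the increment
s. Replacing s² by p² costs O(ρ³), which is O(ρ^(2+α)) because α < 1 and ρ ≤ 1. The condition on 3Lρ
keeps s in [-1,1], where the expansion of Φ is available. -/
theorem FluxBounds.abs_sub_quadratic_le {c₀ α l₁ l₂ K m₀ m : ℝ} {Φ : ℝ → ℝ}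
    (hΦ : FluxBounds c₀ α l₁ l₂ K m₀ Φ m) (hα : α ∈ Ioo (0 : ℝ) 1) (hc : 0 ≤ c₀) (hK : 0 ≤ K)
    {L ρ s p b : ℝ} (hL : 0 ≤ L) (hρ : 0 ≤ ρ) (hρ1 : ρ ≤ 1) (hρL : 3 * L * ρ ≤ 1)
    (hp : |p| ≤ L * ρ) (hb : |b| ≤ L * ρ ^ 2) (hs : |s - p - 1 / 2 * b| ≤ L * ρ ^ (2 + α)) :
    |Φ s - c₀ * (p + 1 / 2 * b + m / 2 * p ^ 2)|
      ≤ (K * (3 * L) ^ (2 + α) + c₀ * (L + 4 * m₀ * L ^ 2)) * ρ ^ (2 + α) := by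
  have hpow2 : ρ ^ (2 + α) ≤ ρ ^ 2 := by
    rw [← Real.rpow_two]
    exact Real.rpow_le_rpow_of_exponent_ge' hρ hρ1 (by norm_num) (by linarith [hα.1])
  have hpow3 : ρ ^ 3 ≤ ρ ^ (2 + α) := by
    rw [← Real.rpow_natCast]
    exact Real.rpow_le_rpow_of_exponent_ge' hρ hρ1 (by linarith [hα.1]) (by norm_num; linarith [hα.2])
  have hρ2 : ρ ^ 2 ≤ ρ := by nlinarith
  have hs2 : |s - p - 1 / 2 * b| ≤ L * ρ ^ 2 := hs.trans (by gcongr)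
  have hsp : |s - p| ≤ 2 * L * ρ ^ 2 := by
    have : s - p = (s - p - 1 / 2 * b) + 1 / 2 * b := by ring
    rw [this]
    refine (abs_add_le _ _).trans ?_
    rw [abs_mul, abs_of_pos (by norm_num : (0:ℝ) < 1 / 2)]
    nlinarith [abs_nonneg b]
  have hsabs : |s| ≤ 3 * L * ρ := by
    have : s = (s - p) + p := by ring
    rw [this]
    refine (abs_add_le _ _).trans ?_
    nlinarith
  have hsp' : |s + p| ≤ 4 * L * ρ := (abs_add_le _ _).trans (by linarith)
  have hsq : |s ^ 2 - p ^ 2| ≤ 8 * L ^ 2 * ρ ^ 3 := by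
    have : s ^ 2 - p ^ 2 = (s - p) * (s + p) := by ring
    rw [this, abs_mul]
    calc _ ≤ (2 * L * ρ ^ 2) * (4 * L * ρ) := by gcongr
      _ = _ := by ring
  have hE := hΦ.expansion s (hsabs.trans hρL)
  have hm0 : 0 ≤ m₀ := (abs_nonneg m).trans hΦ.abs_le
  have h1 : |s| ^ (2 + α) ≤ (3 * L) ^ (2 + α) * ρ ^ (2 + α) := by
    rw [← Real.mul_rpow (by positivity) hρ]
    exact Real.rpow_le_rpow (abs_nonneg s) hsabs (by linarith [hα.1])
  have e : Φ s - c₀ * (p + 1 / 2 * b + m / 2 * p ^ 2)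
      = (Φ s - c₀ * (s + m / 2 * s ^ 2))
        + c₀ * ((s - p - 1 / 2 * b) + m / 2 * (s ^ 2 - p ^ 2)) := by ring
  rw [e]
  have h2 : |(s - p - 1 / 2 * b) + m / 2 * (s ^ 2 - p ^ 2)|
      ≤ L * ρ ^ (2 + α) + m₀ / 2 * (8 * L ^ 2 * ρ ^ 3) := by
    refine (abs_add_le _ _).trans (add_le_add hs ?_)
    rw [abs_mul, abs_div, abs_two]
    have := hΦ.abs_le
    gcongr
  calc _ ≤ K * |s| ^ (2 + α) + c₀ * (L * ρ ^ (2 + α) + m₀ / 2 * (8 * L ^ 2 * ρ ^ 3)) := by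
        refine (abs_add_le _ _).trans (add_le_add hE ?_)
        rw [abs_mul, abs_of_nonneg hc]
        gcongr
    _ ≤ K * ((3 * L) ^ (2 + α) * ρ ^ (2 + α))
        + c₀ * (L * ρ ^ (2 + α) + m₀ / 2 * (8 * L ^ 2 * ρ ^ (2 + α))) := by gcongr
    _ = _ := by ring

/-- Consistency: the pointwise expansion has an error of order ε^(2+α), and the quadratic model
integrates exactly against J. Dividing by ε² leaves ε^α. -/
theorem abs_jump_sub_le {n : ℕ} {α : ℝ} (hα : α ∈ Ioo (0 : ℝ) 1) {J : Eucl n → ℝ}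
    (hJ : IsKernel J) {R : ℝ} (hR : 0 < R) (hJR : ∀ z, R ≤ ‖z‖ → J z = 0)
    {l₁ l₂ K m₀ : ℝ} (hK : 0 ≤ K) {L : ℝ} (hL : 0 ≤ L)
    {Φ : ℝ → ℝ} {m : ℝ} (hΦ : FluxBounds (2 / secondMoment J) α l₁ l₂ K m₀ Φ m)
    {r ε : ℝ} {w : Eucl n → ℝ} {x a : Eucl n} {B : Eucl n →L[ℝ] Eucl n →L[ℝ] ℝ}
    (hw : HasTaylorBound α r L w x a B) (hε : 0 < ε) (hε1 : ε * R ≤ 1) (hεL : 3 * L * (ε * R) ≤ 1)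
    (hεr : ε * R ≤ r)
    (hmeas : AEStronglyMeasurable (fun z => J z * Φ (w (x + ε • z) - w x))) :
    |(ε ^ 2)⁻¹ * (∫ z, J z * Φ (w (x + ε • z) - w x))
      - (∑ i, B (EuclideanSpace.single i 1) (EuclideanSpace.single i 1) + m * ‖a‖ ^ 2)|
      ≤ (K * (3 * L) ^ (2 + α) + 2 / secondMoment J * (L + 4 * m₀ * L ^ 2)) * R ^ (2 + α)
        * ε ^ α := by
  have hc := hJ.secondMoment_pos
  set c := secondMoment J with hcdef
  set C := K * (3 * L) ^ (2 + α) + 2 / c * (L + 4 * m₀ * L ^ 2) with hCdef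
  have hm0 : 0 ≤ m₀ := (abs_nonneg m).trans hΦ.abs_le
  have hC : 0 ≤ C := by positivity
  set q : Eucl n → ℝ := fun z => 2 / c * (inner ℝ a (ε • z) + 1 / 2 * B (ε • z) (ε • z)
    + m / 2 * (inner ℝ a (ε • z)) ^ 2) with hq
  have hqint : Integrable (fun z => J z * q z) := hJ.integrable_mul (by simp only [hq]; fun_prop)
  have hpt : ∀ z, |J z * Φ (w (x + ε • z) - w x) - J z * q z|
      ≤ J z * (C * (ε * R) ^ (2 + α)) := by
    intro z
    rw [← mul_sub, abs_mul, abs_of_nonneg (hJ.nonneg z)]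
    rcases le_or_gt R ‖z‖ with hz | hz
    · simp [hJR z hz]
    refine mul_le_mul_of_nonneg_left ?_ (hJ.nonneg z)
    have hnorm : ‖ε • z‖ = ε * ‖z‖ := by rw [norm_smul, Real.norm_of_nonneg hε.le]
    have hle : ε * ‖z‖ ≤ ε * R := by gcongr
    have hlt : ε * ‖z‖ < ε * R := by gcongr
    have := hΦ.abs_sub_quadratic_le hα (by positivity) hK hL (ρ := ε * ‖z‖) (s := w (x + ε • z) - w x)
      (p := inner ℝ a (ε • z)) (b := B (ε • z) (ε • z)) (by positivity) (hle.trans hε1)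
      ((by gcongr : 3 * L * (ε * ‖z‖) ≤ 3 * L * (ε * R)).trans hεL)
      (by
        rw [← hnorm]
        exact (abs_real_inner_le_norm _ _).trans (by gcongr; exact hw.norm_le))
      (by
        rw [← hnorm, sq, ← mul_assoc]
        exact (B.le_opNorm₂ _ _).trans (by gcongr; exact hw.norm_hess_le))
      (by rw [← hnorm]; exact hw.remainder _ (by rw [hnorm]; linarith))
    refine this.trans ?_
    gcongr
    linarith [hα.1]
  have hdom : Integrable (fun z => J z * (C * (ε * R) ^ (2 + α))) := hJ.integrable.mul_const _
  have hdiff : Integrable (fun z => J z * Φ (w (x + ε • z) - w x) - J z * q z) :=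
    hdom.mono' (hmeas.sub hqint.1) (Eventually.of_forall hpt)
  have hfint : Integrable (fun z => J z * Φ (w (x + ε • z) - w x)) := by
    refine (hdiff.add hqint).congr (Eventually.of_forall fun z => ?_)
    simp
  have hI : |∫ z, (J z * Φ (w (x + ε • z) - w x) - J z * q z)| ≤ C * (ε * R) ^ (2 + α) := by
    have := norm_integral_le_of_norm_le (f := fun z => J z * Φ (w (x + ε • z) - w x) - J z * q z)
      hdom (Eventually.of_forall hpt)
    rwa [integral_mul_const, hJ.integral_eq_one, one_mul] at this
  -- The linear term is odd and drops out, the Hessian gives its trace, and the squared gradient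
  -- term gives m‖a‖²; the factor 2/c compensates the second moment.
  have hqval : ∫ z, J z * q z = ε ^ 2 *
      (∑ i, B (EuclideanSpace.single i 1) (EuclideanSpace.single i 1) + m * ‖a‖ ^ 2) := by
    have e : ∀ z, J z * q z = (2 / c * ε) * (J z * inner ℝ a z) + (1 / c * ε ^ 2) * (J z * B z z)
        + (m / c * ε ^ 2) * (J z * (inner ℝ a z) ^ 2) := by
      intro z
      simp only [hq, inner_smul_right, map_smul, smul_apply, smul_eq_mul]
      ring
    simp only [e]
    have i1 : Integrable (fun z => (2 / c * ε) * (J z * inner ℝ a z)) :=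
      (hJ.integrable_mul (by fun_prop)).const_mul _
    have i2 : Integrable (fun z => (1 / c * ε ^ 2) * (J z * B z z)) :=
      (hJ.integrable_mul (by fun_prop)).const_mul _
    have i3 : Integrable (fun z => (m / c * ε ^ 2) * (J z * (inner ℝ a z) ^ 2)) :=
      (hJ.integrable_mul (by fun_prop)).const_mul _
    have i12 : Integrable (fun z => (2 / c * ε) * (J z * inner ℝ a z)
        + (1 / c * ε ^ 2) * (J z * B z z)) := i1.add i2
    rw [integral_add i12 i3, integral_add i1 i2, integral_const_mul, integral_const_mul,
      integral_const_mul, hJ.integral_mul_bilin, hJ.integral_mul_inner_sq,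
      hJ.integral_mul_odd (fun z => by simp), ← hcdef]
    field_simp
    ring
  rw [integral_sub hfint hqint, hqval] at hI
  have hε2 : 0 < ε ^ 2 := by positivity
  set I := ∫ z, J z * Φ (w (x + ε • z) - w x)
  set D := (∑ i, B (EuclideanSpace.single i 1) (EuclideanSpace.single i 1) + m * ‖a‖ ^ 2)
  have e : (ε ^ 2)⁻¹ * I - D = (ε ^ 2)⁻¹ * (I - ε ^ 2 * D) := by field_simp
  rw [e, abs_mul, abs_of_pos (by positivity : 0 < (ε ^ 2)⁻¹)]
  calc _ ≤ (ε ^ 2)⁻¹ * (C * (ε * R) ^ (2 + α)) := by gcongr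
    _ = _ := by
      rw [Real.mul_rpow hε.le hR.le, Real.rpow_add hε, Real.rpow_two]
      field_simp

/-! ### Comparison -/

noncomputable section

/-- `∫_S k(x-y) Φ(x, w(y)-w(x)) dy`. -/
def jumpOp {n : ℕ} (S : Set (Eucl n)) (k : Eucl n → ℝ) (Φ : Eucl n → ℝ → ℝ) (w : Eucl n → ℝ)
    (x : Eucl n) : ℝ :=
  ∫ y in S, k (x - y) * Φ x (w y - w x)

end

section Comparison

variable {n : ℕ} {S D : Set (Eucl n)} {k : Eucl n → ℝ} {Φ : Eucl n → ℝ → ℝ}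

theorem integrable_comp_sub {k : Eucl n → ℝ} (hkc : Continuous k) (hks : HasCompactSupport k)
    (x : Eucl n) : Integrable (fun y => k (x - y)) :=
  (hkc.integrable_of_hasCompactSupport hks).comp_sub_left x

theorem integrableOn_jump (hkc : Continuous k) (hks : HasCompactSupport k) {x : Eucl n}
    {l B : ℝ} (hl : 0 ≤ l) (hΦc : Continuous (Φ x)) (hΦ : ∀ s σ, |Φ x σ - Φ x s| ≤ l * |σ - s|)
    {w : Eucl n → ℝ} (hw : AEStronglyMeasurable w (volume.restrict S))
    (hB : ∀ᵐ y ∂volume.restrict S, |w y| ≤ B) :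
    IntegrableOn (fun y => k (x - y) * Φ x (w y - w x)) S := by
  refine Integrable.mul_bdd (c := |Φ x 0| + l * (B + |w x|))
    (integrable_comp_sub hkc hks x).integrableOn ?_ ?_
  · exact hΦc.comp_aestronglyMeasurable (hw.sub aestronglyMeasurable_const)
  · filter_upwards [hB] with y hy
    have h1 := hΦ 0 (w y - w x)
    have h2 : |w y - w x| ≤ B + |w x| := (abs_sub _ _).trans (by linarith)
    have h3 : |Φ x (w y - w x)| ≤ |Φ x 0| + |Φ x (w y - w x) - Φ x 0| := by
      have := abs_add_le (Φ x 0) (Φ x (w y - w x) - Φ x 0)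
      simpa using this
    rw [sub_zero] at h1
    rw [Real.norm_eq_abs]
    have := mul_le_mul_of_nonneg_left h2 hl
    linarith

/-- A contraction in the weighted norm with weight exp(-2κl(t-a)): monotonicity of Φ lets an upper
bound for u - w over all of S be halved at each x separately, by following x from the last time at
which u ≤ w. Only measurability of time slices is needed. The set D where the equation is used may
be smaller than Ω; elsewhere the ordering is assumed. -/
theorem comparison {a b B κ l : ℝ} (hab : a < b) (hB : 0 ≤ B) (hl : 0 ≤ l)
    (hD : MeasurableSet D) (hDS : D ⊆ S)
    (hkc : Continuous k) (hks : HasCompactSupport k) (hk0 : ∀ z, 0 ≤ k z)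
    (hkm : ∀ x ∈ D, ∫ y in S, k (x - y) ≤ κ)
    (hΦ : ∀ᵐ x ∂volume.restrict D, Continuous (Φ x) ∧ Monotone (Φ x) ∧
      ∀ s σ, |Φ x σ - Φ x s| ≤ l * |σ - s|)
    {u w : Eucl n → ℝ → ℝ}
    (hum : ∀ t ∈ Ioo a b, AEStronglyMeasurable (fun y => u y t) (volume.restrict S))
    (hub : ∀ t ∈ Ioo a b, ∀ᵐ y ∂volume.restrict S, |u y t| ≤ B)
    (hwm : ∀ t ∈ Ioo a b, AEStronglyMeasurable (fun y => w y t) (volume.restrict S))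
    (hwb : ∀ t ∈ Ioo a b, ∀ᵐ y ∂volume.restrict S, |w y t| ≤ B)
    (hu : ∀ᵐ x ∂volume.restrict D,
      IntervalIntegrable (fun τ => jumpOp S k Φ (fun y => u y τ) x) volume a b ∧
      ∀ t ∈ Icc a b, u x t = u x a + ∫ τ in a..t, jumpOp S k Φ (fun y => u y τ) x)
    (hw : ∀ᵐ x ∂volume.restrict D, ContinuousOn (w x) (Icc a b) ∧
      ∀ t ∈ Ioo a b, ∃ w', HasDerivAt (w x) w' t ∧ jumpOp S k Φ (fun y => w y t) x ≤ w')
    (hext : ∀ t ∈ Ioo a b, ∀ᵐ y ∂volume.restrict (S \ D), u y t ≤ w y t)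
    (hinit : ∀ᵐ x ∂volume.restrict D, u x a ≤ w x a) :
    ∀ᵐ x ∂volume.restrict D, ∀ t ∈ Icc a b, u x t ≤ w x t := by
  have hcont : ∀ᵐ x ∂volume.restrict D, ContinuousOn (u x) (Icc a b) := by
    filter_upwards [hu] with x hx
    have h1 := intervalIntegral.continuousOn_primitive_interval' hx.1 left_mem_uIcc
    rw [uIcc_of_le hab.le] at h1
    exact (continuousOn_const.add h1).congr hx.2
  have hDae : ∀ᵐ x ∂volume.restrict D, x ∈ D := ae_restrict_mem hD
  have hκ : D.Nonempty → 0 ≤ κ := fun ⟨x, hx⟩ =>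
    (integral_nonneg fun y => hk0 _).trans (hkm x hx)
  -- The operator contributes the Lipschitz factor κl while the exponential grows at rate 2κl;
  -- integration in time produces the factor 1/2 at each step.
  have claim : ∀ N : ℕ, ∀ t ∈ Ioo a b, ∀ᵐ x ∂volume.restrict D,
      u x t - w x t ≤ 2 * B * (1 / 2) ^ N * Real.exp (2 * (κ * l) * (t - a)) := by
    intro N
    induction N with
    | zero =>
      intro t ht
      filter_upwards [ae_restrict_of_ae_restrict_of_subset hDS (hub t ht),
        ae_restrict_of_ae_restrict_of_subset hDS (hwb t ht), hDae] with x h1 h2 h3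
      have hκ0 := hκ ⟨x, h3⟩
      have h4 : 1 ≤ Real.exp (2 * (κ * l) * (t - a)) := by
        rw [Real.one_le_exp_iff]
        exact mul_nonneg (by positivity) (by linarith [ht.1])
      have h5 := (abs_le.1 h1).2
      have h6 := (abs_le.1 h2).1
      simp only [pow_zero, mul_one]
      nlinarith
    | succ N ih =>
      set M := 2 * B * (1 / 2) ^ N with hM
      have hM0 : 0 ≤ M := by positivity
      have hzall : ∀ τ ∈ Ioo a b, ∀ᵐ y ∂volume.restrict S,
          u y τ - w y τ ≤ M * Real.exp (2 * (κ * l) * (τ - a)) := by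
        intro τ hτ
        have hunion : S = D ∪ (S \ D) := (union_sdiff_cancel hDS).symm
        rw [hunion, ae_restrict_union_iff]
        refine ⟨ih τ hτ, ?_⟩
        filter_upwards [hext τ hτ] with y hy
        have : 0 ≤ M * Real.exp (2 * (κ * l) * (τ - a)) := by positivity
        linarith
      have hall : ∀ᵐ x ∂volume.restrict D, ∀ t ∈ Ioo a b,
          u x t - w x t ≤ 2 * B * (1 / 2) ^ (N + 1) * Real.exp (2 * (κ * l) * (t - a)) := by
        filter_upwards [hΦ, hu, hw, hinit, hcont, hDae] with x hΦx hux hwx hix hcx hxD t ht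
        have hκ0 := hκ ⟨x, hxD⟩
        have hrhs : 0 ≤ 2 * B * (1 / 2) ^ (N + 1) * Real.exp (2 * (κ * l) * (t - a)) := by
          positivity
        rcases le_or_gt (u x t - w x t) 0 with hz | hz
        · linarith
        have hsubt : Icc a t ⊆ Icc a b := Icc_subset_Icc_right ht.2.le
        have hzc : ContinuousOn (fun σ => u x σ - w x σ) (Icc a t) :=
          (hcx.sub hwx.1).mono hsubt
        have hclosed : IsCompact (Icc a t ∩ (fun σ => u x σ - w x σ) ⁻¹' Iic 0) :=
          isCompact_Icc.of_isClosed_subset (hzc.preimage_isClosed_of_isClosed isClosed_Icc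
            isClosed_Iic) inter_subset_left
        -- The last time s up to t with u ≤ w at x; on the interval between s and t the difference
        -- is positive.
        obtain ⟨s, hs, hsmax⟩ := hclosed.exists_isGreatest
          ⟨a, left_mem_Icc.2 ht.1.le, by simpa using hix⟩
        have hst : s < t := by
          refine lt_of_le_of_ne hs.1.2 fun h => ?_
          have : u x s - w x s ≤ 0 := hs.2
          rw [h] at this
          linarith
        have hpos : ∀ τ ∈ Ioo s t, 0 < u x τ - w x τ := by
          intro τ hτ
          by_contra hneg
          have := hsmax ⟨⟨hs.1.1.trans hτ.1.le, hτ.2.le⟩, not_lt.1 hneg⟩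
          exact absurd hτ.1 (not_lt.2 this)
        have hop : ∀ τ ∈ Ioo s t, jumpOp S k Φ (fun y => u y τ) x
            ≤ jumpOp S k Φ (fun y => w y τ) x + κ * l * (M * Real.exp (2 * (κ * l) * (τ - a))) := by
          intro τ hτ
          have hτ' : τ ∈ Ioo a b := ⟨hs.1.1.trans_lt hτ.1, hτ.2.trans ht.2⟩
          have hiu := integrableOn_jump hkc hks hl hΦx.1 hΦx.2.2 (hum τ hτ') (hub τ hτ')
          have hiw := integrableOn_jump hkc hks hl hΦx.1 hΦx.2.2 (hwm τ hτ') (hwb τ hτ')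
          set e := M * Real.exp (2 * (κ * l) * (τ - a)) with he
          have he0 : 0 ≤ e := by positivity
          have hik : IntegrableOn (fun y => k (x - y) * (l * e)) S :=
            (integrable_comp_sub hkc hks x).integrableOn.mul_const _
          have h1 : jumpOp S k Φ (fun y => u y τ) x
              ≤ ∫ y in S, (k (x - y) * Φ x (w y τ - w x τ) + k (x - y) * (l * e)) := by
            refine integral_mono_ae hiu (hiw.add hik) ?_
            filter_upwards [hzall τ hτ'] with y hy
            rw [← mul_add]
            refine mul_le_mul_of_nonneg_left ?_ (hk0 _)
            have h2 := hpos τ hτ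
            -- Since u exceeds w at x and exceeds it by at most e at y, the jump of u is at most the
            -- jump of w plus e.
            have h3 : Φ x (u y τ - u x τ) ≤ Φ x (w y τ - w x τ + e) :=
              hΦx.2.1 (by linarith)
            have h4 := (abs_le.1 (hΦx.2.2 (w y τ - w x τ) (w y τ - w x τ + e))).2
            rw [add_sub_cancel_left, abs_of_nonneg he0] at h4
            linarith
          rw [integral_add hiw hik, integral_mul_const] at h1
          refine h1.trans (add_le_add le_rfl ?_)
          rw [mul_assoc κ]
          exact mul_le_mul_of_nonneg_right (hkm x hxD) (by positivity)
        choose! w' hw' using hwx.2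
        have hexp : ∀ τ, HasDerivAt (fun τ => M / 2 * Real.exp (2 * (κ * l) * (τ - a)))
            (κ * l * (M * Real.exp (2 * (κ * l) * (τ - a)))) τ := by
          intro τ
          exact ((((hasDerivAt_id' τ).sub_const a).const_mul (2 * (κ * l))).exp.const_mul
            (M / 2)).congr_deriv (by ring)
        have hsab : s ∈ Icc a b := hsubt hs.1
        have htab : t ∈ Icc a b := ⟨ht.1.le, ht.2.le⟩
        have hintg : ∀ c ∈ Icc a b, IntervalIntegrable
            (fun τ => jumpOp S k Φ (fun y => u y τ) x) volume a c := fun c hc =>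
          hux.1.mono_set (by
            rw [uIcc_of_le hab.le, uIcc_of_le hc.1]; exact Icc_subset_Icc_right hc.2)
        -- This form of the fundamental theorem asks only for an integrable minorant of the
        -- derivative, so the time derivative of w need not be integrable.
        have key := intervalIntegral.integral_le_sub_of_hasDeriv_right_of_le
          (g := fun τ => w x τ + M / 2 * Real.exp (2 * (κ * l) * (τ - a)))
          (g' := fun τ => w' τ + κ * l * (M * Real.exp (2 * (κ * l) * (τ - a))))
          (φ := fun τ => jumpOp S k Φ (fun y => u y τ) x) hst.le
          ((hwx.1.mono (Icc_subset_Icc hs.1.1 ht.2.le)).add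
            (fun τ _ => (hexp τ).continuousAt.continuousWithinAt))
          (fun τ hτ => ((hw' τ ⟨hs.1.1.trans_lt hτ.1, hτ.2.trans ht.2⟩).1.add
            (hexp τ)).hasDerivWithinAt)
          (by
            have := (hintg s hsab).symm.trans (hintg t htab)
            rwa [intervalIntegrable_iff_integrableOn_Icc_of_le hst.le] at this)
          (fun τ hτ => (hop τ hτ).trans (add_le_add
            (hw' τ ⟨hs.1.1.trans_lt hτ.1, hτ.2.trans ht.2⟩).2 le_rfl))
        have hdiff : u x t - u x s = ∫ τ in s..t, jumpOp S k Φ (fun y => u y τ) x := by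
          rw [hux.2 t htab, hux.2 s hsab,
            ← intervalIntegral.integral_interval_sub_left (hintg t htab) (hintg s hsab)]
          ring
        rw [← hdiff] at key
        have hzs : u x s - w x s ≤ 0 := hs.2
        have hes : 0 ≤ M / 2 * Real.exp (2 * (κ * l) * (s - a)) := by positivity
        have e2 : 2 * B * (1 / 2) ^ (N + 1) = M / 2 := by rw [hM]; ring
        rw [e2]
        linarith
      intro t ht
      filter_upwards [hall] with x hx using hx t ht
  have hIoo : ∀ t ∈ Ioo a b, ∀ᵐ x ∂volume.restrict D, u x t ≤ w x t := by
    intro t ht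
    have h := ae_all_iff.2 fun N => claim N t ht
    filter_upwards [h] with x hx
    have hlim : Tendsto (fun N : ℕ => 2 * B * (1 / 2) ^ N * Real.exp (2 * (κ * l) * (t - a))) atTop
        (𝓝 (2 * B * 0 * Real.exp (2 * (κ * l) * (t - a)))) :=
      ((tendsto_pow_atTop_nhds_zero_of_lt_one (by norm_num) (by norm_num)).const_mul _).mul_const _
    have := ge_of_tendsto' hlim hx
    linarith
  -- The exceptional set above depends on t; restricting to rational times gives one null set, and
  -- continuity in time does the rest.
  have hQ : ∀ᵐ x ∂volume.restrict D, ∀ q : ℚ, (q : ℝ) ∈ Ioo a b → u x q ≤ w x q := by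
    rw [ae_all_iff]
    intro q
    by_cases hq : (q : ℝ) ∈ Ioo a b
    · filter_upwards [hIoo q hq] with x hx _ using hx
    · exact Eventually.of_forall fun x h => absurd h hq
  filter_upwards [hQ, hcont, hw] with x hx hcx hwx t ht
  have hsub : Icc a b ⊆ closure (Ioo a b ∩ range ((↑) : ℚ → ℝ)) := by
    rw [← closure_Ioo hab.ne]
    exact closure_minimal (Rat.denseRange_cast.open_subset_closure_inter isOpen_Ioo)
      isClosed_closure
  have hcl : IsClosed (Icc a b ∩ (fun σ => u x σ - w x σ) ⁻¹' Iic 0) :=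
    (hcx.sub hwx.1).preimage_isClosed_of_isClosed isClosed_Icc isClosed_Iic
  have hmin := closure_minimal (s := Ioo a b ∩ range ((↑) : ℚ → ℝ)) (fun σ hσ => by
    obtain ⟨hσ1, q, rfl⟩ := hσ
    exact ⟨Ioo_subset_Icc_self hσ1, sub_nonpos.2 (hx q hσ1)⟩) hcl
  exact sub_nonpos.1 (hmin (hsub ht)).2

end Comparison

/-! ### Geometry of the domain -/

section Geometry

variable {n : ℕ} {Ω : Set (Eucl n)}

/-- At every boundary point there is an exterior ball of radius `r`. -/
def HasExteriorBalls (Ω : Set (Eucl n)) (r : ℝ) : Prop :=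
  ∀ p ∈ frontier Ω, ∃ e : Eucl n, ‖e‖ = 1 ∧ ∀ x ∈ Ω, r ≤ ‖x - (p + r • e)‖

theorem exterior_ball_mono {p e : Eucl n} (he : ‖e‖ = 1) {r s : ℝ} (hrs : r ≤ s) {x : Eucl n}
    (h : s ≤ ‖x - (p + s • e)‖) : r ≤ ‖x - (p + r • e)‖ := by
  have h1 : x - (p + s • e) = (x - (p + r • e)) - (s - r) • e := by
    rw [sub_smul]; abel
  have h2 := norm_sub_le (x - (p + r • e)) ((s - r) • e)
  rw [← h1, norm_smul, he, mul_one, Real.norm_of_nonneg (sub_nonneg.2 hrs)] at h2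
  linarith

theorem HasExteriorBalls.mono {r s : ℝ} (h : HasExteriorBalls Ω s) (hrs : r ≤ s) :
    HasExteriorBalls Ω r := fun p hp => by
  obtain ⟨e, he, hx⟩ := h p hp
  exact ⟨e, he, fun x hxΩ => exterior_ball_mono he hrs (hx x hxΩ)⟩

/-- Expanding the square, ‖x - p - re‖² - r² equals ‖x - p‖² - 2r⟨e, x - p⟩, which is nonnegative
when 2rC ≤ 1. -/
theorem exterior_ball_of_inner_le {p e x : Eucl n} (he : ‖e‖ = 1) {r C : ℝ} (hr : 0 ≤ r)
    (h : inner ℝ e (x - p) ≤ C * ‖x - p‖ ^ 2) (hC : 2 * r * C ≤ 1) :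
    r ≤ ‖x - (p + r • e)‖ := by
  have h1 : x - (p + r • e) = (x - p) - r • e := by abel
  have h2 := norm_sub_sq_real (x - p) (r • e)
  rw [inner_smul_right, norm_smul, he, mul_one, Real.norm_of_nonneg hr, real_inner_comm] at h2
  rw [h1]
  refine le_of_sq_le_sq ?_ (norm_nonneg _)
  rw [h2]
  have h3 := mul_le_mul_of_nonneg_left h (by positivity : 0 ≤ 2 * r)
  have h4 := mul_le_mul_of_nonneg_right hC (sq_nonneg ‖x - p‖)
  nlinarith

/-- The derivative of ρ is Lipschitz near q, and ρ(x) < 0 ≤ ρ(p) for x in Ω and p on the boundary.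
Hence the component of x - p along the unit normal at p is at most quadratic in ‖x - p‖, with a
constant uniform in p because the gradient stays away from zero. -/
theorem exists_exterior_ball_nhds (hΩo : IsOpen Ω) {q : Eucl n} {r₀ : ℝ} (hr₀ : 0 < r₀)
    {ρ : Eucl n → ℝ} (hρ : ContDiffOn ℝ 2 ρ (Metric.ball q r₀)) (hρ' : fderiv ℝ ρ q ≠ 0)
    (hΩ : ∀ x ∈ Metric.ball q r₀, (x ∈ Ω ↔ ρ x < 0)) :
    ∃ s > 0, ∃ r > 0, ∀ p ∈ Metric.ball q s ∩ frontier Ω,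
      ∃ e : Eucl n, ‖e‖ = 1 ∧ ∀ x ∈ Ω, r ≤ ‖x - (p + r • e)‖ := by
  have hat : ContDiffAt ℝ 2 ρ q := hρ.contDiffAt (Metric.ball_mem_nhds q hr₀)
  have hat' : ContDiffAt ℝ 1 (fderiv ℝ ρ) q := hat.fderiv_right (by norm_num)
  obtain ⟨K, t, ht, hK⟩ := hat'.exists_lipschitzOnWith
  set c := ‖fderiv ℝ ρ q‖ / 2 with hc
  have hc0 : 0 < c := by have := norm_pos_iff.2 hρ'; positivity
  have hnear : ∀ᶠ x in 𝓝 q, c < ‖fderiv ℝ ρ x‖ :=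
    hat'.continuousAt.norm.eventually (lt_mem_nhds (by
      have := norm_pos_iff.2 hρ'; rw [hc]; linarith))
  obtain ⟨s, hs, hsub⟩ := Metric.mem_nhds_iff.1
    (inter_mem (inter_mem ht hnear) (Metric.ball_mem_nhds q hr₀))
  -- The second bound on the radius is what the quadratic estimate needs near p; the first makes the
  -- ball too small to reach points at distance at least s/2 from p.
  refine ⟨s / 2, by positivity, min (s / 4) (c / (2 * (K + 1))), by positivity, ?_⟩
  rintro p ⟨hpq, hpf⟩
  set r := min (s / 4) (c / (2 * (K + 1))) with hr
  have hr0 : 0 < r := by positivity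
  have hballsub : Metric.ball p (s / 2) ⊆ Metric.ball q s := fun x hx => by
    have h1 : dist x p < s / 2 := hx
    have h2 : dist p q < s / 2 := hpq
    have := dist_triangle x p q
    exact Metric.mem_ball.2 (by linarith)
  have hp := hballsub (Metric.mem_ball_self (by positivity))
  have hgrad : c < ‖fderiv ℝ ρ p‖ := (hsub hp).1.2
  have hρp : 0 ≤ ρ p := by
    by_contra hneg
    have h1 := (hΩ p (hsub hp).2).2 (not_le.1 hneg)
    rw [hΩo.frontier_eq] at hpf
    exact hpf.2 h1
  set g := (InnerProductSpace.toDual ℝ (Eucl n)).symm (fderiv ℝ ρ p) with hg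
  have hgn : ‖g‖ = ‖fderiv ℝ ρ p‖ := LinearIsometryEquiv.norm_map _ _
  have hginner : ∀ z, inner ℝ g z = fderiv ℝ ρ p z := fun z => by
    rw [hg, InnerProductSpace.toDual_symm_apply]
  have hgpos : 0 < ‖g‖ := by rw [hgn]; linarith
  have he : ‖(‖g‖⁻¹ • g : Eucl n)‖ = 1 := by
    rw [norm_smul, norm_inv, norm_norm, inv_mul_cancel₀ hgpos.ne']
  refine ⟨‖g‖⁻¹ • g, he, fun x hx => ?_⟩
  rcases lt_or_ge ‖x - p‖ (s / 2) with hxp | hxp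
  · have hxball : x ∈ Metric.ball p (s / 2) := by rwa [Metric.mem_ball, dist_eq_norm]
    have hdiff : ∀ y ∈ Metric.ball q s, HasFDerivAt ρ (fderiv ℝ ρ y) y := fun y hy =>
      ((hρ.contDiffAt (Metric.isOpen_ball.mem_nhds (hsub hy).2)).differentiableAt
        (by norm_num)).hasFDerivAt
    have hcl : Metric.closedBall p ‖x - p‖ ⊆ Metric.ball q s :=
      (Metric.closedBall_subset_ball hxp).trans hballsub
    have hmv := Convex.norm_image_sub_le_of_norm_hasFDerivWithin_le' (f := ρ)
      (s := Metric.closedBall p ‖x - p‖) (f' := fderiv ℝ ρ) (φ := fderiv ℝ ρ p)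
      (C := K * ‖x - p‖) (x := p) (y := x)
      (fun y hy => (hdiff y (hcl hy)).hasFDerivWithinAt)
      (fun y hy => by
        have := hK.norm_sub_le (hsub (hcl hy)).1.1 (hsub hp).1.1
        refine this.trans ?_
        gcongr
        rwa [Metric.mem_closedBall, dist_eq_norm] at hy)
      (convex_closedBall _ _) (Metric.mem_closedBall_self (norm_nonneg _))
      (by rw [Metric.mem_closedBall, dist_eq_norm])
    have hρx := (hΩ x (hsub (hballsub hxball)).2).1 hx
    rw [Real.norm_eq_abs] at hmv
    have h1 : fderiv ℝ ρ p (x - p) ≤ K * ‖x - p‖ * ‖x - p‖ := by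
      have := (abs_le.1 hmv).1
      linarith
    refine exterior_ball_of_inner_le (C := (K + 1) / c) he hr0.le ?_ ?_
    · rw [inner_smul_left, hginner]
      simp only [map_inv₀, conj_trivial]
      have hK0 : (0 : ℝ) ≤ K := K.2
      calc ‖g‖⁻¹ * fderiv ℝ ρ p (x - p) ≤ ‖g‖⁻¹ * (K * ‖x - p‖ * ‖x - p‖) := by gcongr
        _ ≤ c⁻¹ * ((K + 1) * ‖x - p‖ * ‖x - p‖) := by
            have h3 : ‖g‖⁻¹ ≤ c⁻¹ := inv_anti₀ hc0 (by rw [hgn]; exact hgrad.le)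
            have h4 : (K : ℝ) * ‖x - p‖ * ‖x - p‖ ≤ (K + 1) * ‖x - p‖ * ‖x - p‖ := by
              gcongr; linarith
            exact mul_le_mul h3 h4 (by positivity) (by positivity)
        _ = _ := by field_simp
    · have hK0 : (0 : ℝ) ≤ K := K.2
      calc 2 * r * ((K + 1) / c) ≤ 2 * (c / (2 * (K + 1))) * ((K + 1) / c) := by
            gcongr
            exact min_le_right _ _
        _ = 1 := by field_simp
  · have h1 : x - p = (x - (p + r • (‖g‖⁻¹ • g))) + r • (‖g‖⁻¹ • g) := by abel
    have h2 := norm_add_le (x - (p + r • (‖g‖⁻¹ • g))) (r • (‖g‖⁻¹ • g))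
    rw [← h1, norm_smul r, he, mul_one, Real.norm_of_nonneg hr0.le] at h2
    have h3 : r ≤ s / 4 := min_le_left _ _
    linarith

theorem IsC2HolderDomain.exists_exteriorBalls {α : ℝ} (hΩ : IsC2HolderDomain α Ω) :
    ∃ r > 0, HasExteriorBalls Ω r := by
  have hcpt : IsCompact (frontier Ω) := by
    refine Metric.isCompact_of_isClosed_isBounded isClosed_frontier ?_
    exact hΩ.isBounded.closure.subset frontier_subset_closure
  have := hcpt.induction_on (p := fun S => ∃ r > 0, ∀ p ∈ S ∩ frontier Ω,
      ∃ e : Eucl n, ‖e‖ = 1 ∧ ∀ x ∈ Ω, r ≤ ‖x - (p + r • e)‖)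
    ⟨1, one_pos, by simp⟩
    (fun S T hST ⟨r, hr, h⟩ => ⟨r, hr, fun p hp => h p ⟨hST hp.1, hp.2⟩⟩)
    (fun S T ⟨r, hr, h⟩ ⟨r', hr', h'⟩ => ⟨min r r', lt_min hr hr', fun p hp => by
      rcases hp.1 with h1 | h1
      · obtain ⟨e, he, hx⟩ := h p ⟨h1, hp.2⟩
        exact ⟨e, he, fun x hxΩ => exterior_ball_mono he (min_le_left _ _) (hx x hxΩ)⟩
      · obtain ⟨e, he, hx⟩ := h' p ⟨h1, hp.2⟩
        exact ⟨e, he, fun x hxΩ => exterior_ball_mono he (min_le_right _ _) (hx x hxΩ)⟩⟩)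
    (fun q hq => by
      obtain ⟨r₀, hr₀, ρ, h1, -, h2, h3⟩ := hΩ.boundary q hq
      obtain ⟨s, hs, h⟩ := exists_exterior_ball_nhds hΩ.isOpen hr₀ h1 h2 h3
      exact ⟨Metric.ball q s, mem_nhdsWithin_of_mem_nhds (Metric.ball_mem_nhds q hs), h⟩)
  obtain ⟨r, hr, h⟩ := this
  exact ⟨r, hr, fun p hp => h p ⟨hp, hp⟩⟩

theorem HasExteriorBalls.disjoint_ball {r : ℝ} {p e : Eucl n}
    (h : ∀ x ∈ Ω, r ≤ ‖x - (p + r • e)‖) : Disjoint Ω (Metric.ball (p + r • e) r) := by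
  rw [Set.disjoint_left]
  intro x hx hx'
  rw [Metric.mem_ball, dist_eq_norm] at hx'
  exact absurd (h x hx) (not_le.2 hx')

/-- At a boundary point the exterior ball fills a fixed proportion of every small ball and misses
the frontier, so no boundary point is a Lebesgue density point of the frontier. -/
theorem HasExteriorBalls.volume_frontier {r : ℝ} (hr : 0 < r) (h : HasExteriorBalls Ω r) :
    volume (frontier Ω) = 0 := by
  have hd := Besicovitch.ae_tendsto_measure_inter_div (volume : Measure (Eucl n)) (frontier Ω)
  set θ : ℝ≥0∞ := ENNReal.ofReal ((1 / 2) ^ (n + 1)) with hθ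
  have hθ0 : θ ≠ 0 := by rw [hθ]; simp
  have hfalse : ∀ᵐ x ∂(volume : Measure (Eucl n)).restrict (frontier Ω), False := by
    filter_upwards [hd, ae_restrict_mem isClosed_frontier.measurableSet] with p hp hpf
    have hle : ∀ᶠ s in 𝓝[>] (0 : ℝ), volume (frontier Ω ∩ Metric.closedBall p s) /
        volume (Metric.closedBall p s) ≤ 1 - θ := by
      have hmem : Ioo (0 : ℝ) r ∈ 𝓝[>] (0 : ℝ) := Ioo_mem_nhdsGT hr
      filter_upwards [hmem] with s hs
      obtain ⟨e, he, hx⟩ := h.mono (r := s / 2) (by linarith [hs.1, hs.2]) p hpf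
      have hdis : Disjoint (frontier Ω) (Metric.ball (p + (s / 2) • e) (s / 2)) :=
        ((HasExteriorBalls.disjoint_ball hx).closure_left Metric.isOpen_ball).mono_left
          frontier_subset_closure
      have hsub : Metric.ball (p + (s / 2) • e) (s / 2) ⊆ Metric.closedBall p s := by
        refine (Metric.ball_subset_ball' ?_).trans Metric.ball_subset_closedBall
        rw [dist_eq_norm, add_sub_cancel_left, norm_smul, he, mul_one, Real.norm_of_nonneg
          (by linarith [hs.1])]
        linarith
      have hV0 : volume (Metric.closedBall p s) ≠ 0 :=
        (Metric.measure_closedBall_pos _ _ hs.1).ne'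
      have hVt : volume (Metric.closedBall p s) ≠ ⊤ := measure_closedBall_lt_top.ne
      have hball : volume (Metric.ball (p + (s / 2) • e) (s / 2))
          = θ * volume (Metric.closedBall p s) := by
        rw [Measure.addHaar_ball _ _ (by linarith [hs.1]), Measure.addHaar_closedBall _ _ hs.1.le,
          ← mul_assoc, hθ, ← ENNReal.ofReal_mul (by positivity), finrank_euclideanSpace,
          Fintype.card_fin, ← mul_pow]
        congr 3
        ring
      have hadd : volume (frontier Ω ∩ Metric.closedBall p s)
          + θ * volume (Metric.closedBall p s) ≤ volume (Metric.closedBall p s) := by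
        rw [← hball, ← measure_union (hdis.mono_left inter_subset_left)
          Metric.isOpen_ball.measurableSet]
        exact measure_mono (union_subset inter_subset_right hsub)
      rw [ENNReal.div_le_iff hV0 hVt, ENNReal.sub_mul (fun _ _ => hVt), one_mul]
      refine ENNReal.le_sub_of_add_le_right ?_ hadd
      exact ENNReal.mul_ne_top ENNReal.ofReal_ne_top hVt
    have h1 := le_of_tendsto hp hle
    have h2 : (1 : ℝ≥0∞) - θ < 1 := ENNReal.sub_lt_self ENNReal.one_ne_top one_ne_zero hθ0
    exact absurd h1 (not_le.2 h2)
  rw [eventually_false_iff_eq_bot, ae_eq_bot, Measure.restrict_eq_zero] at hfalse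
  exact hfalse

theorem compl_nonempty_of_isBounded (hΩ : Bornology.IsBounded Ω) : Ωᶜ.Nonempty := by
  rw [nonempty_compl]
  rintro rfl
  exact NormedSpace.unbounded_univ ℝ (Eucl n) hΩ

theorem infDist_compl_pos (hΩo : IsOpen Ω) (hΩ : Bornology.IsBounded Ω) {x : Eucl n} (hx : x ∈ Ω) :
    0 < Metric.infDist x Ωᶜ :=
  (hΩo.isClosed_compl.notMem_iff_infDist_pos (compl_nonempty_of_isBounded hΩ)).1 (by simpa)

theorem exists_nearest_frontier (hΩo : IsOpen Ω) (hΩ : Bornology.IsBounded Ω) {x : Eucl n}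
    (hx : x ∈ Ω) : ∃ p ∈ frontier Ω, ‖x - p‖ = Metric.infDist x Ωᶜ := by
  obtain ⟨p, hp, hd⟩ := hΩo.isClosed_compl.exists_infDist_eq_dist
    (compl_nonempty_of_isBounded hΩ) x
  refine ⟨p, ?_, by rw [hd, dist_eq_norm]⟩
  rw [hΩo.frontier_eq]
  refine ⟨?_, hp⟩
  have hpos := infDist_compl_pos hΩo hΩ hx
  refine closure_mono (Metric.ball_infDist_compl_subset (s := Ω) (x := x)) ?_
  rw [closure_ball x hpos.ne', Metric.mem_closedBall, dist_comm, ← hd]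

/-- The segment from x to y is connected, so it cannot be split between Ω and the exterior of its
closure. -/
theorem exists_frontier_between (hΩo : IsOpen Ω) {x y : Eucl n} (hx : x ∈ Ω) (hy : y ∉ Ω) :
    ∃ p ∈ frontier Ω, ‖y - p‖ ≤ ‖y - x‖ := by
  by_contra! hcon
  have hyc : y ∉ closure Ω := fun hyc => by
    have := hcon y (by rw [hΩo.frontier_eq]; exact ⟨hyc, hy⟩)
    rw [sub_self, norm_zero] at this
    exact absurd this (not_lt.2 (norm_nonneg _))
  obtain ⟨p, hp, hp1, hp2⟩ := (convex_segment x y).isPreconnected Ω (closure Ω)ᶜ hΩo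
    isClosed_closure.isOpen_compl (fun p hp => by
      by_contra hnot
      simp only [mem_union, not_or, mem_compl_iff, not_not] at hnot
      have h1 := hcon p (by rw [hΩo.frontier_eq]; exact ⟨hnot.2, hnot.1⟩)
      have h2 := dist_add_dist_of_mem_segment hp
      rw [dist_eq_norm, dist_eq_norm, dist_eq_norm, norm_sub_rev p y, norm_sub_rev x y] at h2
      linarith [norm_nonneg (x - p)])
    ⟨x, left_mem_segment ℝ x y, hx⟩ ⟨y, right_mem_segment ℝ x y, hyc⟩
  exact hp2 (subset_closure hp1)

/-- Distance to the complement decreases in the direction of a nearest boundary point, up to a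
quadratic error. -/
theorem HasExteriorBalls.exists_direction {r : ℝ} (hr : 0 < r) (h : HasExteriorBalls Ω r)
    (hΩo : IsOpen Ω) (hΩ : Bornology.IsBounded Ω) {x : Eucl n} (hx : x ∈ Ω) :
    ∃ f : Eucl n, ‖f‖ = 1 ∧ ∀ z, x + z ∈ Ω →
      Metric.infDist (x + z) Ωᶜ ≤ Metric.infDist x Ωᶜ - inner ℝ f z + ‖z‖ ^ 2 / (2 * r) := by
  obtain ⟨p, hp, hd⟩ := exists_nearest_frontier hΩo hΩ hx
  obtain ⟨e, he, hball⟩ := h p hp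
  set c := p + r • e with hc
  have hdis := HasExteriorBalls.disjoint_ball hball
  -- The largest ball around y inside Ω is disjoint from the exterior ball, which separates the
  -- centres. At x equality holds, so ‖y - c‖ - r touches the distance function from above at x.
  have key : ∀ y ∈ Ω, Metric.infDist y Ωᶜ + r ≤ ‖y - c‖ := by
    intro y hy
    rw [← dist_eq_norm]
    exact (disjoint_ball_ball_iff (infDist_compl_pos hΩo hΩ hy) hr).1
      (hdis.mono_left Metric.ball_infDist_compl_subset)
  have hρ1 := key x hx
  have hρ2 : ‖x - c‖ ≤ Metric.infDist x Ωᶜ + r := by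
    have e1 : x - c = (x - p) - r • e := by rw [hc]; abel
    rw [e1, ← hd]
    refine (norm_sub_le _ _).trans ?_
    rw [norm_smul, he, mul_one, Real.norm_of_nonneg hr.le]
  have hd0 := infDist_compl_pos hΩo hΩ hx
  set ρ := ‖x - c‖ with hρ
  have hρr : r ≤ ρ := by linarith
  have hρ0 : 0 < ρ := by linarith
  have hf : ‖(ρ⁻¹ • (c - x) : Eucl n)‖ = 1 := by
    rw [norm_smul, norm_sub_rev c x, ← hρ, norm_inv, Real.norm_of_nonneg hρ0.le,
      inv_mul_cancel₀ hρ0.ne']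
  refine ⟨ρ⁻¹ • (c - x), hf, fun z hz => ?_⟩
  have h1 := key _ hz
  set s : ℝ := inner ℝ (ρ⁻¹ • (c - x)) z with hs
  have hsz : |s| ≤ ‖z‖ := by
    have := abs_real_inner_le_norm (ρ⁻¹ • (c - x)) z
    rwa [hf, one_mul] at this
  have hsq : ‖x + z - c‖ ^ 2 = ρ ^ 2 - 2 * ρ * s + ‖z‖ ^ 2 := by
    have e1 : x + z - c = (x - c) + z := by abel
    rw [e1, norm_add_sq_real, ← hρ, hs, inner_smul_left, ← neg_sub x c, inner_neg_left]
    simp only [map_inv₀, conj_trivial]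
    field_simp
    ring
  -- The Euclidean norm lies below this second-order expansion because the square of the right-hand
  -- side exceeds that of the left by a square.
  have hle : ‖x + z - c‖ ≤ ρ - s + ‖z‖ ^ 2 / (2 * ρ) := by
    have hs2 := (abs_le.1 hsz).2
    have hnn : 0 ≤ ρ - s + ‖z‖ ^ 2 / (2 * ρ) := by
      have : ρ - ‖z‖ + ‖z‖ ^ 2 / (2 * ρ) = ((ρ - ‖z‖) ^ 2 + ρ ^ 2) / (2 * ρ) := by
        field_simp; ring
      have h3 : 0 ≤ ρ - ‖z‖ + ‖z‖ ^ 2 / (2 * ρ) := by rw [this]; positivity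
      linarith
    refine le_of_sq_le_sq ?_ hnn
    rw [hsq]
    have : (ρ - s + ‖z‖ ^ 2 / (2 * ρ)) ^ 2
        = ρ ^ 2 - 2 * ρ * s + ‖z‖ ^ 2 + (-s + ‖z‖ ^ 2 / (2 * ρ)) ^ 2 := by
      field_simp; ring
    rw [this]
    linarith [sq_nonneg (-s + ‖z‖ ^ 2 / (2 * ρ))]
  have hfin : ‖z‖ ^ 2 / (2 * ρ) ≤ ‖z‖ ^ 2 / (2 * r) := by gcongr
  linarith

end Geometry

/-! ### Solutions that are absolutely continuous in time -/

/-- Solutions in `C([0,T]; L¹(Ω))` of the equation with operator `jumpOp S k Φ`. -/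
structure IsL1Solution {n : ℕ} (Ω S : Set (Eucl n)) (T : ℝ) (k : Eucl n → ℝ)
    (Φ : Eucl n → ℝ → ℝ) (h : Eucl n → ℝ → ℝ) (u₀ : Eucl n → ℝ) (u : Eucl n → ℝ → ℝ) : Prop where
  measurable : AEStronglyMeasurable (fun p : Eucl n × ℝ => u p.1 p.2)
    (volume.restrict (Ω ×ˢ Ioo 0 T))
  integrable : ∀ t ∈ Icc 0 T, IntegrableOn (fun x => u x t) Ω
  continuous : ∀ t ∈ Icc 0 T,
    Tendsto (fun s => ∫ x in Ω, |u x s - u x t|) (𝓝[Icc 0 T] t) (𝓝 0)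
  equation : ∀ t ∈ Ioo 0 T, ∀ᵐ x ∂volume.restrict Ω,
    u x t = (∫ τ in (0 : ℝ)..t, jumpOp S k Φ (fun y => u y τ) x) + u₀ x
  exterior : ∀ t ∈ Ioo 0 T, ∀ᵐ y ∂volume.restrict (S \ Ω), u y t = h y t

/-- Bounded solutions for which, at almost every `x`, the equation holds at all times. -/
structure IsMildSolution {n : ℕ} (Ω S : Set (Eucl n)) (T : ℝ) (k : Eucl n → ℝ)
    (Φ : Eucl n → ℝ → ℝ) (h : Eucl n → ℝ → ℝ) (u₀ : Eucl n → ℝ) (u : Eucl n → ℝ → ℝ) : Prop where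
  measurable : ∀ t ∈ Ioo 0 T, AEStronglyMeasurable (fun y => u y t) (volume.restrict S)
  bounded : ∃ B ≥ 0, ∀ t ∈ Ioo 0 T, ∀ᵐ y ∂volume.restrict S, |u y t| ≤ B
  equation : ∀ᵐ x ∂volume.restrict Ω,
    IntervalIntegrable (fun τ => jumpOp S k Φ (fun y => u y τ) x) volume 0 T ∧
    ∀ t ∈ Icc 0 T, u x t = u₀ x + ∫ τ in (0 : ℝ)..t, jumpOp S k Φ (fun y => u y τ) x
  exterior : ∀ t ∈ Ioo 0 T, ∀ᵐ y ∂volume.restrict (S \ Ω), u y t = h y t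

theorem IsMildSolution.neg {n : ℕ} {Ω S : Set (Eucl n)} {T : ℝ} {k : Eucl n → ℝ}
    {Φ : Eucl n → ℝ → ℝ} {h : Eucl n → ℝ → ℝ} {u₀ : Eucl n → ℝ} {u : Eucl n → ℝ → ℝ}
    (hu : IsMildSolution Ω S T k Φ h u₀ u) :
    IsMildSolution Ω S T k (fun x s => -Φ x (-s)) (fun x t => -h x t) (fun x => -u₀ x)
      (fun x t => -u x t) := by
  have hop : ∀ x τ, jumpOp S k (fun x s => -Φ x (-s)) (fun y => -u y τ) x
      = -jumpOp S k Φ (fun y => u y τ) x := by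
    intro x τ
    simp only [jumpOp]
    rw [← integral_neg]
    congr 1 with y
    rw [mul_neg]
    congr 3
    ring
  refine ⟨fun t ht => (hu.measurable t ht).neg, ?_, ?_, ?_⟩
  · obtain ⟨B, hB, h⟩ := hu.bounded
    exact ⟨B, hB, by simpa using h⟩
  · filter_upwards [hu.equation] with x hx
    simp only [hop, intervalIntegral.integral_neg]
    refine ⟨hx.1.neg, fun t ht => ?_⟩
    rw [hx.2 t ht]
    ring
  · intro t ht
    filter_upwards [hu.exterior t ht] with y hy
    rw [hy]

/-- After a null set of x is discarded, every remaining slice is continuous and agrees at rational s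
with measurable representatives; arbitrary s are limits of rationals. Joint measurability is needed
for Fubini. -/
theorem exists_measurable_version {n : ℕ} {Ω : Set (Eucl n)} {Φ : Eucl n → ℝ → ℝ}
    (hm : ∀ s, AEMeasurable (fun x => Φ x s) (volume.restrict Ω))
    (hc : ∀ᵐ x ∂volume.restrict Ω, Continuous (Φ x)) :
    ∃ Ψ : Eucl n → ℝ → ℝ, Measurable (fun p : ℝ × Eucl n => Ψ p.2 p.1) ∧
      ∀ᵐ x ∂volume.restrict Ω, Ψ x = Φ x := by
  classical
  have hae : ∀ᵐ x ∂volume.restrict Ω, Continuous (Φ x) ∧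
      ∀ q : ℚ, Φ x q = (hm q).mk (fun x => Φ x q) x :=
    hc.and (ae_all_iff.2 fun q => (hm q).ae_eq_mk)
  obtain ⟨g, hg, hgm, hgood⟩ := hae.exists_measurable_mem
  refine ⟨fun x s => if x ∈ g then Φ x s else 0, ?_, ?_⟩
  · have hcont : ∀ x, Continuous (fun s => if x ∈ g then Φ x s else 0) := by
      intro x
      by_cases hx : x ∈ g
      · simpa [hx] using (hgood x hx).1
      · simpa [hx] using continuous_const
    have hrat : ∀ q : ℚ, Measurable (fun x => if x ∈ g then Φ x q else 0) := by
      intro q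
      have : (fun x => if x ∈ g then Φ x q else 0)
          = fun x => if x ∈ g then (hm q).mk (fun x => Φ x q) x else 0 := by
        ext x
        by_cases hx : x ∈ g
        · simp [hx, (hgood x hx).2 q]
        · simp [hx]
      rw [this]
      exact Measurable.ite hgm (hm q).measurable_mk measurable_const
    refine measurable_uncurry_of_continuous_of_measurable
      (u := fun s x => if x ∈ g then Φ x s else 0) hcont fun s => ?_
    obtain ⟨q, hq⟩ : ∃ q : ℕ → ℚ, Tendsto (fun i => (q i : ℝ)) atTop (𝓝 s) := by
      obtain ⟨f, hf, hlim⟩ := mem_closure_iff_seq_limit.1 (Rat.denseRange_cast s)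
      choose q hq using hf
      exact ⟨q, by simpa only [hq] using hlim⟩
    exact measurable_of_tendsto_metrizable (fun i => hrat (q i))
      (tendsto_pi_nhds.2 fun x => ((hcont x).tendsto s).comp hq)
  · filter_upwards [hg] with x hx
    ext s
    simp [hx]

/-- A Grönwall bound obtained at a maximum point of exp(-2lt)|f(t)|: the weight makes the integral
term at most half of the maximum, which is absorbed on the left. -/
theorem abs_le_of_integral_equation {T c l C : ℝ} (hT : 0 ≤ T) (hC : 0 ≤ C)
    {f N : ℝ → ℝ} (hN : IntervalIntegrable N volume 0 T)
    (hf : ∀ t ∈ Icc 0 T, f t = c + ∫ τ in (0 : ℝ)..t, N τ) (hl : 0 ≤ l)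
    (hb : ∀ τ ∈ Ioo 0 T, |N τ| ≤ l * |f τ| + C) :
    ∀ t ∈ Icc 0 T, |f t| ≤ 2 * (|c| + C * T) * Real.exp (2 * l * T) := by
  have hcont : ContinuousOn f (Icc 0 T) := by
    have h1 := intervalIntegral.continuousOn_primitive_interval' hN left_mem_uIcc
    rw [uIcc_of_le hT] at h1
    exact (continuousOn_const.add h1).congr hf
  have hgc : ContinuousOn (fun t => Real.exp (-(2 * l * t)) * |f t|) (Icc 0 T) := by
    have : Continuous fun t : ℝ => Real.exp (-(2 * l * t)) := by fun_prop
    exact this.continuousOn.mul hcont.abs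
  obtain ⟨s, hs, hmax⟩ := isCompact_Icc.exists_isMaxOn ⟨0, left_mem_Icc.2 hT⟩ hgc
  set M := Real.exp (-(2 * l * s)) * |f s| with hM
  have hM0 : 0 ≤ M := by positivity
  have hle : ∀ t ∈ Icc 0 T, |f t| ≤ M * Real.exp (2 * l * t) := by
    intro t ht
    have h1 : Real.exp (-(2 * l * t)) * |f t| ≤ M := hmax ht
    have h2 := mul_le_mul_of_nonneg_right h1 (Real.exp_pos (2 * l * t)).le
    rwa [mul_right_comm, ← Real.exp_add, neg_add_cancel, Real.exp_zero, one_mul] at h2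
  have hfs : |f s| = M * Real.exp (2 * l * s) := by
    rw [hM, mul_right_comm, ← Real.exp_add, neg_add_cancel, Real.exp_zero, one_mul]
  have hd : ∀ τ, HasDerivAt (fun τ => M / 2 * Real.exp (2 * l * τ) + C * τ)
      (l * (M * Real.exp (2 * l * τ)) + C) τ := fun τ =>
    (((((hasDerivAt_id' τ).const_mul (2 * l))).exp.const_mul (M / 2)).add
      ((hasDerivAt_id' τ).const_mul C)).congr_deriv (by ring)
  have hNs : IntervalIntegrable N volume 0 s := hN.mono_set (by
    rw [uIcc_of_le hT, uIcc_of_le hs.1]; exact Icc_subset_Icc_right hs.2)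
  have key := intervalIntegral.integral_le_sub_of_hasDeriv_right_of_le
    (g := fun τ => M / 2 * Real.exp (2 * l * τ) + C * τ)
    (g' := fun τ => l * (M * Real.exp (2 * l * τ)) + C) (φ := fun τ => |N τ|) hs.1
    (fun τ _ => (hd τ).continuousAt.continuousWithinAt) (fun τ _ => (hd τ).hasDerivWithinAt)
    (by
      have := hNs.abs
      rwa [intervalIntegrable_iff_integrableOn_Icc_of_le hs.1] at this)
    (fun τ hτ => by
      have hτ' : τ ∈ Ioo 0 T := ⟨hτ.1, hτ.2.trans_le hs.2⟩
      refine (hb τ hτ').trans ?_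
      gcongr
      exact hle τ (Ioo_subset_Icc_self hτ'))
  have hI : |f s| ≤ |c| + ∫ τ in (0 : ℝ)..s, |N τ| := by
    rw [hf s hs]
    refine (abs_add_le _ _).trans (add_le_add le_rfl ?_)
    exact intervalIntegral.abs_integral_le_integral_abs hs.1
  simp only [mul_zero, Real.exp_zero, mul_one] at key
  have hCs : C * s ≤ C * T := by have := hs.2; gcongr
  have hMle : M * Real.exp (2 * l * s) ≤ 2 * (|c| + C * T) := by
    rw [hfs] at hI
    linarith
  have h1 : 1 ≤ Real.exp (2 * l * s) := by
    rw [Real.one_le_exp_iff]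
    have := hs.1
    positivity
  have hMfin : M ≤ 2 * (|c| + C * T) := by nlinarith
  intro t ht
  refine (hle t ht).trans ?_
  have := ht.2
  have hnn : 0 ≤ 2 * (|c| + C * T) := by positivity
  gcongr

section

variable {n : ℕ} {Ω S : Set (Eucl n)} {T : ℝ} {k : Eucl n → ℝ} {Φ : Eucl n → ℝ → ℝ}
  {h : Eucl n → ℝ → ℝ} {u₀ : Eucl n → ℝ} {u : Eucl n → ℝ → ℝ}

theorem jumpOp_congr {w w' : Eucl n → ℝ} {x : Eucl n} (hx : w x = w' x)
    (hae : ∀ᵐ y ∂volume.restrict S, w y = w' y) : jumpOp S k Φ w x = jumpOp S k Φ w' x := by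
  refine integral_congr_ae ?_
  filter_upwards [hae] with y hy
  rw [hx, hy]

theorem setIntegral_comp_sub_le (hkc : Continuous k) (hks : HasCompactSupport k)
    (hk0 : ∀ z, 0 ≤ k z) (x : Eucl n) : ∫ y in S, k (x - y) ≤ ∫ z, k z := by
  rw [← integral_sub_left_eq_self k volume x]
  exact setIntegral_le_integral (integrable_comp_sub hkc hks x) (Eventually.of_forall fun y => hk0 _)

/-- Values of w in Ω other than w(x) enter only through the L¹ norm, as k is bounded. At fixed x the
equation is therefore a scalar integral equation with linear growth, which upgrades L¹ solutions to
bounded ones. -/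
theorem abs_jumpOp_le (hΩ : MeasurableSet Ω) (hΩS : Ω ⊆ S)
    (hkc : Continuous k) (hks : HasCompactSupport k) (hk0 : ∀ z, 0 ≤ k z) {Kk : ℝ}
    (hKk : ∀ z, k z ≤ Kk) {l M A : ℝ} (hl : 0 ≤ l) (hM : 0 ≤ M) {w : Eucl n → ℝ} {x : Eucl n}
    (hΦ : ∀ s, |Φ x s| ≤ l * |s|) (hw : IntegrableOn w Ω)
    (hwM : ∀ᵐ y ∂volume.restrict (S \ Ω), |w y| ≤ M) (hA : ∫ y in Ω, |w y| ≤ A) :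
    |jumpOp S k Φ w x| ≤ l * (∫ z, k z) * |w x| + (l * (∫ z, k z) * M + l * Kk * A) := by
  have hKk0 : 0 ≤ Kk := (hk0 0).trans (hKk 0)
  have hi1 : Integrable (fun y => k (x - y) * (l * (|w x| + M))) (volume.restrict S) :=
    (integrable_comp_sub hkc hks x).integrableOn.mul_const _
  have hi2 : Integrable (Ω.indicator fun y => l * Kk * |w y|) (volume.restrict S) :=
    ((integrable_indicator_iff hΩ).2 (hw.abs.const_mul _)).restrict
  have hpt : ∀ᵐ y ∂volume.restrict S, ‖k (x - y) * Φ x (w y - w x)‖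
      ≤ k (x - y) * (l * (|w x| + M)) + Ω.indicator (fun y => l * Kk * |w y|) y := by
    rw [← union_sdiff_cancel hΩS, ae_restrict_union_iff]
    have hgen : ∀ y, ‖k (x - y) * Φ x (w y - w x)‖ ≤ k (x - y) * (l * (|w y| + |w x|)) := by
      intro y
      rw [norm_mul, Real.norm_of_nonneg (hk0 _), Real.norm_eq_abs]
      refine mul_le_mul_of_nonneg_left ?_ (hk0 _)
      exact (hΦ _).trans (mul_le_mul_of_nonneg_left (abs_sub _ _) hl)
    constructor
    · filter_upwards [ae_restrict_mem hΩ] with y hy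
      refine (hgen y).trans ?_
      rw [indicator_of_mem hy]
      have h1 : k (x - y) * (l * |w y|) ≤ Kk * (l * |w y|) := by
        have := hKk (x - y)
        gcongr
      have h2 : 0 ≤ k (x - y) * (l * M) := mul_nonneg (hk0 _) (by positivity)
      nlinarith
    · filter_upwards [hwM] with y hy
      refine (hgen y).trans ?_
      have h3 : 0 ≤ Ω.indicator (fun y => l * Kk * |w y|) y :=
        indicator_nonneg (fun y _ => by positivity) y
      have h4 : k (x - y) * (l * (|w y| + |w x|)) ≤ k (x - y) * (l * (|w x| + M)) := by
        refine mul_le_mul_of_nonneg_left (mul_le_mul_of_nonneg_left (by linarith) hl) (hk0 _)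
      linarith
  have hI := norm_integral_le_of_norm_le (hi1.add hi2) hpt
  simp only [Pi.add_apply] at hI
  rw [integral_add hi1 hi2, integral_mul_const, setIntegral_indicator hΩ,
    inter_eq_right.2 hΩS, integral_const_mul] at hI
  have h1 : (∫ y in S, k (x - y)) * (l * (|w x| + M)) ≤ (∫ z, k z) * (l * (|w x| + M)) :=
    mul_le_mul_of_nonneg_right (setIntegral_comp_sub_le hkc hks hk0 x) (by positivity)
  have h2 : l * Kk * ∫ y in Ω, |w y| ≤ l * Kk * A := by gcongr
  rw [Real.norm_eq_abs] at hI
  unfold jumpOp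
  linarith

theorem IsL1Solution.exists_integral_le (hT : 0 ≤ T) (hu : IsL1Solution Ω S T k Φ h u₀ u) :
    ∃ A, ∀ t ∈ Icc 0 T, ∫ y in Ω, |u y t| ≤ A := by
  have hc : ContinuousOn (fun t => ∫ y in Ω, |u y t|) (Icc 0 T) := by
    intro t ht
    refine tendsto_iff_dist_tendsto_zero.2 ?_
    refine tendsto_of_tendsto_of_tendsto_of_le_of_le' tendsto_const_nhds (hu.continuous t ht)
      (Eventually.of_forall fun s => dist_nonneg) ?_
    filter_upwards [self_mem_nhdsWithin] with s hs
    have his := (hu.integrable s hs)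
    have hit := (hu.integrable t ht)
    rw [Real.dist_eq, ← integral_sub his.abs hit.abs]
    refine (abs_integral_le_integral_abs).trans ?_
    refine integral_mono (his.abs.sub hit.abs).abs (his.sub hit).abs fun y => ?_
    exact abs_abs_sub_abs_le_abs_sub _ _
  obtain ⟨s, -, hs⟩ := isCompact_Icc.exists_isMaxOn ⟨0, left_mem_Icc.2 hT⟩ hc
  exact ⟨_, fun t ht => hs ht⟩

end

/-- Tonelli applied to |f - g|. It allows the order of "almost every x" and "almost every t" to be
exchanged. -/
theorem ae_prod_eq_of_ae_ae {X Y : Type*} [MeasurableSpace X] [MeasurableSpace Y] {μ : Measure X}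
    {ν : Measure Y} [SFinite μ] [SFinite ν] {f g : X × Y → ℝ} (hf : AEStronglyMeasurable f (μ.prod ν))
    (hg : AEStronglyMeasurable g (μ.prod ν)) (h : ∀ᵐ y ∂ν, ∀ᵐ x ∂μ, f (x, y) = g (x, y)) :
    ∀ᵐ p ∂μ.prod ν, f p = g p := by
  have hm : AEMeasurable (fun p => ‖f p - g p‖ₑ) (μ.prod ν) := (hf.sub hg).enorm
  have h0 : ∫⁻ p, ‖f p - g p‖ₑ ∂μ.prod ν = 0 := by
    rw [lintegral_prod_symm _ hm, lintegral_eq_zero_of_ae_eq_zero]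
    filter_upwards [h] with y hy
    rw [Pi.zero_apply, lintegral_eq_zero_of_ae_eq_zero]
    filter_upwards [hy] with x hx
    simp [hx]
  rw [lintegral_eq_zero_iff' hm] at h0
  filter_upwards [h0] with p hp
  simpa [sub_eq_zero] using hp

theorem ae_ae_swap_of_ae_prod {X Y : Type*} [MeasurableSpace X] [MeasurableSpace Y] {μ : Measure X}
    {ν : Measure Y} [SFinite μ] [SFinite ν] {p : X × Y → Prop} (h : ∀ᵐ z ∂μ.prod ν, p z) :
    ∀ᵐ y ∂ν, ∀ᵐ x ∂μ, p (x, y) :=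
  Measure.ae_ae_of_ae_prod
    ((Measure.measurePreserving_swap (μ := ν) (ν := μ)).quasiMeasurePreserving.ae h)

section

variable {n : ℕ} {Ω S : Set (Eucl n)} {T : ℝ} {k : Eucl n → ℝ} {Φ : Eucl n → ℝ → ℝ}
  {h : Eucl n → ℝ → ℝ} {u₀ : Eucl n → ℝ} {u : Eucl n → ℝ → ℝ}

/-- For almost every `x`, the operator applied to an `L¹` solution agrees at almost every time
with a jointly measurable function of `(x,τ)`. -/
theorem IsL1Solution.exists_measurable_jumpOp (hu : IsL1Solution Ω S T k Φ h u₀ u)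
    (hΩ : MeasurableSet Ω) (hS : MeasurableSet S) (hΩS : Ω ⊆ S) (hkc : Continuous k)
    (hΦm : ∀ s, AEMeasurable (fun x => Φ x s) (volume.restrict Ω))
    (hΦc : ∀ᵐ x ∂volume.restrict Ω, Continuous (Φ x))
    (hh : ContinuousOn (fun p : Eucl n × ℝ => h p.1 p.2) ((S \ Ω) ×ˢ Ioo 0 T)) :
    ∃ M : Eucl n × ℝ → ℝ, StronglyMeasurable M ∧ ∀ᵐ x ∂volume.restrict Ω,
      ∀ᵐ τ ∂volume.restrict (Ioo 0 T), jumpOp S k Φ (fun y => u y τ) x = M (x, τ) := by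
  classical
  obtain ⟨Ψ, hΨm, hΨ⟩ := exists_measurable_version hΦm hΦc
  -- Outside Ω the solution is known only time by time; replacing it there by the continuous datum
  -- makes the function jointly measurable without changing almost any slice.
  set U : Eucl n × ℝ → ℝ := fun p => if p.1 ∈ Ω then u p.1 p.2 else h p.1 p.2 with hUdef
  have hprod : ∀ A : Set (Eucl n), (volume.restrict A).prod (volume.restrict (Ioo 0 T))
      = (volume : Measure (Eucl n × ℝ)).restrict (A ×ˢ Ioo 0 T) := fun A => by
    rw [Measure.prod_restrict, ← Measure.volume_eq_prod]
  have hUm : AEStronglyMeasurable U ((volume.restrict S).prod (volume.restrict (Ioo 0 T))) := by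
    rw [hprod, ← union_sdiff_cancel hΩS, union_prod, aestronglyMeasurable_union_iff]
    constructor
    · refine hu.measurable.congr ?_
      filter_upwards [ae_restrict_mem (hΩ.prod measurableSet_Ioo)] with p hp
      simp [hUdef, hp.1]
    · have h1 := hh.aestronglyMeasurable (μ := volume) ((hS.diff hΩ).prod measurableSet_Ioo)
      refine h1.congr ?_
      filter_upwards [ae_restrict_mem ((hS.diff hΩ).prod measurableSet_Ioo)] with p hp
      simp [hUdef, hp.1.2]
  set V := hUm.mk U with hV
  have hVm : StronglyMeasurable V := hUm.stronglyMeasurable_mk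
  have hUV : ∀ᵐ p ∂(volume.restrict S).prod (volume.restrict (Ioo 0 T)), U p = V p := hUm.ae_eq_mk
  have hUVΩ : ∀ᵐ p ∂(volume.restrict Ω).prod (volume.restrict (Ioo 0 T)), U p = V p := by
    rw [hprod] at hUV ⊢
    exact ae_restrict_of_ae_restrict_of_subset (prod_mono_left hΩS) hUV
  have hgood : ∀ᵐ τ ∂volume.restrict (Ioo 0 T), ∀ᵐ y ∂volume.restrict S, u y τ = V (y, τ) := by
    filter_upwards [ae_ae_swap_of_ae_prod hUV, ae_restrict_mem measurableSet_Ioo] with τ h1 hτ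
    have h2 : ∀ᵐ y ∂volume.restrict S, u y τ = U (y, τ) := by
      rw [← union_sdiff_cancel hΩS, ae_restrict_union_iff]
      constructor
      · filter_upwards [ae_restrict_mem hΩ] with y hy
        simp [hUdef, hy]
      · filter_upwards [hu.exterior τ hτ, ae_restrict_mem (hS.diff hΩ)] with y hy hy'
        simp [hUdef, hy'.2, hy]
    filter_upwards [h1, h2] with y hy1 hy2
    rw [hy2, hy1]
  refine ⟨fun p => ∫ y in S, k (p.1 - y) * Ψ p.1 (V (y, p.2) - V p), ?_, ?_⟩
  · refine StronglyMeasurable.integral_prod_right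
      (f := fun (p : Eucl n × ℝ) y => k (p.1 - y) * Ψ p.1 (V (y, p.2) - V p)) ?_
    refine Measurable.stronglyMeasurable ?_
    have hVm' := hVm.measurable
    have hk := hkc.measurable
    have h1 : Measurable fun q : (Eucl n × ℝ) × Eucl n => (V (q.2, q.1.2) - V q.1, q.1.1) := by
      fun_prop
    have h2 := hΨm.comp h1
    have h3 : Measurable fun q : (Eucl n × ℝ) × Eucl n => k (q.1.1 - q.2) := by fun_prop
    exact h3.mul h2
  · filter_upwards [Measure.ae_ae_of_ae_prod hUVΩ, hΨ, ae_restrict_mem hΩ] with x h1 h2 h3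
    filter_upwards [h1, hgood] with τ h4 h5
    have h6 : u x τ = V (x, τ) := by rw [← h4]; simp [hUdef, h3]
    refine integral_congr_ae ?_
    filter_upwards [h5] with y hy
    rw [hy, h6, h2]

theorem stronglyMeasurable_primitive {X : Type*} [MeasurableSpace X] {M : X × ℝ → ℝ}
    (hM : StronglyMeasurable M) :
    StronglyMeasurable fun p : X × ℝ => ∫ τ in Ioc 0 p.2, M (p.1, τ) := by
  have h1 : ∀ p : X × ℝ, ∫ τ in Ioc 0 p.2, M (p.1, τ)
      = ∫ τ, ({q : (X × ℝ) × ℝ | 0 < q.2 ∧ q.2 ≤ q.1.2}.indicator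
        fun q => M (q.1.1, q.2)) (p, τ) := by
    intro p
    rw [← integral_indicator measurableSet_Ioc]
    rfl
  simp only [h1]
  refine StronglyMeasurable.integral_prod_right
    (f := fun (p : X × ℝ) τ => ({q : (X × ℝ) × ℝ | 0 < q.2 ∧ q.2 ≤ q.1.2}.indicator
        fun q => M (q.1.1, q.2)) (p, τ)) ?_
  refine StronglyMeasurable.indicator (f := fun q : (X × ℝ) × ℝ => M (q.1.1, q.2)) ?_ ?_
  · exact hM.comp_measurable (by fun_prop)
  · exact (measurableSet_lt measurable_const measurable_snd).inter
      (measurableSet_le measurable_snd (measurable_snd.comp measurable_fst))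

/-- The null set in the equation depends on t. The remedy is to redefine the solution as the time
primitive of a jointly measurable version of the operator: it is continuous in time for almost every
x, equals u at each time almost everywhere, and by Fubini is itself a solution. -/
theorem IsL1Solution.exists_mild (hu : IsL1Solution Ω S T k Φ h u₀ u) (hT : 0 < T)
    (hΩ : MeasurableSet Ω) (hΩb : volume Ω ≠ ⊤) (hS : MeasurableSet S) (hΩS : Ω ⊆ S)
    (hkc : Continuous k) (hks : HasCompactSupport k) (hk0 : ∀ z, 0 ≤ k z)
    (hΦm : ∀ s, AEMeasurable (fun x => Φ x s) (volume.restrict Ω)) {l : ℝ} (hl : 0 ≤ l)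
    (hΦ : ∀ᵐ x ∂volume.restrict Ω, Continuous (Φ x) ∧ ∀ s, |Φ x s| ≤ l * |s|)
    (hh : ContinuousOn (fun p : Eucl n × ℝ => h p.1 p.2) ((S \ Ω) ×ˢ Ioo 0 T)) {M : ℝ}
    (hM0 : 0 ≤ M) (hhM : ∀ t ∈ Ioo 0 T, ∀ y ∈ S \ Ω, |h y t| ≤ M)
    (hu₀m : AEStronglyMeasurable u₀ (volume.restrict Ω))
    (hu₀M : ∀ x ∈ Ω, |u₀ x| ≤ M) :
    ∃ w, IsMildSolution Ω S T k Φ h u₀ w ∧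
      ∀ t ∈ Icc 0 T, ∀ᵐ x ∂volume.restrict Ω, w x t = u x t := by
  classical
  have : IsFiniteMeasure (volume.restrict Ω) := ⟨by simpa using hΩb.lt_top⟩
  obtain ⟨N, hNm, hN⟩ := hu.exists_measurable_jumpOp hΩ hS hΩS hkc hΦm
    (hΦ.mono fun x hx => hx.1) hh
  obtain ⟨A, hA⟩ := hu.exists_integral_le hT.le
  obtain ⟨Kk, hKk⟩ : ∃ C, ∀ z, k z ≤ C := by
    obtain ⟨C, hC⟩ := hkc.bounded_above_of_compact_support hks
    exact ⟨C, fun z => (le_abs_self _).trans (hC z)⟩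
  set κ := ∫ z, k z with hκ
  have hκ0 : 0 ≤ κ := integral_nonneg hk0
  set C := l * κ * M + l * Kk * A with hCdef
  have hprod : (volume.restrict Ω).prod (volume.restrict (Ioo 0 T))
      = (volume : Measure (Eucl n × ℝ)).restrict (Ω ×ˢ Ioo 0 T) := by
    rw [Measure.prod_restrict, ← Measure.volume_eq_prod]
  have hum := hu.measurable
  rw [← hprod] at hum
  have hKk0 : 0 ≤ Kk := (hk0 0).trans (hKk 0)
  have hA0 : 0 ≤ A := (integral_nonneg fun y => abs_nonneg _).trans (hA 0 (left_mem_Icc.2 hT.le))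
  have hC0 : 0 ≤ C := by positivity
  -- integrability of the operator in time
  have huint : Integrable (fun p : Eucl n × ℝ => u p.1 p.2)
      ((volume.restrict Ω).prod (volume.restrict (Ioo 0 T))) := by
    rw [integrable_prod_iff' hum]
    constructor
    · filter_upwards [ae_restrict_mem measurableSet_Ioo] with t ht
      exact hu.integrable t (Ioo_subset_Icc_self ht)
    · refine Integrable.mono' (integrable_const A) hum.norm.prod_swap.integral_prod_right' ?_
      filter_upwards [ae_restrict_mem measurableSet_Ioo] with t ht
      rw [Real.norm_of_nonneg (integral_nonneg fun x => norm_nonneg _)]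
      exact hA t (Ioo_subset_Icc_self ht)
  have hextM : ∀ τ ∈ Ioo 0 T, ∀ᵐ y ∂volume.restrict (S \ Ω), |u y τ| ≤ M := by
    intro τ hτ
    filter_upwards [hu.exterior τ hτ, ae_restrict_mem (hS.diff hΩ)] with y h1 h2
    rw [h1]
    exact hhM τ hτ y h2
  have hNint : ∀ᵐ x ∂volume.restrict Ω, IntegrableOn (fun τ => N (x, τ)) (Ioo 0 T) := by
    filter_upwards [hN, huint.prod_right_ae, hΦ] with x h1 h2 h3
    have hi : IntegrableOn (fun τ => l * κ * |u x τ| + C) (Ioo 0 T) :=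
      (h2.abs.const_mul _).add (integrable_const C)
    refine hi.mono' ?_ ?_
    · exact (hNm.comp_measurable measurable_prodMk_left).aestronglyMeasurable
    · filter_upwards [h1, ae_restrict_mem measurableSet_Ioo] with τ h4 hτ
      rw [← h4]
      exact abs_jumpOp_le (w := fun y => u y τ) hΩ hΩS hkc hks hk0 hKk hl hM0 h3.2
        (hu.integrable τ (Ioo_subset_Icc_self hτ)) (hextM τ hτ) (hA τ (Ioo_subset_Icc_self hτ))
  set w : Eucl n → ℝ → ℝ := fun x t =>
    if x ∈ Ω then u₀ x + ∫ τ in (0 : ℝ)..t, N (x, τ) else h x t with hw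
  have hwΩ : ∀ x ∈ Ω, ∀ t, w x t = u₀ x + ∫ τ in (0 : ℝ)..t, N (x, τ) := fun x hx t => by
    simp [hw, hx]
  -- agreement with `u`
  have hwu : ∀ t ∈ Ioo 0 T, ∀ᵐ x ∂volume.restrict Ω, w x t = u x t := by
    intro t ht
    filter_upwards [hu.equation t ht, hN, ae_restrict_mem hΩ] with x h1 h2 h3
    rw [hwΩ x h3, h1, add_comm]
    congr 1
    refine intervalIntegral.integral_congr_ae ?_
    rw [uIoc_of_le ht.1.le, ← ae_restrict_iff' measurableSet_Ioc]
    refine (ae_restrict_of_ae_restrict_of_subset (Ioc_subset_Ioo_right ht.2) h2).mono ?_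
    exact fun τ hτ => hτ.symm
  have hwext : ∀ t ∈ Ioo 0 T, ∀ᵐ y ∂volume.restrict (S \ Ω), w y t = h y t := by
    intro t _
    filter_upwards [ae_restrict_mem (hS.diff hΩ)] with y hy
    simp [hw, hy.2]
  have hwuS : ∀ t ∈ Ioo 0 T, ∀ᵐ y ∂volume.restrict S, w y t = u y t := by
    intro t ht
    rw [← union_sdiff_cancel hΩS, ae_restrict_union_iff]
    refine ⟨hwu t ht, ?_⟩
    filter_upwards [hwext t ht, hu.exterior t ht] with y h1 h2
    rw [h1, h2]
  -- The operator at (x,τ) involves the value at x itself, so agreement is needed along almost every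
  -- vertical line and not only on time slices.
  have hwuprod : ∀ᵐ x ∂volume.restrict Ω, ∀ᵐ t ∂volume.restrict (Ioo 0 T), w x t = u x t := by
    have hwm : AEStronglyMeasurable (fun p : Eucl n × ℝ => w p.1 p.2)
        ((volume.restrict Ω).prod (volume.restrict (Ioo 0 T))) := by
      have h1 : AEStronglyMeasurable (fun p : Eucl n × ℝ => u₀ p.1 + ∫ τ in Ioc 0 p.2, N (p.1, τ))
          ((volume.restrict Ω).prod (volume.restrict (Ioo 0 T))) :=
        hu₀m.comp_fst.add (stronglyMeasurable_primitive hNm).aestronglyMeasurable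
      refine h1.congr ?_
      rw [hprod]
      filter_upwards [ae_restrict_mem (hΩ.prod measurableSet_Ioo)] with p hp
      rw [hwΩ _ hp.1, intervalIntegral.integral_of_le hp.2.1.le]
    refine Measure.ae_ae_of_ae_prod (p := fun p : Eucl n × ℝ => w p.1 p.2 = u p.1 p.2)
      (ae_prod_eq_of_ae_ae hwm hum ?_)
    filter_upwards [ae_restrict_mem measurableSet_Ioo] with t ht using hwu t ht
  have hNw : ∀ᵐ x ∂volume.restrict Ω, ∀ᵐ τ ∂volume.restrict (Ioo 0 T),
      N (x, τ) = jumpOp S k Φ (fun y => w y τ) x := by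
    filter_upwards [hN, hwuprod] with x h1 h2
    filter_upwards [h1, h2, ae_restrict_mem measurableSet_Ioo] with τ h3 h4 hτ
    rw [← h3]
    exact (jumpOp_congr h4 (hwuS τ hτ)).symm
  have heq : ∀ᵐ x ∂volume.restrict Ω,
      IntervalIntegrable (fun τ => jumpOp S k Φ (fun y => w y τ) x) volume 0 T ∧
      ∀ t ∈ Icc 0 T, w x t = u₀ x + ∫ τ in (0 : ℝ)..t, jumpOp S k Φ (fun y => w y τ) x := by
    filter_upwards [hNint, hNw, ae_restrict_mem hΩ] with x h1 h2 h3
    constructor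
    · rw [intervalIntegrable_iff_integrableOn_Ioo_of_le hT.le]
      exact h1.congr h2
    · intro t ht
      rw [hwΩ x h3]
      congr 1
      refine intervalIntegral.integral_congr_ae ?_
      rw [uIoc_of_le ht.1, ← ae_restrict_iff' measurableSet_Ioc, ← restrict_Ioo_eq_restrict_Ioc]
      exact ae_restrict_of_ae_restrict_of_subset (Ioo_subset_Ioo_right ht.2) h2
  have hwint : ∀ t ∈ Ioo 0 T, IntegrableOn (fun x => w x t) Ω := fun t ht =>
    (hu.integrable t (Ioo_subset_Icc_self ht)).congr ((hwu t ht).mono fun x hx => hx.symm)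
  set B := 2 * (M + C * T) * Real.exp (2 * (l * κ) * T) with hB
  have hbound : ∀ᵐ x ∂volume.restrict Ω, ∀ t ∈ Icc 0 T, |w x t| ≤ B := by
    filter_upwards [heq, hΦ, ae_restrict_mem hΩ] with x h1 h2 h3 t ht
    refine (abs_le_of_integral_equation hT.le hC0 h1.1 h1.2 (l := l * κ) (by positivity) ?_ t
      ht).trans ?_
    · intro τ hτ
      refine abs_jumpOp_le (w := fun y => w y τ) hΩ hΩS hkc hks hk0 hKk hl hM0 h2.2
        (hwint τ hτ) ?_ ?_
      · filter_upwards [hwext τ hτ, ae_restrict_mem (hS.diff hΩ)] with y h4 h5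
        rw [h4]
        exact hhM τ hτ y h5
      · have h6 : ∫ y in Ω, |w y τ| = ∫ y in Ω, |u y τ| :=
          integral_congr_ae ((hwu τ hτ).mono fun x hx => by simp only [hx])
        rw [h6]
        exact hA τ (Ioo_subset_Icc_self hτ)
    · rw [hB]
      have := hu₀M x h3
      gcongr
  refine ⟨w, ⟨?_, ⟨max B M, hM0.trans (le_max_right _ _), ?_⟩, heq, hwext⟩, ?_⟩
  · intro t ht
    rw [← union_sdiff_cancel hΩS, aestronglyMeasurable_union_iff]
    refine ⟨(hwint t ht).1, ?_⟩
    have h1 : ContinuousOn (fun y => h y t) (S \ Ω) :=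
      hh.comp (f := fun y => (y, t)) (by fun_prop) fun y hy => ⟨hy, ht⟩
    exact (h1.aestronglyMeasurable (hS.diff hΩ)).congr ((hwext t ht).mono fun y hy => hy.symm)
  · intro t ht
    rw [← union_sdiff_cancel hΩS, ae_restrict_union_iff]
    constructor
    · filter_upwards [hbound] with x hx
      exact (hx t (Ioo_subset_Icc_self ht)).trans (le_max_left _ _)
    · filter_upwards [hwext t ht, ae_restrict_mem (hS.diff hΩ)] with y h1 h2
      rw [h1]
      exact (hhM t ht y h2).trans (le_max_right _ _)
  · -- passage to the end points
    intro t ht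
    have hne : (𝓝[Ioo 0 T] t).NeBot := by
      rw [← mem_closure_iff_nhdsWithin_neBot, closure_Ioo hT.ne]
      exact ht
    have hcontw : ∀ᵐ x ∂volume.restrict Ω, ContinuousOn (w x) (Icc 0 T) := by
      filter_upwards [heq] with x hx
      have h1 := intervalIntegral.continuousOn_primitive_interval' hx.1 left_mem_uIcc
      rw [uIcc_of_le hT.le] at h1
      exact (continuousOn_const.add h1).congr hx.2
    have hut := hu.integrable t ht
    have hlim1 : Tendsto (fun s => ∫ x in Ω, |w x s - u x t|) (𝓝[Ioo 0 T] t)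
        (𝓝 (∫ x in Ω, |w x t - u x t|)) := by
      refine tendsto_integral_filter_of_dominated_convergence (fun x => B + |u x t|) ?_ ?_
        ((integrable_const B).add hut.abs) ?_
      · filter_upwards [self_mem_nhdsWithin] with s hs
        exact ((hwint s hs).sub hut).abs.1
      · filter_upwards [self_mem_nhdsWithin] with s hs
        filter_upwards [hbound] with x hx
        rw [Real.norm_eq_abs, abs_abs]
        exact (abs_sub _ _).trans (add_le_add (hx s (Ioo_subset_Icc_self hs)) le_rfl)
      · filter_upwards [hcontw] with x hx
        exact (((hx t ht).mono Ioo_subset_Icc_self).sub continuousWithinAt_const).abs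
    have hlim2 : Tendsto (fun s => ∫ x in Ω, |w x s - u x t|) (𝓝[Ioo 0 T] t) (𝓝 0) := by
      refine ((hu.continuous t ht).mono_left (nhdsWithin_mono t Ioo_subset_Icc_self)).congr' ?_
      filter_upwards [self_mem_nhdsWithin] with s hs
      refine integral_congr_ae ?_
      filter_upwards [hwu s hs] with x hx
      rw [hx]
    -- Dominated convergence for w and L¹-continuity of u compute the same limit, so w and u agree
    -- at time t as well.
    have h0 := tendsto_nhds_unique hlim1 hlim2
    have hwtm : AEStronglyMeasurable (fun x => w x t) (volume.restrict Ω) := by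
      have h1 : AEStronglyMeasurable (fun x => u₀ x + ∫ τ in Ioc 0 t, N (x, τ))
          (volume.restrict Ω) := by
        refine hu₀m.add (StronglyMeasurable.aestronglyMeasurable ?_)
        exact (stronglyMeasurable_primitive hNm).comp_measurable
          (measurable_id.prodMk measurable_const)
      refine h1.congr ?_
      filter_upwards [ae_restrict_mem hΩ] with x hx
      rw [hwΩ x hx, intervalIntegral.integral_of_le ht.1]
    have hwti : Integrable (fun x => w x t) (volume.restrict Ω) := by
      refine (integrable_const B).mono' hwtm ?_
      filter_upwards [hbound] with x hx using hx t ht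
    have hi : Integrable (fun x => |w x t - u x t|) (volume.restrict Ω) := (hwti.sub hut).abs
    rw [integral_eq_zero_iff_of_nonneg (fun x => abs_nonneg _) hi] at h0
    filter_upwards [h0] with x hx
    simpa [sub_eq_zero] using hx

end

/-! ### The limit problem -/

/-- `v` solves `v_t = Δv + μ|∇v|²` at `(x,t)`, with derivatives and Taylor remainder on the ball of
radius `r` controlled by `L`. -/
def SolvesAt {n : ℕ} (α r L : ℝ) (v : Eucl n → ℝ → ℝ) (μ : Eucl n → ℝ) (x : Eucl n) (t : ℝ) : Prop :=
  ∃ (a : Eucl n) (B : Eucl n →L[ℝ] Eucl n →L[ℝ] ℝ) (v' : ℝ), HasDerivAt (v x) v' t ∧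
    HasTaylorBound α r L (fun y => v y t) x a B ∧
    v' = ∑ i, B (EuclideanSpace.single i 1) (EuclideanSpace.single i 1) + μ x * ‖a‖ ^ 2

theorem HasTaylorBound.neg {n : ℕ} {α r L : ℝ} {w : Eucl n → ℝ} {x a : Eucl n}
    {B : Eucl n →L[ℝ] Eucl n →L[ℝ] ℝ} (h : HasTaylorBound α r L w x a B) :
    HasTaylorBound α r L (fun y => -w y) x (-a) (-B) where
  norm_le := by rw [norm_neg]; exact h.norm_le
  norm_hess_le := (ContinuousLinearMap.opNorm_neg B).trans_le h.norm_hess_le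
  remainder z hz := by
    rw [← abs_neg]
    convert h.remainder z hz using 2
    simp only [inner_neg_left, neg_apply]
    ring

theorem SolvesAt.neg {n : ℕ} {α r L : ℝ} {v : Eucl n → ℝ → ℝ} {μ : Eucl n → ℝ} {x : Eucl n} {t : ℝ}
    (h : SolvesAt α r L v μ x t) : SolvesAt α r L (fun y s => -v y s) (fun y => -μ y) x t := by
  obtain ⟨a, B, v', h1, h2, h3⟩ := h
  refine ⟨-a, -B, -v', h1.neg, h2.neg, ?_⟩
  rw [h3]
  simp only [neg_apply, norm_neg, Finset.sum_neg_distrib]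
  ring

noncomputable section

/-- The rescaled kernel with the diffusive time scaling. -/
def diffusiveKernel {n : ℕ} (J : Eucl n → ℝ) (ε : ℝ) (z : Eucl n) : ℝ :=
  (ε ^ 2)⁻¹ * rescaledKernel J ε z

/-- The region seen by the nonlocal equation. -/
def seenRegion {n : ℕ} (Ω : Set (Eucl n)) (J : Eucl n → ℝ) (ε : ℝ) : Set (Eucl n) :=
  Ω ∪ reach Ω (rescaledKernel J ε)

open Classical in
/-- The function equal to `v` in `Ω` and to `h` outside. -/
def glue {n : ℕ} (Ω : Set (Eucl n)) (v h : Eucl n → ℝ → ℝ) (y : Eucl n) (t : ℝ) : ℝ :=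
  if y ∈ Ω then v y t else h y t

end

/-- The support of J may miss the origin, so the reach of Ω need not contain Ω. Adjoining Ω does not
affect the integrals at points of Ω, since the kernel vanishes off the reach. -/
theorem subset_seenRegion {n : ℕ} {Ω : Set (Eucl n)} {J : Eucl n → ℝ} {ε : ℝ} :
    Ω ⊆ seenRegion Ω J ε := subset_union_left

theorem add_mem_seenRegion {n : ℕ} {Ω : Set (Eucl n)} {J : Eucl n → ℝ} {ε : ℝ} (hε : 0 < ε)
    {x z : Eucl n} (hx : x ∈ Ω) (hz : J z ≠ 0) : x + ε • z ∈ seenRegion Ω J ε :=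
  Or.inr (add_mem_reach hε hx hz)

/-- The hypotheses on domain, kernel, flux, limit solution `v` and exterior datum `h` under which
nonlocal solutions are compared with `v`. -/
structure LimitSetting {n : ℕ} (α T ε₀ R r M l₁ l₂ K m₀ : ℝ) (Ω : Set (Eucl n)) (J : Eucl n → ℝ)
    (Φ : Eucl n → ℝ → ℝ) (μ : Eucl n → ℝ) (v h : Eucl n → ℝ → ℝ) : Prop where
  exponent : α ∈ Ioo (0 : ℝ) 1
  time_pos : 0 < T
  isOpen : IsOpen Ω
  isBounded : Bornology.IsBounded Ω
  radius_pos : 0 < r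
  exteriorBalls : HasExteriorBalls Ω r
  kernel : IsKernel J
  range_pos : 0 < R
  range : ∀ z, R ≤ ‖z‖ → J z = 0
  lip_nonneg : 0 ≤ M
  l₁_pos : 0 < l₁
  l₂_nonneg : 0 ≤ l₂
  K_nonneg : 0 ≤ K
  m₀_nonneg : 0 ≤ m₀
  flux : ∀ᵐ x ∂volume.restrict Ω, FluxBounds (2 / secondMoment J) α l₁ l₂ K m₀ (Φ x) (μ x)
  continuousOn : ContinuousOn (fun p : Eucl n × ℝ => v p.1 p.2) (closure Ω ×ˢ Icc 0 T)
  interior : ∀ p ∈ Ω ×ˢ Ioo 0 T, ∃ U ∈ 𝓝 p, ∃ s > 0, ∃ L ≥ 0, ∀ q ∈ U,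
    SolvesAt α s L v μ q.1 q.2
  exterior : ∀ y ∈ exteriorCollar Ω J ε₀, ∀ p ∈ frontier Ω, ∀ t ∈ Ioo 0 T,
    |h y t - v p t| ≤ M * ‖y - p‖
  exterior_continuousOn : ∀ t ∈ Ioo 0 T, ContinuousOn (fun y => h y t) (exteriorCollar Ω J ε₀)
  frontier_lip : ∀ p ∈ frontier Ω, ∀ q ∈ frontier Ω, ∀ t ∈ Ioo 0 T,
    |v p t - v q t| ≤ M * ‖p - q‖

namespace LimitSetting

variable {n : ℕ} {α T ε₀ R r M l₁ l₂ K m₀ : ℝ} {Ω : Set (Eucl n)} {J : Eucl n → ℝ}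
  {Φ : Eucl n → ℝ → ℝ} {μ : Eucl n → ℝ} {v h : Eucl n → ℝ → ℝ}

theorem neg (H : LimitSetting α T ε₀ R r M l₁ l₂ K m₀ Ω J Φ μ v h) :
    LimitSetting α T ε₀ R r M l₁ l₂ K m₀ Ω J (fun x s => -Φ x (-s)) (fun x => -μ x)
      (fun x t => -v x t) (fun x t => -h x t) where
  __ := H
  flux := H.flux.mono fun x hx => hx.neg
  continuousOn := H.continuousOn.neg
  interior p hp := by
    obtain ⟨U, hU, s, hs, L, hL, hq⟩ := H.interior p hp
    exact ⟨U, hU, s, hs, L, hL, fun q hqU => (hq q hqU).neg⟩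
  exterior y hy p hp t ht := by
    have := H.exterior y hy p hp t ht
    rwa [neg_sub_neg, abs_sub_comm]
  exterior_continuousOn t ht := (H.exterior_continuousOn t ht).neg
  frontier_lip p hp q hq t ht := by
    have := H.frontier_lip p hp q hq t ht
    rwa [neg_sub_neg, abs_sub_comm]

theorem measurableSet_seenRegion (H : LimitSetting α T ε₀ R r M l₁ l₂ K m₀ Ω J Φ μ v h)
    (ε : ℝ) : MeasurableSet (seenRegion Ω J ε) :=
  (H.isOpen.union (isOpen_reach H.isOpen _)).measurableSet

theorem collar (H : LimitSetting α T ε₀ R r M l₁ l₂ K m₀ Ω J Φ μ v h)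
    {ε : ℝ} (hε : ε ∈ Ioc 0 ε₀) {y : Eucl n} (hy : y ∈ seenRegion Ω J ε \ Ω) :
    y ∈ exteriorCollar Ω J ε₀ ∧ ∃ p ∈ frontier Ω, ‖y - p‖ ≤ ε * R := by
  have hyr : y ∈ reach Ω (rescaledKernel J ε) := hy.1.resolve_left hy.2
  refine ⟨⟨mem_biUnion hε hyr, hy.2⟩, ?_⟩
  obtain ⟨x, hx, hxy⟩ := exists_of_mem_reach hε.1 H.range hyr
  obtain ⟨p, hp, hpy⟩ := exists_frontier_between H.isOpen hx hy.2
  exact ⟨p, hp, hpy.trans hxy⟩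

theorem exists_bound (H : LimitSetting α T ε₀ R r M l₁ l₂ K m₀ Ω J Φ μ v h) :
    ∃ B ≥ 0, ∀ x ∈ closure Ω, ∀ t ∈ Icc 0 T, |v x t| ≤ B := by
  have hcpt : IsCompact (closure Ω ×ˢ Icc (0 : ℝ) T) :=
    H.isBounded.isCompact_closure.prod isCompact_Icc
  obtain ⟨B, hB⟩ := hcpt.exists_bound_of_continuousOn H.continuousOn
  exact ⟨max B 0, le_max_right _ _, fun x hx t ht =>
    (hB (x, t) ⟨hx, ht⟩).trans (le_max_left _ _)⟩

theorem aestronglyMeasurable_of_continuousOn (H : LimitSetting α T ε₀ R r M l₁ l₂ K m₀ Ω J Φ μ v h)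
    {ε : ℝ} {w : Eucl n → ℝ}
    (h1 : ContinuousOn w Ω) (h2 : ContinuousOn w (seenRegion Ω J ε \ Ω)) :
    AEStronglyMeasurable w (volume.restrict (seenRegion Ω J ε)) := by
  rw [← union_sdiff_cancel (subset_seenRegion (Ω := Ω) (J := J) (ε := ε)),
    aestronglyMeasurable_union_iff]
  exact ⟨h1.aestronglyMeasurable H.isOpen.measurableSet,
    h2.aestronglyMeasurable ((H.measurableSet_seenRegion ε).diff H.isOpen.measurableSet)⟩

theorem continuousOn_slice (H : LimitSetting α T ε₀ R r M l₁ l₂ K m₀ Ω J Φ μ v h)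
    {t : ℝ} (ht : t ∈ Icc 0 T) :
    ContinuousOn (fun y => v y t) (closure Ω) :=
  H.continuousOn.comp (f := fun y => (y, t)) (by fun_prop) fun _ hy => ⟨hy, ht⟩

theorem continuousOn_time (H : LimitSetting α T ε₀ R r M l₁ l₂ K m₀ Ω J Φ μ v h)
    {x : Eucl n} (hx : x ∈ closure Ω) :
    ContinuousOn (v x) (Icc 0 T) :=
  H.continuousOn.comp (f := fun t => (x, t)) (by fun_prop) fun _ ht => ⟨hx, ht⟩

theorem continuousOn_glue (H : LimitSetting α T ε₀ R r M l₁ l₂ K m₀ Ω J Φ μ v h)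
    {t : ℝ} (ht : t ∈ Icc 0 T) : ContinuousOn (fun y => glue Ω v h y t) Ω :=
  ((H.continuousOn_slice ht).mono subset_closure).congr fun y hy => by simp [glue, hy]

theorem continuousOn_glue_compl (H : LimitSetting α T ε₀ R r M l₁ l₂ K m₀ Ω J Φ μ v h)
    {ε : ℝ} (hε : ε ∈ Ioc 0 ε₀) {t : ℝ} (ht : t ∈ Ioo 0 T) :
    ContinuousOn (fun y => glue Ω v h y t) (seenRegion Ω J ε \ Ω) :=
  ((H.exterior_continuousOn t ht).mono fun _ hy => (H.collar hε hy).1).congr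
    fun y hy => by simp [glue, hy.2]

theorem exists_glue_bound (H : LimitSetting α T ε₀ R r M l₁ l₂ K m₀ Ω J Φ μ v h) :
    ∃ B ≥ 0, ∀ ε ∈ Ioc 0 ε₀, ε * R ≤ 1 → ∀ t ∈ Ioo 0 T,
    ∀ y ∈ seenRegion Ω J ε, |glue Ω v h y t| ≤ B := by
  obtain ⟨B, hB0, hB⟩ := H.exists_bound
  refine ⟨B + M, add_nonneg hB0 H.lip_nonneg, fun ε hε hεR t ht y hy => ?_⟩
  by_cases hyΩ : y ∈ Ω
  · have := hB y (subset_closure hyΩ) t (Ioo_subset_Icc_self ht)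
    have hM := H.lip_nonneg
    simp only [glue, hyΩ, if_true]
    linarith
  · obtain ⟨hyc, p, hp, hpy⟩ := H.collar hε ⟨hy, hyΩ⟩
    have h1 := H.exterior y hyc p hp t ht
    have h2 := hB p (frontier_subset_closure hp) t (Ioo_subset_Icc_self ht)
    simp only [glue, hyΩ, if_false]
    have h3 : |h y t| ≤ |v p t| + |h y t - v p t| := by
      have := abs_add_le (v p t) (h y t - v p t)
      simpa using this
    have h4 : M * ‖y - p‖ ≤ M * 1 := mul_le_mul_of_nonneg_left (hpy.trans hεR) H.lip_nonneg
    linarith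

end LimitSetting

/-! ### The nonlocal operator in the scaled variable z -/

section Operator

variable {n : ℕ} {Ω : Set (Eucl n)} {J : Eucl n → ℝ} {Φ : Eucl n → ℝ → ℝ} {ε : ℝ}

theorem jumpOp_seenRegion (hJ : IsKernel J) (hε : 0 < ε) {x : Eucl n} (hx : x ∈ Ω)
    (w : Eucl n → ℝ) : jumpOp (seenRegion Ω J ε) (diffusiveKernel J ε) Φ w x
      = (ε ^ 2)⁻¹ * ∫ z, J z * Φ x (w (x + ε • z) - w x) := by
  rw [← integral_rescaledKernel hJ hε x (fun y => Φ x (w y - w x)), jumpOp,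
    ← integral_const_mul, setIntegral_eq_integral_of_forall_compl_eq_zero]
  · simp only [diffusiveKernel, mul_assoc]
  · intro y hy
    by_contra hne
    exact hy (Or.inr (mem_reach_of_ne_zero hJ hx
      (right_ne_zero_of_mul (left_ne_zero_of_mul hne))))

theorem quasiMeasurePreserving_add_smul (hε : 0 < ε) (x : Eucl n) :
    Measure.QuasiMeasurePreserving (fun z : Eucl n => x + ε • z) volume volume := by
  have h1 : Measure.QuasiMeasurePreserving (fun z : Eucl n => ε • z) volume volume := by
    refine ⟨by fun_prop, ?_⟩
    rw [Measure.map_addHaar_smul _ hε.ne']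
    exact Measure.smul_absolutelyContinuous
  exact (measurePreserving_add_left volume x).quasiMeasurePreserving.comp h1

theorem aestronglyMeasurable_jump (hJ : IsKernel J) (hε : 0 < ε)
    (hS : MeasurableSet (seenRegion Ω J ε)) {x : Eucl n} (hx : x ∈ Ω) (hΦ : Continuous (Φ x))
    {w : Eucl n → ℝ} (hw : AEStronglyMeasurable w (volume.restrict (seenRegion Ω J ε))) :
    AEStronglyMeasurable fun z => J z * Φ x (w (x + ε • z) - w x) := by
  have h1 : AEStronglyMeasurable ((seenRegion Ω J ε).indicator w) volume :=
    (aestronglyMeasurable_indicator_iff hS).2 hw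
  have h2 := h1.comp_quasiMeasurePreserving (quasiMeasurePreserving_add_smul hε x)
  have h3 : AEStronglyMeasurable fun z => J z *
      Φ x ((seenRegion Ω J ε).indicator w (x + ε • z) - w x) :=
    hJ.continuous.aestronglyMeasurable.mul
      (hΦ.comp_aestronglyMeasurable (h2.sub aestronglyMeasurable_const))
  refine h3.congr (Eventually.of_forall fun z => ?_)
  by_cases hz : J z = 0
  · simp [hz]
  · simp only [indicator_of_mem (add_mem_seenRegion hε hx hz)]

theorem integrable_jump (hJ : IsKernel J) (hε : 0 < ε)
    (hS : MeasurableSet (seenRegion Ω J ε)) {x : Eucl n} (hx : x ∈ Ω) (hΦ : Continuous (Φ x))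
    {l B : ℝ} (hl : 0 ≤ l) (hΦl : ∀ s, |Φ x s| ≤ l * |s|) {w : Eucl n → ℝ}
    (hw : AEStronglyMeasurable w (volume.restrict (seenRegion Ω J ε)))
    (hB : ∀ y ∈ seenRegion Ω J ε, |w y| ≤ B) :
    Integrable fun z => J z * Φ x (w (x + ε • z) - w x) := by
  refine (hJ.integrable.mul_const (l * (B + B))).mono'
    (aestronglyMeasurable_jump hJ hε hS hx hΦ hw) (Eventually.of_forall fun z => ?_)
  rw [norm_mul, Real.norm_of_nonneg (hJ.nonneg z), Real.norm_eq_abs]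
  by_cases hz : J z = 0
  · simp [hz]
  · refine mul_le_mul_of_nonneg_left ((hΦl _).trans (mul_le_mul_of_nonneg_left ?_ hl)) (hJ.nonneg z)
    exact (abs_sub _ _).trans (add_le_add (hB _ (add_mem_seenRegion hε hx hz))
      (hB _ (subset_seenRegion hx)))

theorem jumpOp_le (hJ : IsKernel J) (hε : 0 < ε)
    (hS : MeasurableSet (seenRegion Ω J ε)) {x : Eucl n} (hx : x ∈ Ω) (hΦ : Continuous (Φ x))
    {l B : ℝ} (hl : 0 ≤ l) (hΦl : ∀ s, |Φ x s| ≤ l * |s|) {w : Eucl n → ℝ}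
    (hw : AEStronglyMeasurable w (volume.restrict (seenRegion Ω J ε)))
    (hB : ∀ y ∈ seenRegion Ω J ε, |w y| ≤ B) {g : Eucl n → ℝ} (hg : Integrable fun z => J z * g z)
    (hle : ∀ z, J z ≠ 0 → Φ x (w (x + ε • z) - w x) ≤ g z) :
    jumpOp (seenRegion Ω J ε) (diffusiveKernel J ε) Φ w x ≤ (ε ^ 2)⁻¹ * ∫ z, J z * g z := by
  rw [jumpOp_seenRegion hJ hε hx]
  refine mul_le_mul_of_nonneg_left ?_ (by positivity)
  refine integral_mono (integrable_jump hJ hε hS hx hΦ hl hΦl hw hB) hg fun z => ?_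
  by_cases hz : J z = 0
  · simp [hz]
  · exact mul_le_mul_of_nonneg_left (hle z hz) (hJ.nonneg z)

theorem continuous_diffusiveKernel (hJ : IsKernel J) : Continuous (diffusiveKernel J ε) :=
  continuous_const.mul (continuous_rescaledKernel hJ)

theorem diffusiveKernel_nonneg (hJ : IsKernel J) (hε : 0 < ε) (z : Eucl n) :
    0 ≤ diffusiveKernel J ε z :=
  mul_nonneg (by positivity) (rescaledKernel_nonneg hJ hε z)

theorem hasCompactSupport_diffusiveKernel (hJ : IsKernel J) (hε : 0 < ε) :
    HasCompactSupport (diffusiveKernel J ε) :=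
  (hasCompactSupport_rescaledKernel hJ hε).mul_left

end Operator

namespace LimitSetting

variable {n : ℕ} {α T ε₀ R r M l₁ l₂ K m₀ : ℝ} {Ω : Set (Eucl n)} {J : Eucl n → ℝ}
  {Φ : Eucl n → ℝ → ℝ} {μ : Eucl n → ℝ} {v h : Eucl n → ℝ → ℝ}

theorem comparison (H : LimitSetting α T ε₀ R r M l₁ l₂ K m₀ Ω J Φ μ v h)
    {ε : ℝ} (hε : 0 < ε) {u₀ : Eucl n → ℝ} {u : Eucl n → ℝ → ℝ}
    (hu : IsMildSolution Ω (seenRegion Ω J ε) T (diffusiveKernel J ε) Φ h u₀ u)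
    {D : Set (Eucl n)} (hD : MeasurableSet D) (hDΩ : D ⊆ Ω) {a b B : ℝ} (ha : 0 ≤ a) (hab : a < b)
    (hb : b ≤ T) {w : Eucl n → ℝ → ℝ}
    (hwm : ∀ t ∈ Ioo a b, AEStronglyMeasurable (fun y => w y t)
      (volume.restrict (seenRegion Ω J ε)))
    (hwb : ∀ t ∈ Ioo a b, ∀ y ∈ seenRegion Ω J ε, |w y t| ≤ B)
    (hw : ∀ᵐ x ∂volume.restrict D, ContinuousOn (w x) (Icc a b) ∧
      ∀ t ∈ Ioo a b, ∃ w', HasDerivAt (w x) w' t ∧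
        jumpOp (seenRegion Ω J ε) (diffusiveKernel J ε) Φ (fun y => w y t) x ≤ w')
    (hext : ∀ t ∈ Ioo a b, ∀ᵐ y ∂volume.restrict (seenRegion Ω J ε \ D), u y t ≤ w y t)
    (hinit : ∀ᵐ x ∂volume.restrict D, u x a ≤ w x a) :
    ∀ᵐ x ∂volume.restrict D, ∀ t ∈ Icc a b, u x t ≤ w x t := by
  obtain ⟨B', hB', hub⟩ := hu.bounded
  have hsub : Ioo a b ⊆ Ioo 0 T := Ioo_subset_Ioo ha hb
  refine _root_.comparison (B := max B B') (κ := ∫ z, diffusiveKernel J ε z) hab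
    (hB'.trans (le_max_right _ _)) H.l₂_nonneg hD (hDΩ.trans subset_seenRegion)
    (continuous_diffusiveKernel H.kernel)
    (hasCompactSupport_diffusiveKernel H.kernel hε) (diffusiveKernel_nonneg H.kernel hε)
    (fun x _ => setIntegral_comp_sub_le (continuous_diffusiveKernel H.kernel)
      (hasCompactSupport_diffusiveKernel H.kernel hε) (diffusiveKernel_nonneg H.kernel hε) x)
    ?_ (fun t ht => hu.measurable t (hsub ht))
    (fun t ht => (hub t (hsub ht)).mono fun y hy => hy.trans (le_max_right _ _)) hwm
    (fun t ht => ?_) ?_ hw hext hinit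
  · filter_upwards [ae_restrict_of_ae_restrict_of_subset hDΩ H.flux] with x hx
    exact ⟨hx.continuous H.l₁_pos.le, hx.monotone H.l₁_pos.le, hx.abs_sub_le H.l₁_pos.le⟩
  · filter_upwards [ae_restrict_mem (H.measurableSet_seenRegion ε)] with y hy
    exact (hwb t ht y hy).trans (le_max_left _ _)
  · filter_upwards [ae_restrict_of_ae_restrict_of_subset hDΩ hu.equation] with x hx
    have hintg : ∀ c ∈ Icc 0 T, IntervalIntegrable (fun τ => jumpOp (seenRegion Ω J ε)
        (diffusiveKernel J ε) Φ (fun y => u y τ) x) volume 0 c := fun c hc => hx.1.mono_set (by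
      rw [uIcc_of_le H.time_pos.le, uIcc_of_le hc.1]; exact Icc_subset_Icc_right hc.2)
    have haT : a ∈ Icc 0 T := ⟨ha, hab.le.trans hb⟩
    have hbT : b ∈ Icc 0 T := ⟨ha.trans hab.le, hb⟩
    refine ⟨(hintg a haT).symm.trans (hintg b hbT), fun t ht => ?_⟩
    have htT : t ∈ Icc 0 T := ⟨ha.trans ht.1, ht.2.trans hb⟩
    rw [hx.2 t htT, hx.2 a haT, ← intervalIntegral.integral_interval_sub_left (hintg t htT)
      (hintg a haT)]
    ring

end LimitSetting

/-! ### A barrier in the boundary layer -/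

open Classical in
-- The second moment in direction f is c for every f. The slab |⟨f,z⟩| < θ accounts for at most θ² =
-- c/2 of it; the rest is at most R² times the mass of the two opposite half-spaces, which are equal
-- by evenness. Hence the bound c/(4R²), uniform in f.
theorem IsKernel.exists_halfspace_mass {n : ℕ} {J : Eucl n → ℝ} (hJ : IsKernel J) {R : ℝ}
    (hR : 0 < R) (hJR : ∀ z, R ≤ ‖z‖ → J z = 0) :
    ∃ θ > 0, ∃ p > 0, ∀ f : Eucl n, ‖f‖ = 1 →
      Integrable (fun z => J z * if θ ≤ inner ℝ f z then 1 else 0) ∧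
      p ≤ ∫ z, J z * if θ ≤ inner ℝ f z then 1 else 0 := by
  have hc := hJ.secondMoment_pos
  set c := secondMoment J with hcdef
  refine ⟨√(c / 2), by positivity, c / (4 * R ^ 2), by positivity, fun f hf => ?_⟩
  set θ := √(c / 2) with hθ
  have hθ2 : θ ^ 2 = c / 2 := Real.sq_sqrt (by positivity)
  have hθ0 : 0 < θ := by positivity
  set g : Eucl n → ℝ := fun z => if θ ≤ inner ℝ f z then 1 else 0 with hg
  have hgm : Measurable g := by
    refine Measurable.ite ?_ measurable_const measurable_const
    exact measurableSet_le measurable_const (by fun_prop)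
  have hg0 : ∀ z, 0 ≤ g z := fun z => by simp only [hg]; split_ifs <;> norm_num
  have hintg : Integrable (fun z => J z * g z) := by
    refine hJ.integrable.mul_bdd (c := 1) hgm.aestronglyMeasurable (Eventually.of_forall fun z => ?_)
    simp only [hg]
    split_ifs <;> norm_num
  have hintneg : Integrable (fun z => J z * g (-z)) := by
    have := hintg.comp_neg
    simpa only [hJ.map_neg] using this
  have hneg : ∫ z, J z * g (-z) = ∫ z, J z * g z := by
    have := integral_neg_eq_self (fun z => J z * g z) (volume : Measure (Eucl n))
    simpa only [hJ.map_neg] using this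
  refine ⟨hintg, ?_⟩
  have hle : ∫ z, J z * (inner ℝ f z) ^ 2
      ≤ ∫ z, (J z * θ ^ 2 + R ^ 2 * (J z * g z + J z * g (-z))) := by
    refine integral_mono (hJ.integrable_mul (by fun_prop))
      ((hJ.integrable.mul_const _).add ((hintg.add hintneg).const_mul _)) fun z => ?_
    have e : J z * θ ^ 2 + R ^ 2 * (J z * g z + J z * g (-z))
        = J z * (θ ^ 2 + R ^ 2 * (g z + g (-z))) := by ring
    show J z * (inner ℝ f z) ^ 2 ≤ J z * θ ^ 2 + R ^ 2 * (J z * g z + J z * g (-z))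
    rw [e]
    rcases le_or_gt R ‖z‖ with hz | hz
    · simp [hJR z hz]
    refine mul_le_mul_of_nonneg_left ?_ (hJ.nonneg z)
    have hin : |inner ℝ f z| ≤ R := by
      refine (abs_real_inner_le_norm f z).trans ?_
      rw [hf, one_mul]
      exact hz.le
    have hin2 : (inner ℝ f z) ^ 2 ≤ R ^ 2 := by
      rw [← sq_abs (inner ℝ f z)]
      gcongr
    rcases le_or_gt θ (inner ℝ f z) with h1 | h1
    · have : g z = 1 := by simp [hg, h1]
      nlinarith [hg0 (-z), sq_nonneg R, sq_nonneg θ, mul_nonneg (sq_nonneg R) (hg0 (-z))]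
    rcases le_or_gt (inner ℝ f z) (-θ) with h2 | h2
    · have : g (-z) = 1 := by
        simp only [hg, inner_neg_right]
        rw [if_pos (by linarith)]
      nlinarith [hg0 z, sq_nonneg R, sq_nonneg θ, mul_nonneg (sq_nonneg R) (hg0 z)]
    · have h3 : (inner ℝ f z) ^ 2 ≤ θ ^ 2 := sq_le_sq' h2.le h1.le
      have := mul_nonneg (sq_nonneg R) (add_nonneg (hg0 z) (hg0 (-z)))
      linarith
  have hadd : Integrable (fun z => J z * g z + J z * g (-z)) := hintg.add hintneg
  rw [hJ.integral_mul_inner_sq, hf, integral_add (hJ.integrable.mul_const _)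
    (hadd.const_mul _), integral_mul_const, hJ.integral_eq_one, integral_const_mul,
    integral_add hintg hintneg, hneg, hθ2, ← hcdef] at hle
  rw [div_le_iff₀ (by positivity)]
  linarith

noncomputable section

open Classical in
/-- A function that increases with the distance to the boundary at scale `ε`, with a jump at the
boundary. -/
def layer {n : ℕ} (Ω : Set (Eucl n)) (ε lam Q : ℝ) (y : Eucl n) : ℝ :=
  if y ∈ Ω then 1 - Real.exp (-(lam * Metric.infDist y Ωᶜ / ε)) else 1 - Q

end

section Layer

variable {n : ℕ} {Ω : Set (Eucl n)} {ε lam Q : ℝ}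

theorem layer_le_one (hQ : 0 ≤ Q) (y : Eucl n) : layer Ω ε lam Q y ≤ 1 := by
  unfold layer
  split_ifs
  · linarith [Real.exp_pos (-(lam * Metric.infDist y Ωᶜ / ε))]
  · linarith

theorem layer_add_pos (hlam : 0 ≤ lam) (hε : 0 ≤ ε) (hQ : 1 ≤ Q) (y : Eucl n) :
    1 ≤ layer Ω ε lam Q y + Q := by
  unfold layer
  split_ifs
  · have : Real.exp (-(lam * Metric.infDist y Ωᶜ / ε)) ≤ 1 := by
      rw [Real.exp_le_one_iff, neg_nonpos]
      exact div_nonneg (mul_nonneg hlam Metric.infDist_nonneg) hε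
    linarith
  · linarith

theorem layer_sub_le (hQ : 0 ≤ Q) {x : Eucl n} (hx : x ∈ Ω) (y : Eucl n) :
    layer Ω ε lam Q y - layer Ω ε lam Q x ≤ Real.exp (-(lam * Metric.infDist x Ωᶜ / ε)) := by
  have h1 := layer_le_one (Ω := Ω) (ε := ε) (lam := lam) hQ y
  have h2 : layer Ω ε lam Q x = 1 - Real.exp (-(lam * Metric.infDist x Ωᶜ / ε)) := by
    simp [layer, hx]
  linarith

/-- The choice of Q makes two kinds of jump equally useful: moving closer to the boundary by εδ
multiplies the exponential by at least Q, and leaving Ω meets the jump of size Q at the boundary. -/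
theorem layer_sub_le_of_infDist_le (hlam : 0 ≤ lam) (hε : 0 < ε) {δ : ℝ}
    (hQ : Q = Real.exp (lam * δ)) {x y : Eucl n} (hx : x ∈ Ω)
    (hy : y ∈ Ω → Metric.infDist y Ωᶜ ≤ Metric.infDist x Ωᶜ - ε * δ) :
    layer Ω ε lam Q y - layer Ω ε lam Q x
      ≤ -(Real.exp (-(lam * Metric.infDist x Ωᶜ / ε)) * (Q - 1)) := by
  have h2 : layer Ω ε lam Q x = 1 - Real.exp (-(lam * Metric.infDist x Ωᶜ / ε)) := by
    simp [layer, hx]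
  by_cases hyΩ : y ∈ Ω
  · have h3 : layer Ω ε lam Q y = 1 - Real.exp (-(lam * Metric.infDist y Ωᶜ / ε)) := by
      simp [layer, hyΩ]
    have h4 : Real.exp (-(lam * Metric.infDist x Ωᶜ / ε)) * Q
        ≤ Real.exp (-(lam * Metric.infDist y Ωᶜ / ε)) := by
      rw [hQ, ← Real.exp_add, Real.exp_le_exp]
      have h5 := mul_le_mul_of_nonneg_left (hy hyΩ) hlam
      have h6 : lam * Metric.infDist y Ωᶜ / ε ≤ lam * (Metric.infDist x Ωᶜ - ε * δ) / ε := by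
        gcongr
      have h7 : lam * (Metric.infDist x Ωᶜ - ε * δ) / ε
          = lam * Metric.infDist x Ωᶜ / ε - lam * δ := by field_simp
      linarith
    rw [h2, h3]
    linarith
  · have h3 : layer Ω ε lam Q y = 1 - Q := by simp [layer, hyΩ]
    have h4 : Real.exp (-(lam * Metric.infDist x Ωᶜ / ε)) ≤ 1 := by
      rw [Real.exp_le_one_iff, neg_nonpos]
      exact div_nonneg (mul_nonneg hlam Metric.infDist_nonneg) hε.le
    have hQ0 : 0 ≤ Q := by rw [hQ]; positivity
    rw [h2, h3]
    nlinarith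

end Layer

namespace LimitSetting

variable {n : ℕ} {α T ε₀ R r M l₁ l₂ K m₀ : ℝ} {Ω : Set (Eucl n)} {J : Eucl n → ℝ}
  {Φ : Eucl n → ℝ → ℝ} {μ : Eucl n → ℝ} {v h : Eucl n → ℝ → ℝ}

theorem aestronglyMeasurable_add_layer (H : LimitSetting α T ε₀ R r M l₁ l₂ K m₀ Ω J Φ μ v h)
    {ε : ℝ} (lam Q c c' : ℝ) {w : Eucl n → ℝ} (h1 : ContinuousOn w Ω)
    (h2 : ContinuousOn w (seenRegion Ω J ε \ Ω)) :
    AEStronglyMeasurable (fun y => w y + (c' + c * (layer Ω ε lam Q y + Q)))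
      (volume.restrict (seenRegion Ω J ε)) := by
  refine H.aestronglyMeasurable_of_continuousOn (h1.add ?_) (h2.add ?_)
  · have : ContinuousOn (layer Ω ε lam Q) Ω := by
      have hc : Continuous fun y => 1 - Real.exp (-(lam * Metric.infDist y Ωᶜ / ε)) := by
        have := Metric.continuous_infDist_pt Ωᶜ
        fun_prop
      exact hc.continuousOn.congr fun y hy => by simp [layer, hy]
    fun_prop
  · have : ContinuousOn (layer Ω ε lam Q) (seenRegion Ω J ε \ Ω) :=
      (continuousOn_const (c := 1 - Q)).congr fun y hy => by simp [layer, hy.2]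
    fun_prop

/-- Adding a multiple of the layer function decreases the nonlocal operator by an amount that is
exponentially small in the scaled distance to the boundary. -/
theorem exists_layer (H : LimitSetting α T ε₀ R r M l₁ l₂ K m₀ Ω J Φ μ v h) :
    ∃ lam ≥ 0, ∃ Q ≥ 1, ∃ ε₁ > 0, ∀ ε, 0 < ε → ε < ε₁ → ∀ x ∈ Ω,
      FluxBounds (2 / secondMoment J) α l₁ l₂ K m₀ (Φ x) (μ x) →
      ∀ (w : Eucl n → ℝ) (B c c' : ℝ), 0 ≤ c → ContinuousOn w Ω →
      ContinuousOn w (seenRegion Ω J ε \ Ω) → (∀ y ∈ seenRegion Ω J ε, |w y| ≤ B) →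
      jumpOp (seenRegion Ω J ε) (diffusiveKernel J ε) Φ
          (fun y => w y + (c' + c * (layer Ω ε lam Q y + Q))) x
        ≤ jumpOp (seenRegion Ω J ε) (diffusiveKernel J ε) Φ w x
          - (ε ^ 2)⁻¹ * (c * Real.exp (-(lam * Metric.infDist x Ωᶜ / ε))) := by
  classical
  have hl₁ := H.l₁_pos
  have hl₂ := H.l₂_nonneg
  have hr := H.radius_pos
  have hR := H.range_pos
  obtain ⟨θ, hθ, p, hp, hmass⟩ := H.kernel.exists_halfspace_mass H.range_pos H.range
  -- Jumps into the good half-space have mass at least p and lower the flux by l₁(Q - 1) units each;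
  -- all jumps together can raise it by at most l₂ units. With this Q the net effect is at most -1
  -- unit.
  set Q := 1 + (l₂ + 1) / (l₁ * p) with hQ
  have hQ1 : 1 ≤ Q := by
    have : 0 ≤ (l₂ + 1) / (l₁ * p) := by positivity
    linarith
  have hQ0 : 0 < Q := by linarith
  set lam := Real.log Q / (θ / 2) with hlam
  have hlam0 : 0 ≤ lam := div_nonneg (Real.log_nonneg hQ1) (by positivity)
  have hQexp : Q = Real.exp (lam * (θ / 2)) := by
    rw [hlam, div_mul_cancel₀ _ (by positivity), Real.exp_log hQ0]
  -- For ε below this threshold the curvature error in the distance is at most εθ/2, so good jumps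
  -- approach the boundary by at least εθ/2, the amount built into `lam`.
  refine ⟨lam, hlam0, Q, hQ1, θ * r / R ^ 2, by positivity, ?_⟩
  intro ε hε hε1 x hx hΦ w B c c' hc hw1 hw2 hwB
  have hΦc := hΦ.continuous hl₁.le
  obtain ⟨f, hf, hdir⟩ := H.exteriorBalls.exists_direction hr H.isOpen H.isBounded hx
  obtain ⟨hmi, hmp⟩ := hmass f hf
  set E := Real.exp (-(lam * Metric.infDist x Ωᶜ / ε)) with hE
  have hE0 : 0 < E := Real.exp_pos _
  set g : Eucl n → ℝ := fun z => if θ ≤ inner ℝ f z then 1 else 0 with hg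
  have hbase : Integrable fun z => J z * Φ x (w (x + ε • z) - w x) :=
    integrable_jump H.kernel hε (H.measurableSet_seenRegion ε) hx hΦc hl₂
      (hΦ.abs_apply_le hl₁.le) (H.aestronglyMeasurable_of_continuousOn hw1 hw2) hwB
  have hεθ : ε * R ^ 2 / (2 * r) ≤ θ / 2 := by
    rw [lt_div_iff₀ (by positivity)] at hε1
    rw [div_le_iff₀ (by positivity)]
    linarith
  have hpt : ∀ z, J z ≠ 0 →
      Φ x ((w (x + ε • z) + (c' + c * (layer Ω ε lam Q (x + ε • z) + Q)))
        - (w x + (c' + c * (layer Ω ε lam Q x + Q))))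
      ≤ Φ x (w (x + ε • z) - w x) + (c * E * l₂ - c * E * (l₁ * (Q - 1)) * g z) := by
    intro z hz
    have hzR : ‖z‖ < R := by
      by_contra hcon
      exact hz (H.range z (not_lt.1 hcon))
    set s := w (x + ε • z) - w x
    set d := layer Ω ε lam Q (x + ε • z) - layer Ω ε lam Q x with hd
    have e : (w (x + ε • z) + (c' + c * (layer Ω ε lam Q (x + ε • z) + Q)))
        - (w x + (c' + c * (layer Ω ε lam Q x + Q))) = s + c * d := by
      simp only [s, hd]; ring
    rw [e]
    have hcE : 0 ≤ c * E := mul_nonneg hc hE0.le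
    -- Good jumps go towards the boundary and use the lower slope bound; all others use the
    -- worst-case increase of the layer and the upper slope bound.
    rcases le_or_gt θ (inner ℝ f z) with h1 | h1
    · have hgz : g z = 1 := by simp [hg, h1]
      have hd2 : d ≤ -(E * (Q - 1)) := by
        refine layer_sub_le_of_infDist_le hlam0 hε hQexp hx fun hy => ?_
        have h2 := hdir (ε • z) hy
        rw [inner_smul_right, norm_smul, Real.norm_of_nonneg hε.le] at h2
        have h3 : (ε * ‖z‖) ^ 2 / (2 * r) ≤ ε * (ε * R ^ 2 / (2 * r)) := by
          rw [mul_pow, sq ε, mul_assoc ε ε, mul_div_assoc ε]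
          gcongr
        have h4 : ε * (ε * R ^ 2 / (2 * r)) ≤ ε * (θ / 2) := by gcongr
        have h5 : ε * θ ≤ ε * inner ℝ f z := by gcongr
        linarith
      have h6 : Φ x (s + c * d) ≤ Φ x (s - c * E * (Q - 1)) := by
        refine hΦ.monotone hl₁.le ?_
        have := mul_le_mul_of_nonneg_left hd2 hc
        linarith
      have h7 := hΦ.lower (s - c * E * (Q - 1)) s
        (by have := mul_nonneg hcE (sub_nonneg.2 hQ1); linarith)
      rw [sub_sub_cancel] at h7
      have h8 : 0 ≤ c * E * l₂ := by positivity
      rw [hgz]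
      linarith
    · have hgz : g z = 0 := by simp [hg, h1]
      have hd2 : d ≤ E := layer_sub_le hQ0.le hx _
      have h6 : Φ x (s + c * d) ≤ Φ x (s + c * E) := by
        refine hΦ.monotone hl₁.le ?_
        have := mul_le_mul_of_nonneg_left hd2 hc
        linarith
      have h7 := hΦ.upper s (s + c * E) (by linarith)
      rw [hgz]
      rw [add_sub_cancel_left] at h7
      linarith
  have hi2 : Integrable fun z => J z * (c * E * l₂) := H.kernel.integrable.mul_const _
  have hi3 : Integrable fun z => (c * E * (l₁ * (Q - 1))) * (J z * g z) := hmi.const_mul _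
  have hsplit : ∀ z, J z * (Φ x (w (x + ε • z) - w x)
      + (c * E * l₂ - c * E * (l₁ * (Q - 1)) * g z))
      = J z * Φ x (w (x + ε • z) - w x) + (J z * (c * E * l₂)
        - (c * E * (l₁ * (Q - 1))) * (J z * g z)) := fun z => by ring
  have hi23 : Integrable fun z => J z * (c * E * l₂)
      - (c * E * (l₁ * (Q - 1))) * (J z * g z) := hi2.sub hi3
  have hmain := jumpOp_le H.kernel hε (H.measurableSet_seenRegion ε) hx hΦc hl₂
    (hΦ.abs_apply_le hl₁.le) (B := B + (|c'| + c * (1 + Q)))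
    (H.aestronglyMeasurable_add_layer lam Q c c' hw1 hw2) (fun y hy => by
      refine (abs_add_le _ _).trans (add_le_add (hwB y hy) ((abs_add_le _ _).trans
        (add_le_add le_rfl ?_)))
      rw [abs_mul, abs_of_nonneg hc]
      refine mul_le_mul_of_nonneg_left (abs_le.2 ⟨?_, ?_⟩) hc
      · linarith [layer_add_pos (Ω := Ω) hlam0 hε.le hQ1 y]
      · linarith [layer_le_one (Ω := Ω) (ε := ε) (lam := lam) hQ0.le y])
    (g := fun z => Φ x (w (x + ε • z) - w x) + (c * E * l₂ - c * E * (l₁ * (Q - 1)) * g z))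
    (by simp only [hsplit]; exact hbase.add hi23) hpt
  refine hmain.trans ?_
  rw [jumpOp_seenRegion H.kernel hε hx, ← mul_sub]
  refine mul_le_mul_of_nonneg_left ?_ (by positivity)
  simp only [hsplit]
  rw [integral_add hbase hi23, integral_sub hi2 hi3, integral_mul_const, integral_const_mul,
    H.kernel.integral_eq_one]
  have hcE : 0 ≤ c * E := mul_nonneg hc hE0.le
  have hQp : l₁ * (Q - 1) * p = l₂ + 1 := by rw [hQ]; field_simp; ring
  have hfin : c * E * (l₂ + 1) ≤ c * E * (l₁ * (Q - 1)) * ∫ z, J z * g z := by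
    rw [← hQp, mul_assoc (c * E)]
    refine mul_le_mul_of_nonneg_left (mul_le_mul_of_nonneg_left hmp ?_) hcE
    exact mul_nonneg hl₁.le (sub_nonneg.2 hQ1)
  linarith

end LimitSetting

/-! ### The rate of convergence -/

namespace LimitSetting

variable {n : ℕ} {α T ε₀ R r M l₁ l₂ K m₀ : ℝ} {Ω : Set (Eucl n)} {J : Eucl n → ℝ}
  {Φ : Eucl n → ℝ → ℝ} {μ : Eucl n → ℝ} {v h : Eucl n → ℝ → ℝ}

theorem exists_consistency (H : LimitSetting α T ε₀ R r M l₁ l₂ K m₀ Ω J Φ μ v h) {L : ℝ}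
    (hL : 0 ≤ L) :
    ∃ C ≥ 0, ∀ ε ∈ Ioc 0 ε₀, ε * R ≤ 1 → 3 * L * (ε * R) ≤ 1 → ∀ x ∈ Ω,
      FluxBounds (2 / secondMoment J) α l₁ l₂ K m₀ (Φ x) (μ x) → ∀ t ∈ Ioo 0 T, ∀ s,
      ε * R ≤ s → s ≤ Metric.infDist x Ωᶜ → SolvesAt α s L v μ x t →
      ∃ v', HasDerivAt (v x) v' t ∧
        jumpOp (seenRegion Ω J ε) (diffusiveKernel J ε) Φ (fun y => glue Ω v h y t) x
          ≤ v' + C * ε ^ α := by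
  have hm0 := H.m₀_nonneg
  have hc := H.kernel.secondMoment_pos
  have hK := H.K_nonneg
  have hR := H.range_pos
  refine ⟨(K * (3 * L) ^ (2 + α) + 2 / secondMoment J * (L + 4 * m₀ * L ^ 2)) * R ^ (2 + α),
    by positivity, ?_⟩
  rintro ε hε hεR hεL x hx hΦ t ht s hεs hs ⟨a, B, v', hv', hT, heq⟩
  refine ⟨v', hv', ?_⟩
  -- The ball of radius s stays in Ω, so the exterior datum is never seen by the expansion.
  have hT' : HasTaylorBound α s L (fun y => glue Ω v h y t) x a B := by
    refine ⟨hT.norm_le, hT.norm_hess_le, fun z hz => ?_⟩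
    have hxz : x + z ∈ Ω := by
      refine Metric.ball_infDist_compl_subset (s := Ω) (x := x) ?_
      rw [Metric.mem_ball, dist_eq_norm, add_sub_cancel_left]
      linarith
    have := hT.remainder z hz
    simpa only [glue, hx, hxz, if_true] using this
  have hmeas := aestronglyMeasurable_jump H.kernel hε.1 (H.measurableSet_seenRegion ε) hx
    (hΦ.continuous H.l₁_pos.le) (H.aestronglyMeasurable_of_continuousOn
      (H.continuousOn_glue (Ioo_subset_Icc_self ht)) (H.continuousOn_glue_compl hε ht))
  have := abs_jump_sub_le H.exponent H.kernel hR H.range hK hL hΦ hT' hε.1 hεR hεL hεs hmeas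
  rw [← heq] at this
  rw [jumpOp_seenRegion H.kernel hε.1 hx]
  linarith [(abs_le.1 this).2]

theorem abs_deriv_le {L s : ℝ} {x : Eucl n} {t v' : ℝ} (hm₀ : |μ x| ≤ m₀)
    (hsol : SolvesAt α s L v μ x t) (hv' : HasDerivAt (v x) v' t) :
    |v'| ≤ (n + 1) * L + m₀ * L ^ 2 := by
  obtain ⟨a, B, v'', hv'', hT, heq⟩ := hsol
  rw [hv'.unique hv'', heq]
  refine (abs_add_le _ _).trans (add_le_add ?_ ?_)
  · refine (Finset.abs_sum_le_sum_abs _ _).trans ?_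
    refine (Finset.sum_le_card_nsmul _ _ L fun i _ => ?_).trans ?_
    · refine (B.le_opNorm₂ _ _).trans ?_
      simpa using hT.norm_hess_le
    · simp
  · rw [abs_mul, abs_of_nonneg (sq_nonneg ‖a‖)]
    have := hT.norm_le
    have h0 := (abs_nonneg (μ x)).trans hm₀
    gcongr

/-- Ω need not be convex, so the gradient bound on v is used only along segments to nearest boundary
points; the two boundary points are compared through the Lipschitz datum. In units of εR the
interior legs cost L and 2L, the boundary leg 4M. -/
theorem abs_glue_sub_le (H : LimitSetting α T ε₀ R r M l₁ l₂ K m₀ Ω J Φ μ v h) {L : ℝ} (hL : 0 ≤ L)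
    (hlip : ∀ x ∈ Ω, ∀ p ∈ frontier Ω, ‖x - p‖ = Metric.infDist x Ωᶜ → ∀ t ∈ Ioo 0 T,
      |v x t - v p t| ≤ L * ‖x - p‖)
    {ε : ℝ} (hε : ε ∈ Ioc 0 ε₀) {x : Eucl n} (hx : x ∈ Ω) (hxd : Metric.infDist x Ωᶜ < ε * R)
    {t : ℝ} (ht : t ∈ Ioo 0 T) {z : Eucl n} (hz : J z ≠ 0) :
    |glue Ω v h (x + ε • z) t - glue Ω v h x t| ≤ (3 * L + 4 * M) * R * ε := by
  have hM := H.lip_nonneg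
  have hR := H.range_pos
  have hzR : ‖z‖ < R := by
    by_contra hcon
    exact hz (H.range z (not_lt.1 hcon))
  set y := x + ε • z with hy
  have hyx : ‖y - x‖ ≤ ε * R := by
    rw [hy, add_sub_cancel_left, norm_smul, Real.norm_of_nonneg hε.1.le]
    have := hε.1
    gcongr
  obtain ⟨p, hp, hpx⟩ := exists_nearest_frontier H.isOpen H.isBounded hx
  have hvp := hlip x hx p hp hpx t ht
  have hxp : ‖x - p‖ ≤ ε * R := by rw [hpx]; exact hxd.le
  have h1 : |v x t - v p t| ≤ L * (ε * R) := hvp.trans (by gcongr)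
  have hxg : glue Ω v h x t = v x t := by simp [glue, hx]
  have hεR : 0 ≤ ε * R := mul_nonneg hε.1.le hR.le
  rw [hxg]
  by_cases hyΩ : y ∈ Ω
  · have hyg : glue Ω v h y t = v y t := by simp [glue, hyΩ]
    rw [hyg]
    obtain ⟨q, hq, hqy⟩ := exists_nearest_frontier H.isOpen H.isBounded hyΩ
    have hdy : Metric.infDist y Ωᶜ ≤ 2 * (ε * R) := by
      have := Metric.infDist_le_infDist_add_dist (s := Ωᶜ) (x := y) (y := x)
      rw [dist_eq_norm] at this
      linarith
    have h2 : |v y t - v q t| ≤ L * (2 * (ε * R)) :=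
      (hlip y hyΩ q hq hqy t ht).trans (by rw [hqy]; gcongr)
    have hqp : ‖q - p‖ ≤ 4 * (ε * R) := by
      have e : q - p = -(y - q) + (y - x) + (x - p) := by abel
      rw [e]
      refine (norm_add₃_le).trans ?_
      rw [norm_neg, hqy]
      linarith
    have h3 : |v q t - v p t| ≤ M * (4 * (ε * R)) :=
      (H.frontier_lip q hq p hp t ht).trans (by gcongr)
    have e : v y t - v x t = (v y t - v q t) + (v q t - v p t) + -(v x t - v p t) := by ring
    rw [e]
    refine (abs_add_three _ _ _).trans ?_
    rw [abs_neg]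
    nlinarith
  · have hyg : glue Ω v h y t = h y t := by simp [glue, hyΩ]
    rw [hyg]
    have hyc := (H.collar hε ⟨add_mem_seenRegion hε.1 hx hz, hyΩ⟩).1
    have hyp : ‖y - p‖ ≤ 2 * (ε * R) := by
      have e : y - p = (y - x) + (x - p) := by abel
      rw [e]
      exact (norm_add_le _ _).trans (by linarith)
    have h2 : |h y t - v p t| ≤ M * (2 * (ε * R)) :=
      (H.exterior y hyc p hp t ht).trans (by gcongr)
    have e : h y t - v x t = (h y t - v p t) + -(v x t - v p t) := by ring
    rw [e]
    refine (abs_add_le _ _).trans ?_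
    rw [abs_neg]
    nlinarith [mul_nonneg hL hεR, mul_nonneg hM hεR]

/-- The barrier is v (or h) plus C₁ε^α t, which pays for the consistency error, plus a layer of
height O(ε), which pays for the boundary strip. As ε ≤ ε^α, the layer does not spoil the rate. -/
theorem exists_rate (H : LimitSetting α T ε₀ R r M l₁ l₂ K m₀ Ω J Φ μ v h) (hε₀ : 0 < ε₀)
    {L : ℝ} (hL : 0 ≤ L)
    (hsol : ∀ x ∈ Ω, ∀ t ∈ Ioo 0 T, SolvesAt α (Metric.infDist x Ωᶜ) L v μ x t)
    (hlip : ∀ x ∈ Ω, ∀ p ∈ frontier Ω, ‖x - p‖ = Metric.infDist x Ωᶜ → ∀ t ∈ Ioo 0 T,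
      |v x t - v p t| ≤ L * ‖x - p‖) :
    ∃ C ≥ 0, ∃ ε₁ > 0, ∀ ε, 0 < ε → ε < ε₁ → ∀ u,
      IsMildSolution Ω (seenRegion Ω J ε) T (diffusiveKernel J ε) Φ h (fun x => v x 0) u →
      ∀ᵐ x ∂volume.restrict Ω, ∀ t ∈ Icc 0 T, u x t ≤ v x t + C * ε ^ α := by
  obtain ⟨lam, hlam, Q, hQ, ε₂, hε₂, hlayer⟩ := H.exists_layer
  obtain ⟨C₁, hC₁, hcons⟩ := H.exists_consistency hL
  obtain ⟨B, hB0, hB⟩ := H.exists_glue_bound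
  have hR := H.range_pos
  have hM := H.lip_nonneg
  have hl₂ := H.l₂_nonneg
  have hm₀ := H.m₀_nonneg
  have hT := H.time_pos
  set C₂ := (3 * L + 4 * M) * R with hC₂
  set Lt := (n + 1) * L + m₀ * L ^ 2 with hLt
  -- Within distance εR of the boundary the layer's gain carries a factor at least exp(-lam·R); this
  -- amplitude makes it exceed both the O(1/ε) size of the operator and the bound on the time
  -- derivative of v.
  set κ := (l₂ * C₂ + Lt) * Real.exp (lam * R) with hκ
  have hC₂0 : 0 ≤ C₂ := by positivity
  have hLt0 : 0 ≤ Lt := by positivity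
  have hκ0 : 0 ≤ κ := by positivity
  refine ⟨C₁ * T + κ * (1 + Q), by positivity,
    min (min ε₀ ε₂) (min 1 (1 / ((3 * L + 1) * R))), by positivity, ?_⟩
  intro ε hε hεlt u hu
  simp only [lt_min_iff] at hεlt
  obtain ⟨⟨hεε₀, hεε₂⟩, hε1, hεR'⟩ := hεlt
  have hε' : ε ∈ Ioc 0 ε₀ := ⟨hε, hεε₀.le⟩
  rw [lt_div_iff₀ (by positivity)] at hεR'
  have hεRpos : 0 < ε * R := by positivity
  have hεR : ε * R ≤ 1 := by nlinarith
  have hεL : 3 * L * (ε * R) ≤ 1 := by nlinarith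
  have hεα : 0 < ε ^ α := Real.rpow_pos_of_pos hε α
  set c := κ * ε with hc
  have hc0 : 0 ≤ c := by positivity
  set w : Eucl n → ℝ → ℝ := fun y t =>
    glue Ω v h y t + (C₁ * ε ^ α * t + c * (layer Ω ε lam Q y + Q)) with hw
  have hlow : ∀ y, 1 ≤ layer Ω ε lam Q y + Q := layer_add_pos hlam hε.le hQ
  have hupp : ∀ y, layer Ω ε lam Q y + Q ≤ 1 + Q := fun y => by
    have := layer_le_one (Ω := Ω) (ε := ε) (lam := lam) (by linarith : 0 ≤ Q) y
    linarith
  have hcomp := H.comparison hε hu H.isOpen.measurableSet Subset.rfl le_rfl hT le_rfl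
    (w := w) (B := B + (C₁ * ε ^ α * T + c * (1 + Q))) ?_ ?_ ?_ ?_ ?_
  · filter_upwards [hcomp, ae_restrict_mem H.isOpen.measurableSet] with x hx hxΩ t ht
    refine (hx t ht).trans ?_
    have h1 : ε ≤ ε ^ α := by
      have := Real.rpow_le_rpow_of_exponent_ge hε hε1.le H.exponent.2.le
      rwa [Real.rpow_one] at this
    have h2 : C₁ * ε ^ α * t ≤ C₁ * ε ^ α * T := by have := ht.2; gcongr
    have h3 : c * (layer Ω ε lam Q x + Q) ≤ κ * ε ^ α * (1 + Q) := by
      rw [hc]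
      refine mul_le_mul (by gcongr) (hupp x) (by linarith [hlow x]) (by positivity)
    have hg : glue Ω v h x t = v x t := by simp [glue, hxΩ]
    simp only [hw, hg]
    linarith
  · intro t ht
    exact H.aestronglyMeasurable_add_layer lam Q c (C₁ * ε ^ α * t)
      (H.continuousOn_glue (Ioo_subset_Icc_self ht)) (H.continuousOn_glue_compl hε' ht)
  · intro t ht y hy
    have h1 := hB ε hε' hεR t ht y hy
    have h2 : 0 ≤ C₁ * ε ^ α * t := by have := ht.1; positivity
    have h3 : C₁ * ε ^ α * t ≤ C₁ * ε ^ α * T := by have := ht.2; gcongr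
    have h4 : c * (layer Ω ε lam Q y + Q) ≤ c * (1 + Q) := by
      have := hupp y; gcongr
    have h5 : 0 ≤ c * (layer Ω ε lam Q y + Q) := mul_nonneg hc0 (by linarith [hlow y])
    refine (abs_add_le _ _).trans (add_le_add h1 ?_)
    rw [abs_of_nonneg (by linarith)]
    linarith
  · filter_upwards [H.flux, ae_restrict_mem H.isOpen.measurableSet] with x hΦ hx
    have hgx : ∀ t, glue Ω v h x t = v x t := fun t => by simp [glue, hx]
    constructor
    · have h1 := H.continuousOn_time (subset_closure hx)
      simp only [hw, hgx]
      fun_prop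
    · intro t ht
      have hsolx := hsol x hx t ht
      obtain ⟨v', hv', -⟩ : ∃ v', HasDerivAt (v x) v' t ∧ True := by
        obtain ⟨a, B, v', hv', -⟩ := hsolx
        exact ⟨v', hv', trivial⟩
      refine ⟨v' + C₁ * ε ^ α, ?_, ?_⟩
      · simp only [hw, hgx]
        exact (hv'.add (((hasDerivAt_id' t).const_mul (C₁ * ε ^ α)).add_const _)).congr_deriv
          (by ring)
      · have hlay := hlayer ε hε hεε₂ x hx hΦ (fun y => glue Ω v h y t) B c (C₁ * ε ^ α * t) hc0
          (H.continuousOn_glue (Ioo_subset_Icc_self ht)) (H.continuousOn_glue_compl hε' ht)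
          (hB ε hε' hεR t ht)
        refine hlay.trans ?_
        set E := Real.exp (-(lam * Metric.infDist x Ωᶜ / ε)) with hE
        have hE0 : 0 < E := Real.exp_pos _
        -- Away from the strip consistency applies and the layer only helps; inside it the Lipschitz
        -- estimate is crude and the layer compensates.
        rcases le_or_gt (ε * R) (Metric.infDist x Ωᶜ) with hd | hd
        · obtain ⟨v'', hv'', hle⟩ := hcons ε hε' hεR hεL x hx hΦ t ht _ hd le_rfl hsolx
          rw [hv'.unique hv'']
          have : 0 ≤ (ε ^ 2)⁻¹ * (c * E) := by positivity
          linarith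
        · have h1 : jumpOp (seenRegion Ω J ε) (diffusiveKernel J ε) Φ
              (fun y => glue Ω v h y t) x ≤ (ε ^ 2)⁻¹ * (l₂ * (C₂ * ε)) := by
            have := jumpOp_le H.kernel hε (H.measurableSet_seenRegion ε) hx
              (hΦ.continuous H.l₁_pos.le) hl₂ (hΦ.abs_apply_le H.l₁_pos.le)
              (H.aestronglyMeasurable_of_continuousOn
                (H.continuousOn_glue (Ioo_subset_Icc_self ht)) (H.continuousOn_glue_compl hε' ht))
              (hB ε hε' hεR t ht) (g := fun _ => l₂ * (C₂ * ε))
              (H.kernel.integrable.mul_const _) (fun z hz => by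
                refine (le_abs_self _).trans ((hΦ.abs_apply_le H.l₁_pos.le _).trans ?_)
                have := H.abs_glue_sub_le hL hlip hε' hx hd ht hz
                gcongr)
            rwa [integral_mul_const, H.kernel.integral_eq_one, one_mul] at this
          have h2 : Real.exp (-(lam * R)) ≤ E := by
            rw [hE, Real.exp_le_exp, neg_le_neg_iff, div_le_iff₀ hε]
            have := mul_le_mul_of_nonneg_left hd.le hlam
            linarith
          have h3 : (l₂ * C₂ + Lt) * ε ≤ c * E := by
            calc (l₂ * C₂ + Lt) * ε = c * Real.exp (-(lam * R)) := by
                  rw [hc, hκ]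
                  have : Real.exp (lam * R) * Real.exp (-(lam * R)) = 1 := by
                    rw [← Real.exp_add, add_neg_cancel, Real.exp_zero]
                  linear_combination -(l₂ * C₂ + Lt) * ε * this
              _ ≤ c * E := by gcongr
          have h4 : (ε ^ 2)⁻¹ * (l₂ * (C₂ * ε)) - (ε ^ 2)⁻¹ * (c * E) ≤ -Lt := by
            rw [← mul_sub]
            calc (ε ^ 2)⁻¹ * (l₂ * (C₂ * ε) - c * E) ≤ (ε ^ 2)⁻¹ * (-(Lt * ε)) := by
                  gcongr
                  linarith
              _ = -(Lt * ε⁻¹) := by field_simp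
              _ ≤ -(Lt * 1) := by
                  have := (one_le_inv₀ hε).2 hε1.le
                  gcongr
              _ = -Lt := by ring
          have h5 := (abs_le.1 (abs_deriv_le hΦ.abs_le hsolx hv')).1
          have h6 : 0 ≤ C₁ * ε ^ α := by positivity
          linarith
  · intro t ht
    filter_upwards [hu.exterior t ht, ae_restrict_mem
      ((H.measurableSet_seenRegion ε).diff H.isOpen.measurableSet)] with y hy hyS
    have hg : glue Ω v h y t = h y t := by simp [glue, hyS.2]
    have h2 : 0 ≤ C₁ * ε ^ α * t := by have := ht.1; positivity
    have h5 : 0 ≤ c * (layer Ω ε lam Q y + Q) := mul_nonneg hc0 (by linarith [hlow y])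
    simp only [hw, hg, hy]
    linarith
  · filter_upwards [hu.equation, ae_restrict_mem H.isOpen.measurableSet] with x hx hxΩ
    have h1 := hx.2 0 (left_mem_Icc.2 hT.le)
    rw [intervalIntegral.integral_same, add_zero] at h1
    have hg : glue Ω v h x 0 = v x 0 := by simp [glue, hxΩ]
    have h5 : 0 ≤ c * (layer Ω ε lam Q x + Q) := mul_nonneg hc0 (by linarith [hlow x])
    simp only [hw, hg, h1]
    linarith

end LimitSetting

/-! ### Logarithmic barriers -/

theorem exp_quadratic_lower {t : ℝ} (ht : |t| ≤ 1) :
    1 + t + t ^ 2 / 2 - |t| ^ 3 ≤ Real.exp t := by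
  have h := Real.exp_bound ht (n := 3) (by norm_num)
  have e : ∑ m ∈ Finset.range 3, t ^ m / (m.factorial : ℝ) = 1 + t + t ^ 2 / 2 := by
    simp [Finset.sum_range_succ, Nat.factorial]
  rw [e] at h
  have h1 := (abs_le.1 h).1
  have h2 : |t| ^ 3 * (((3 : ℕ).succ : ℝ) / (((3 : ℕ).factorial : ℝ) * (3 : ℕ))) ≤ |t| ^ 3 := by
    refine mul_le_of_le_one_right (by positivity) ?_
    norm_num [Nat.factorial]
  linarith

/-- The exponential has the same first-order term and a quadratic coefficient that grows with m. For
small s it therefore dominates the quadratic part of Φ together with its remainder, since |s|^(2+α)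
≤ s². -/
theorem exists_flux_le_exp {c₀ α K m₀ : ℝ} (hc₀ : 0 < c₀) (hα : 0 < α) (hK : 0 ≤ K)
    (hm₀ : 0 ≤ m₀) : ∃ m > 0, ∃ s₀ > 0, ∀ (l₁ l₂ : ℝ) (Φ : ℝ → ℝ) (μ : ℝ),
      FluxBounds c₀ α l₁ l₂ K m₀ Φ μ → ∀ s, |s| ≤ s₀ → Φ s ≤ c₀ * ((Real.exp (m * s) - 1) / m) := by
  -- For |ms| ≤ 1/4 the cubic error eats half of the quadratic term ms²/2; the remaining quarter of
  -- m must beat m₀/2 + K/c₀.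
  set m := 4 * (m₀ / 2 + K / c₀) + 4 with hm
  have hm4 : 4 ≤ m := by
    have : 0 ≤ 4 * (m₀ / 2 + K / c₀) := by positivity
    linarith
  have hmpos : 0 < m := by linarith
  refine ⟨m, hmpos, 1 / (4 * m), by positivity, fun l₁ l₂ Φ μ hΦ s hs => ?_⟩
  have hms : |m * s| ≤ 1 / 4 := by
    rw [abs_mul, abs_of_pos hmpos]
    calc m * |s| ≤ m * (1 / (4 * m)) := by gcongr
      _ = 1 / 4 := by field_simp
  have hs1 : |s| ≤ 1 := hs.trans (by
    rw [div_le_one (by positivity)]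
    linarith)
  have h1 := (abs_le.1 (hΦ.expansion s hs1)).2
  have h2 : |s| ^ (2 + α) ≤ s ^ 2 := by
    rw [← sq_abs s, ← Real.rpow_two]
    exact Real.rpow_le_rpow_of_exponent_ge' (abs_nonneg s) hs1 (by norm_num) (by linarith)
  have h3 : μ / 2 * s ^ 2 ≤ m₀ / 2 * s ^ 2 := by
    have := (abs_le.1 hΦ.abs_le).2
    gcongr
  have h4 := exp_quadratic_lower (hms.trans (by norm_num))
  have h5 : |m * s| ^ 3 ≤ (m * s) ^ 2 / 4 := by
    have : |m * s| ^ 3 = |m * s| * (m * s) ^ 2 := by rw [← sq_abs (m * s)]; ring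
    rw [this]
    nlinarith [sq_nonneg (m * s)]
  have h6 : s + m * s ^ 2 / 4 ≤ (Real.exp (m * s) - 1) / m := by
    rw [le_div_iff₀ hmpos]
    nlinarith
  have h7 : c₀ * (s + m * s ^ 2 / 4) ≤ c₀ * ((Real.exp (m * s) - 1) / m) := by gcongr
  have h8 : K * |s| ^ (2 + α) ≤ K * s ^ 2 := by gcongr
  have h9 : c₀ * (m * s ^ 2 / 4) = (c₀ * m₀ / 2 + K + c₀) * s ^ 2 := by
    rw [hm]
    field_simp
  have h10 : c₀ * (μ / 2 * s ^ 2) ≤ c₀ * (m₀ / 2 * s ^ 2) := by gcongr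
  have h11 : 0 ≤ c₀ * s ^ 2 := by positivity
  linarith

theorem abs_log_sub_log_le {a b : ℝ} (ha : 1 / 2 ≤ a) (hb : 1 / 2 ≤ b) :
    |Real.log a - Real.log b| ≤ 2 * |a - b| := by
  have key : ∀ a b : ℝ, 1 / 2 ≤ a → 1 / 2 ≤ b → Real.log a - Real.log b ≤ 2 * |a - b| := by
    intro a b ha hb
    have ha0 : 0 < a := by linarith
    have hb0 : 0 < b := by linarith
    rw [← Real.log_div ha0.ne' hb0.ne']
    refine (Real.log_le_sub_one_of_pos (by positivity)).trans ?_
    have e : a / b - 1 = (a - b) / b := by field_simp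
    rw [e]
    refine (div_le_div_of_nonneg_right (le_abs_self _) hb0.le).trans ?_
    rw [div_le_iff₀ hb0]
    nlinarith [abs_nonneg (a - b)]
  rw [abs_le]
  have h1 := key a b ha hb
  have h2 := key b a hb ha
  rw [abs_sub_comm] at h2
  constructor <;> linarith

namespace LimitSetting

variable {n : ℕ} {α T ε₀ R r M l₁ l₂ K m₀ : ℝ} {Ω : Set (Eucl n)} {J : Eucl n → ℝ}
  {Φ : Eucl n → ℝ → ℝ} {μ : Eucl n → ℝ} {v h : Eucl n → ℝ → ℝ}

theorem exists_near_of_mem_seenRegion (H : LimitSetting α T ε₀ R r M l₁ l₂ K m₀ Ω J Φ μ v h)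
    {ε : ℝ} (hε : 0 < ε) {y : Eucl n} (hy : y ∈ seenRegion Ω J ε) : ∃ x ∈ Ω, ‖y - x‖ ≤ ε * R := by
  rcases hy with hy | hy
  · exact ⟨y, hy, by rw [sub_self, norm_zero]; exact mul_nonneg hε.le H.range_pos.le⟩
  · exact exists_of_mem_reach hε H.range hy

/-- If `q` is a supersolution of the linear nonlocal heat equation, then `c + m⁻¹ log (1 + A q)` is
a barrier for the nonlinear equation. -/
theorem le_log_barrier (H : LimitSetting α T ε₀ R r M l₁ l₂ K m₀ Ω J Φ μ v h)
    {m s₀ : ℝ} (hm : 0 < m)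
    (hexp : ∀ (l₁ l₂ : ℝ) (Φ : ℝ → ℝ) (μ : ℝ), FluxBounds (2 / secondMoment J) α l₁ l₂ K m₀ Φ μ →
      ∀ s, |s| ≤ s₀ → Φ s ≤ 2 / secondMoment J * ((Real.exp (m * s) - 1) / m))
    {ε : ℝ} (hε : ε ∈ Ioc 0 ε₀) {u₀ : Eucl n → ℝ} {u : Eucl n → ℝ → ℝ}
    (hu : IsMildSolution Ω (seenRegion Ω J ε) T (diffusiveKernel J ε) Φ h u₀ u)
    {a b : ℝ} (ha : 0 ≤ a) (hab : a < b) (hb : b ≤ T)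
    {q : Eucl n → ℝ → ℝ} {q' A Lq Bq c δ : ℝ} (hA : 0 ≤ A)
    (hqc : ∀ t, Continuous fun y => q y t) (hqd : ∀ x t, HasDerivAt (q x) q' t)
    (hq0 : ∀ x ∈ closure Ω, ∀ t ∈ Icc a b, 0 ≤ q x t)
    (hqB : ∀ x ∈ closure Ω, ∀ t ∈ Icc a b, q x t ≤ Bq)
    (hqL : ∀ x ∈ closure Ω, ∀ t ∈ Icc a b, ∀ y, ‖y - x‖ ≤ 1 → |q y t - q x t| ≤ Lq * ‖y - x‖)
    (hqs : ∀ x ∈ Ω, ∀ t ∈ Ioo a b,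
      (ε ^ 2)⁻¹ * (2 / secondMoment J * ∫ z, J z * (q (x + ε • z) t - q x t)) ≤ q')
    (hεR : ε * R ≤ 1) (hLq : 0 ≤ Lq) (h1 : A * Lq * (ε * R) ≤ 1 / 2)
    (h2 : 2 / m * (A * Lq * (ε * R)) ≤ s₀)
    (h3 : M * (ε * R) + 2 / m * (A * Lq * (ε * R)) ≤ δ)
    (hbd : ∀ p ∈ frontier Ω, ∀ t ∈ Ioo a b, v p t + δ ≤ c + 1 / m * Real.log (1 + A * q p t))
    (hin : ∀ᵐ x ∂volume.restrict Ω, u x a ≤ c + 1 / m * Real.log (1 + A * q x a)) :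
    ∀ᵐ x ∂volume.restrict Ω, ∀ t ∈ Icc a b, u x t ≤ c + 1 / m * Real.log (1 + A * q x t) := by
  have hR := H.range_pos
  have hM := H.lip_nonneg
  have hc₀ := H.kernel.secondMoment_pos
  have hAL : 0 ≤ A * Lq := mul_nonneg hA hLq
  have hge : ∀ x ∈ closure Ω, ∀ t ∈ Icc a b, 1 ≤ 1 + A * q x t := fun x hx t ht => by
    have := mul_nonneg hA (hq0 x hx t ht)
    linarith
  -- Outside the closure q may be negative, but within one jump 1 + Aq stays at least 1/2, where the
  -- logarithm is 2-Lipschitz.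
  have hnear : ∀ x ∈ closure Ω, ∀ t ∈ Icc a b, ∀ y, ‖y - x‖ ≤ ε * R →
      1 / 2 ≤ 1 + A * q y t ∧ |1 / m * Real.log (1 + A * q y t) - 1 / m * Real.log (1 + A * q x t)|
        ≤ 2 / m * (A * Lq * (ε * R)) := by
    intro x hx t ht y hy
    have h4 := hqL x hx t ht y (hy.trans hεR)
    have h5 : |A * q y t - A * q x t| ≤ A * Lq * (ε * R) := by
      rw [← mul_sub, abs_mul, abs_of_nonneg hA, mul_assoc]
      exact mul_le_mul_of_nonneg_left (h4.trans (by gcongr)) hA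
    have h6 : 1 / 2 ≤ 1 + A * q y t := by
      have := (abs_le.1 h5).1
      have := hge x hx t ht
      linarith
    refine ⟨h6, ?_⟩
    rw [← mul_sub, abs_mul, abs_of_pos (by positivity)]
    have h7 := abs_log_sub_log_le h6 (by linarith [hge x hx t ht] : 1 / 2 ≤ 1 + A * q x t)
    have e : 1 + A * q y t - (1 + A * q x t) = A * q y t - A * q x t := by ring
    rw [e] at h7
    calc 1 / m * |Real.log (1 + A * q y t) - Real.log (1 + A * q x t)|
        ≤ 1 / m * (2 * (A * Lq * (ε * R))) := by gcongr; linarith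
      _ = _ := by ring
  have hsub : Ioo a b ⊆ Ioo 0 T := Ioo_subset_Ioo ha hb
  set w : Eucl n → ℝ → ℝ := fun y t => c + 1 / m * Real.log (1 + A * q y t) with hw
  have hwm : ∀ t, AEStronglyMeasurable (fun y => w y t) (volume.restrict (seenRegion Ω J ε)) := by
    intro t
    have : Measurable fun y => q y t := (hqc t).measurable
    exact (by fun_prop : Measurable fun y => c + 1 / m * Real.log (1 + A * q y t)).aestronglyMeasurable
  set Bw := |c| + (1 / m * Real.log (1 + A * Bq) + s₀) with hBw
  have hwB : ∀ t ∈ Ioo a b, ∀ y ∈ seenRegion Ω J ε, |w y t| ≤ Bw := by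
    intro t ht y hy
    have ht' := Ioo_subset_Icc_self ht
    obtain ⟨x, hx, hxy⟩ := H.exists_near_of_mem_seenRegion hε.1 hy
    have hxc := subset_closure hx
    have h4 := (hnear x hxc t ht' y hxy).2.trans h2
    have h5 := hge x hxc t ht'
    have h6 : 0 ≤ 1 / m * Real.log (1 + A * q x t) :=
      mul_nonneg (by positivity) (Real.log_nonneg h5)
    have h7 : 1 / m * Real.log (1 + A * q x t) ≤ 1 / m * Real.log (1 + A * Bq) := by
      have := hqB x hxc t ht'
      gcongr
    refine (abs_add_le _ _).trans (add_le_add le_rfl ?_)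
    rw [abs_le] at h4 ⊢
    constructor <;> linarith
  refine H.comparison hε.1 hu H.isOpen.measurableSet Subset.rfl ha hab hb (w := w) (B := Bw)
    (fun t _ => hwm t) hwB ?_ ?_ hin
  · filter_upwards [H.flux, ae_restrict_mem H.isOpen.measurableSet] with x hΦ hx
    have hxc := subset_closure hx
    have hderiv : ∀ t ∈ Icc a b,
        HasDerivAt (w x) (1 / m * (A * q' / (1 + A * q x t))) t := fun t ht =>
      ((((hqd x t).const_mul A).const_add 1).log (by linarith [hge x hxc t ht])).const_mul (1 / m)
        |>.const_add c
    refine ⟨fun t ht => (hderiv t ht).continuousAt.continuousWithinAt, fun t ht => ?_⟩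
    have ht' := Ioo_subset_Icc_self ht
    refine ⟨_, hderiv t ht', ?_⟩
    have hX := hge x hxc t ht'
    set X := 1 + A * q x t with hXdef
    have hX0 : 0 < X := by linarith
    set c₀ := 2 / secondMoment J with hc₀def
    have hc₀0 : 0 < c₀ := by positivity
    have hintg : Integrable fun z => J z * (q (x + ε • z) t - q x t) :=
      H.kernel.integrable_mul (by have := hqc t; fun_prop)
    have hi' : ∀ z, J z * (c₀ * (A / (m * X)) * (q (x + ε • z) t - q x t))
        = c₀ * (A / (m * X)) * (J z * (q (x + ε • z) t - q x t)) := fun z => by ring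
    -- The exponential undoes the logarithm: (e^(m(w(y)-w(x))) - 1)/m equals A(q(y) - q(x))/(mX),
    -- linear in the jump of q, with the same factor A/(mX) that multiplies q' in the time
    -- derivative of w.
    have := jumpOp_le H.kernel hε.1 (H.measurableSet_seenRegion ε) hx
      (hΦ.continuous H.l₁_pos.le) H.l₂_nonneg (hΦ.abs_apply_le H.l₁_pos.le) (hwm t) (hwB t ht)
      (g := fun z => c₀ * (A / (m * X)) * (q (x + ε • z) t - q x t))
      (by simp only [hi']; exact hintg.const_mul _) (fun z hz => by
        have hzR : ‖z‖ < R := by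
          by_contra hcon
          exact hz (H.range z (not_lt.1 hcon))
        have hzn : ‖x + ε • z - x‖ ≤ ε * R := by
          rw [add_sub_cancel_left, norm_smul, Real.norm_of_nonneg hε.1.le]
          have := hε.1
          gcongr
        obtain ⟨h4, h5⟩ := hnear x hxc t ht' _ hzn
        have e1 : w (x + ε • z) t - w x t = 1 / m * Real.log (1 + A * q (x + ε • z) t)
            - 1 / m * Real.log X := by simp only [hw, hXdef]; ring
        rw [e1]
        refine (hexp _ _ _ _ hΦ _ (h5.trans h2)).trans (le_of_eq ?_)
        have e2 : m * (1 / m * Real.log (1 + A * q (x + ε • z) t) - 1 / m * Real.log X)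
            = Real.log (1 + A * q (x + ε • z) t) - Real.log X := by field_simp
        rw [e2, Real.exp_sub, Real.exp_log (by linarith), Real.exp_log hX0]
        field_simp
        rw [hXdef]
        ring)
    refine this.trans ?_
    simp only [hi']
    rw [integral_const_mul]
    have hs := hqs x hx t ht
    calc (ε ^ 2)⁻¹ * (c₀ * (A / (m * X)) * ∫ z, J z * (q (x + ε • z) t - q x t))
        = A / (m * X) * ((ε ^ 2)⁻¹ * (c₀ * ∫ z, J z * (q (x + ε • z) t - q x t))) := by ring
      _ ≤ A / (m * X) * q' := by gcongr
      _ = _ := by field_simp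
  · intro t ht
    have ht' := Ioo_subset_Icc_self ht
    filter_upwards [hu.exterior t (hsub ht), ae_restrict_mem
      ((H.measurableSet_seenRegion ε).diff H.isOpen.measurableSet)] with y hy hyS
    obtain ⟨hyc, p, hp, hpy⟩ := H.collar hε hyS
    have h4 := (abs_le.1 (H.exterior y hyc p hp t (hsub ht))).2
    have h5 : M * ‖y - p‖ ≤ M * (ε * R) := by gcongr
    have h6 := (abs_le.1 (hnear p (frontier_subset_closure hp) t ht' y hpy).2).1
    have h7 := hbd p hp t ht
    rw [hy]
    simp only [hw]
    linarith

end LimitSetting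

/-! ### Barriers at parabolic boundary points -/

namespace LimitSetting

variable {n : ℕ} {α T ε₀ R r M l₁ l₂ K m₀ : ℝ} {Ω : Set (Eucl n)} {J : Eucl n → ℝ}
  {Φ : Eucl n → ℝ → ℝ} {μ : Eucl n → ℝ} {v h : Eucl n → ℝ → ℝ}

theorem exists_modulus (H : LimitSetting α T ε₀ R r M l₁ l₂ K m₀ Ω J Φ μ v h) {δ : ℝ} (hδ : 0 < δ) :
    ∃ ρ > 0, ∀ x ∈ closure Ω, ∀ y ∈ closure Ω, ∀ s ∈ Icc 0 T, ∀ t ∈ Icc 0 T,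
      ‖x - y‖ < ρ → |s - t| < ρ → |v x s - v y t| ≤ δ := by
  have hcpt : IsCompact (closure Ω ×ˢ Icc (0 : ℝ) T) :=
    H.isBounded.isCompact_closure.prod isCompact_Icc
  have hu := hcpt.uniformContinuousOn_of_continuous H.continuousOn
  obtain ⟨ρ, hρ, hd⟩ := Metric.uniformContinuousOn_iff.1 hu δ hδ
  refine ⟨ρ, hρ, fun x hx y hy s hs t ht hxy hst => ?_⟩
  have := hd (x, s) ⟨hx, hs⟩ (y, t) ⟨hy, ht⟩ (by
    rw [Prod.dist_eq, dist_eq_norm, Real.dist_eq]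
    exact max_lt hxy hst)
  rw [Real.dist_eq] at this
  exact this.le

/-- Near (y,t) the modulus of continuity of v suffices. Far from it q ≥ γ, and the coefficient
exp(2mB₀)/γ makes the logarithmic term at least 2B₀, which exceeds any oscillation of v. -/
theorem add_le_barrier {B₀ ρ δ m γ : ℝ}
    (hB₀ : ∀ x ∈ closure Ω, ∀ t ∈ Icc 0 T, |v x t| ≤ B₀)
    (hρ : ∀ x ∈ closure Ω, ∀ y ∈ closure Ω, ∀ s ∈ Icc 0 T, ∀ t ∈ Icc 0 T,
      ‖x - y‖ < ρ → |s - t| < ρ → |v x s - v y t| ≤ δ) (hm : 0 < m) (hγ : 0 < γ) (hδ : 0 ≤ δ)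
    {x y : Eucl n} (hx : x ∈ closure Ω) (hy : y ∈ closure Ω) {s t : ℝ} (hs : s ∈ Icc 0 T)
    (ht : t ∈ Icc 0 T) {q : ℝ} (hq0 : 0 ≤ q) (hq : ρ ≤ ‖x - y‖ ∨ ρ ≤ |s - t| → γ ≤ q) :
    v x s + δ ≤ v y t + 2 * δ + 1 / m * Real.log (1 + Real.exp (2 * m * B₀) / γ * q) := by
  by_cases hnear : ‖x - y‖ < ρ ∧ |s - t| < ρ
  · have h1 := (abs_le.1 (hρ x hx y hy s hs t ht hnear.1 hnear.2)).2
    have h2 : 0 ≤ 1 / m * Real.log (1 + Real.exp (2 * m * B₀) / γ * q) := by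
      refine mul_nonneg (by positivity) (Real.log_nonneg ?_)
      have : 0 ≤ Real.exp (2 * m * B₀) / γ * q := by positivity
      linarith
    linarith
  · have hq' := hq (by
      by_contra hcon
      exact hnear ⟨not_le.1 fun h => hcon (Or.inl h), not_le.1 fun h => hcon (Or.inr h)⟩)
    have h1 : Real.exp (2 * m * B₀) ≤ Real.exp (2 * m * B₀) / γ * q := by
      rw [div_mul_eq_mul_div, le_div_iff₀ hγ]
      gcongr
    have h2 : 2 * B₀ ≤ 1 / m * Real.log (1 + Real.exp (2 * m * B₀) / γ * q) := by
      have h3 : 2 * m * B₀ ≤ Real.log (1 + Real.exp (2 * m * B₀) / γ * q) := by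
        rw [Real.le_log_iff_exp_le (by have := Real.exp_pos (2 * m * B₀); linarith)]
        linarith
      calc 2 * B₀ = 1 / m * (2 * m * B₀) := by field_simp
        _ ≤ _ := by gcongr
    have h4 := (abs_le.1 (hB₀ x hx s hs)).2
    have h5 := (abs_le.1 (hB₀ y hy t ht)).1
    linarith

theorem log_term_le {m A q δ : ℝ} (hm : 0 < m) (hAq : 0 ≤ A * q) (h : A * q ≤ m * δ) :
    1 / m * Real.log (1 + A * q) ≤ δ := by
  have h1 : Real.log (1 + A * q) ≤ A * q := by
    have := Real.log_le_sub_one_of_pos (by linarith : 0 < 1 + A * q)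
    linarith
  calc 1 / m * Real.log (1 + A * q) ≤ 1 / m * (m * δ) := by gcongr; linarith
    _ = δ := by field_simp

theorem exists_diam (H : LimitSetting α T ε₀ R r M l₁ l₂ K m₀ Ω J Φ μ v h) :
    ∃ d > 0, ∀ x ∈ closure Ω, ∀ y ∈ closure Ω, ‖x - y‖ ≤ d := by
  obtain ⟨d, hd⟩ := Metric.isBounded_iff.1 H.isBounded.closure
  refine ⟨max d 1, by positivity, fun x hx y hy => ?_⟩
  rw [← dist_eq_norm]
  exact (hd hx hy).trans (le_max_left _ _)

theorem abs_norm_sq_sub_le {E : Type*} [SeminormedAddCommGroup E] {x y c : E} {d : ℝ}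
    (hx : ‖x - c‖ ≤ d) (hy : ‖y - x‖ ≤ 1) :
    |‖y - c‖ ^ 2 - ‖x - c‖ ^ 2| ≤ (2 * d + 1) * ‖y - x‖ := by
  have h1 : |‖y - c‖ - ‖x - c‖| ≤ ‖y - x‖ := by
    have := abs_norm_sub_norm_le (y - c) (x - c)
    rwa [sub_sub_sub_cancel_right] at this
  have h2 : ‖y - c‖ ≤ d + 1 := by
    have := (abs_le.1 h1).2
    linarith
  have e : ‖y - c‖ ^ 2 - ‖x - c‖ ^ 2 = (‖y - c‖ + ‖x - c‖) * (‖y - c‖ - ‖x - c‖) := by ring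
  rw [e, abs_mul, abs_of_nonneg (by positivity : 0 ≤ ‖y - c‖ + ‖x - c‖)]
  refine mul_le_mul (by linarith) h1 (abs_nonneg _) ?_
  linarith [norm_nonneg (x - c)]

/-- Smallness conditions on `ε` under which logarithmic barriers apply. -/
theorem exists_barrier_scale (hε₀ : 0 < ε₀) {s₀ δ : ℝ} (hs₀ : 0 < s₀) (hδ : 0 < δ) (m A Lq : ℝ) :
    ∃ ε₁ > 0, ∀ ε, 0 < ε → ε < ε₁ → ε ∈ Ioc 0 ε₀ ∧ ε * R ≤ 1 ∧ A * Lq * (ε * R) ≤ 1 / 2 ∧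
      2 / m * (A * Lq * (ε * R)) ≤ s₀ ∧ M * (ε * R) + 2 / m * (A * Lq * (ε * R)) ≤ δ := by
  have hlim : ∀ c : ℝ, Tendsto (fun ε : ℝ => c * (ε * R)) (𝓝 0) (𝓝 0) := fun c => by
    have : Continuous fun ε : ℝ => c * (ε * R) := by fun_prop
    simpa using this.tendsto 0
  have e1 := (tendsto_order.1 (hlim 1)).2 1 one_pos
  have e2 := (tendsto_order.1 (hlim (A * Lq))).2 (1 / 2) (by norm_num)
  have e3 := (tendsto_order.1 (hlim (2 / m * (A * Lq)))).2 s₀ hs₀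
  have e4 := (tendsto_order.1 (hlim (M + 2 / m * (A * Lq)))).2 δ hδ
  obtain ⟨ε₁, hε₁, hsub⟩ := Metric.eventually_nhds_iff.1 (e1.and (e2.and (e3.and e4)))
  refine ⟨min ε₁ ε₀, lt_min hε₁ hε₀, fun ε hε hlt => ?_⟩
  obtain ⟨f1, f2, f3, f4⟩ := hsub (y := ε) (by
    rw [Real.dist_eq, sub_zero, abs_of_pos hε]
    exact hlt.trans_le (min_le_left _ _))
  refine ⟨⟨hε, hlt.le.trans (min_le_right _ _)⟩, by linarith, f2.le, ?_, ?_⟩ <;> nlinarith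

/-- The squared norm has no Taylor remainder, so ‖x - x₀‖² + 2Nt, with N the dimension, solves the
linear nonlocal heat equation exactly for every ε. -/
theorem integral_norm_sq_jump {J : Eucl n → ℝ} (hJ : IsKernel J) (ε : ℝ) (ξ : Eucl n) :
    ∫ z, J z * (‖ξ + ε • z‖ ^ 2 - ‖ξ‖ ^ 2) = ε ^ 2 * ((n + 1) * secondMoment J) := by
  have e : ∀ z, J z * (‖ξ + ε • z‖ ^ 2 - ‖ξ‖ ^ 2)
      = 2 * ε * (J z * inner ℝ ξ z) + ε ^ 2 * (J z * ‖z‖ ^ 2) := by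
    intro z
    rw [norm_add_sq_real, inner_smul_right, norm_smul, mul_pow, Real.norm_eq_abs, sq_abs]
    ring
  simp only [e]
  rw [integral_add ((hJ.integrable_mul (by fun_prop)).const_mul _)
    ((hJ.integrable_mul (by fun_prop)).const_mul _), integral_const_mul, integral_const_mul,
    hJ.integral_mul_odd (fun z => by simp), hJ.integral_mul_norm_sq]
  ring

/-- An upper bound by `v + β` at time `a` persists for a short time, uniformly in `ε` and `a`. -/
theorem exists_forward (H : LimitSetting α T ε₀ R r M l₁ l₂ K m₀ Ω J Φ μ v h) (hε₀ : 0 < ε₀)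
    {δ : ℝ} (hδ : 0 < δ) :
    ∃ η > 0, ∃ ε₁ > 0, ∀ ε, 0 < ε → ε < ε₁ → ∀ u₀ u,
      IsMildSolution Ω (seenRegion Ω J ε) T (diffusiveKernel J ε) Φ h u₀ u →
      ∀ a b β, 0 ≤ a → a < b → b ≤ T → b ≤ a + η → 0 ≤ β →
      (∀ᵐ x ∂volume.restrict Ω, u x a ≤ v x a + β) →
      ∀ᵐ x ∂volume.restrict Ω, ∀ t ∈ Icc a b, u x t ≤ v x t + (β + 4 * δ) := by
  obtain ⟨m, hm, s₀, hs₀, hexp⟩ := exists_flux_le_exp (c₀ := 2 / secondMoment J)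
    (by have := H.kernel.secondMoment_pos; positivity) H.exponent.1 H.K_nonneg H.m₀_nonneg
  obtain ⟨B₀, hB₀0, hB₀⟩ := H.exists_bound
  obtain ⟨ρ, hρ0, hρ⟩ := H.exists_modulus hδ
  obtain ⟨d, hd0, hd⟩ := H.exists_diam
  have hT := H.time_pos
  -- The least value of ‖x - x₀‖² + 2N(t - a) once either the spatial or the temporal distance
  -- reaches ρ.
  set γ := min (ρ ^ 2) ρ with hγ
  have hγ0 : 0 < γ := by positivity
  set A := Real.exp (2 * m * B₀) / γ with hA
  have hA0 : 0 < A := by positivity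
  obtain ⟨ε₁, hε₁, hsmall⟩ := exists_barrier_scale (R := R) (M := M) hε₀ hs₀ hδ m A
    (2 * d + 1)
  set N : ℝ := n + 1 with hN
  have hN1 : 1 ≤ N := by
    have : (0 : ℝ) ≤ n := Nat.cast_nonneg n
    linarith
  refine ⟨min (min 1 (ρ / 2)) (m * δ / (A * (1 + 2 * N))), by positivity, ε₁, hε₁, ?_⟩
  intro ε hε hlt u₀ u hu a b β ha hab hb hbη hβ hin
  set η := min (min 1 (ρ / 2)) (m * δ / (A * (1 + 2 * N))) with hη
  have hη0 : 0 < η := by positivity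
  have hη1 : η ≤ 1 := (min_le_left _ _).trans (min_le_left _ _)
  have hηρ : η < ρ := ((min_le_left _ _).trans (min_le_right _ _)).trans_lt (by linarith)
  have hηA : A * (η + 2 * N * η) ≤ m * δ := by
    have := min_le_right (min 1 (ρ / 2)) (m * δ / (A * (1 + 2 * N)))
    rw [← hη, le_div_iff₀ (by positivity)] at this
    linarith
  obtain ⟨hεI, k1, k2, k3, k4⟩ := hsmall ε hε hlt
  have haT : a ∈ Icc 0 T := ⟨ha, hab.le.trans hb⟩
  have hIT : ∀ t ∈ Icc a b, t ∈ Icc 0 T := fun t ht => ⟨ha.trans ht.1, ht.2.trans hb⟩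
  have hfar : ∀ x x₀ : Eucl n, ∀ t ∈ Icc a b, ρ ≤ ‖x - x₀‖ ∨ ρ ≤ |t - a| →
      γ ≤ ‖x - x₀‖ ^ 2 + 2 * N * (t - a) := by
    intro x x₀ t ht hor
    have ht0 : 0 ≤ t - a := sub_nonneg.2 ht.1
    rcases hor with h1 | h1
    · have : ρ ^ 2 ≤ ‖x - x₀‖ ^ 2 := by gcongr
      have h2 := min_le_left (ρ ^ 2) ρ
      nlinarith
    · rw [abs_of_nonneg ht0] at h1
      have h2 := min_le_right (ρ ^ 2) ρ
      nlinarith [sq_nonneg ‖x - x₀‖]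
  have hpoint : ∀ x₀ ∈ closure Ω, ∀ᵐ x ∂volume.restrict Ω, ∀ t ∈ Icc a b,
      u x t ≤ (v x₀ a + 2 * δ + β)
        + 1 / m * Real.log (1 + A * (‖x - x₀‖ ^ 2 + 2 * N * (t - a))) := by
    intro x₀ hx₀
    have hq0 : ∀ x : Eucl n, ∀ t ∈ Icc a b, 0 ≤ ‖x - x₀‖ ^ 2 + 2 * N * (t - a) := fun x t ht => by
      have := sub_nonneg.2 ht.1
      positivity
    refine H.le_log_barrier (q := fun x t => ‖x - x₀‖ ^ 2 + 2 * N * (t - a)) (q' := 2 * N)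
      (Lq := 2 * d + 1) (Bq := d ^ 2 + 2 * N * (b - a)) hm hexp hεI hu ha hab hb hA0.le
      (fun t => by fun_prop) (fun x t => ?_) (fun x _ t ht => hq0 x t ht) (fun x hx t ht => ?_)
      (fun x hx t _ y hy => ?_) (fun x _ t _ => ?_) k1 (by positivity) k2 k3 k4
      (fun p hp t ht => ?_) ?_
    · exact ((((hasDerivAt_id' t).sub_const a).const_mul (2 * N)).const_add
        (‖x - x₀‖ ^ 2)).congr_deriv (by ring)
    · have h1 := hd x hx x₀ hx₀
      have h2 := ht.2
      gcongr
    · have := abs_norm_sq_sub_le (hd x hx x₀ hx₀) hy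
      rwa [add_sub_add_right_eq_sub]
    · have e : ∀ z, J z * (‖x + ε • z - x₀‖ ^ 2 + 2 * N * (t - a)
          - (‖x - x₀‖ ^ 2 + 2 * N * (t - a)))
          = J z * (‖(x - x₀) + ε • z‖ ^ 2 - ‖x - x₀‖ ^ 2) := fun z => by
        rw [show x + ε • z - x₀ = (x - x₀) + ε • z by abel]
        ring
      simp only [e]
      rw [integral_norm_sq_jump H.kernel]
      have := H.kernel.secondMoment_pos
      refine le_of_eq ?_
      field_simp
      rfl
    · have ht' := Ioo_subset_Icc_self ht
      have := add_le_barrier hB₀ hρ hm hγ0 hδ.le (frontier_subset_closure hp) hx₀ (hIT t ht') haT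
        (hq0 p t ht') (hfar p x₀ t ht')
      linarith
    · filter_upwards [hin, ae_restrict_mem H.isOpen.measurableSet] with x hx hxΩ
      have haI : a ∈ Icc a b := left_mem_Icc.2 hab.le
      have := add_le_barrier hB₀ hρ hm hγ0 hδ.le (subset_closure hxΩ) hx₀ haT haT
        (hq0 x a haI) (hfar x x₀ a haI)
      linarith
  -- Each centre x₀ has its own null set, so only finitely many centres are used. Near a centre the
  -- logarithmic term and the oscillation of v each cost a further δ, giving 4δ in all.
  obtain ⟨F, hFsub, hFfin, hFcov⟩ := H.isBounded.isCompact_closure.finite_cover_balls hη0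
  have hall : ∀ᵐ x ∂volume.restrict Ω, ∀ x₀ ∈ F, ∀ t ∈ Icc a b,
      u x t ≤ (v x₀ a + 2 * δ + β)
        + 1 / m * Real.log (1 + A * (‖x - x₀‖ ^ 2 + 2 * N * (t - a))) :=
    (ae_ball_iff hFfin.countable).2 fun x₀ hx₀ => hpoint x₀ (hFsub hx₀)
  filter_upwards [hall, ae_restrict_mem H.isOpen.measurableSet] with x hx hxΩ t ht
  obtain ⟨x₀, hx₀, hdist⟩ := mem_iUnion₂.1 (hFcov (subset_closure hxΩ))
  rw [Metric.mem_ball, dist_eq_norm] at hdist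
  have ht0 : 0 ≤ t - a := sub_nonneg.2 ht.1
  have htη : t - a ≤ η := by linarith [ht.2]
  have hlog := log_term_le (m := m) (A := A) (q := ‖x - x₀‖ ^ 2 + 2 * N * (t - a)) (δ := δ) hm
    (by positivity) (by
      refine le_trans ?_ hηA
      have : ‖x - x₀‖ ^ 2 ≤ η := by nlinarith [norm_nonneg (x - x₀)]
      gcongr)
  have hmod := (abs_le.1 (hρ x₀ (hFsub hx₀) x (subset_closure hxΩ) a haT t (hIT t ht)
    (by rw [norm_sub_rev]; linarith) (by rw [abs_sub_comm, abs_of_nonneg ht0]; linarith))).2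
  have := hx x₀ hx₀ t ht
  linarith

end LimitSetting

/-! ### Barriers at lateral boundary points -/

theorem abs_exp_neg_sub_le {a b : ℝ} (ha : 0 ≤ a) (hb : 0 ≤ b) :
    |Real.exp (-a) - Real.exp (-b)| ≤ |a - b| := by
  have key : ∀ a b : ℝ, 0 ≤ a → a ≤ b → Real.exp (-a) - Real.exp (-b) ≤ b - a := by
    intro a b ha hab
    have h1 := Real.add_one_le_exp (-(b - a))
    have h2 : Real.exp (-b) = Real.exp (-a) * Real.exp (-(b - a)) := by
      rw [← Real.exp_add]; ring_nf
    have h3 : Real.exp (-a) ≤ 1 := Real.exp_le_one_iff.2 (by linarith)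
    have h4 := Real.exp_pos (-a)
    have h5 : Real.exp (-a) - Real.exp (-b) = Real.exp (-a) * (1 - Real.exp (-(b - a))) := by
      rw [h2]; ring
    rw [h5]
    calc _ ≤ Real.exp (-a) * (b - a) := mul_le_mul_of_nonneg_left (by linarith) h4.le
      _ ≤ 1 * (b - a) := mul_le_mul_of_nonneg_right h3 (sub_nonneg.2 hab)
      _ = _ := one_mul _
  rcases le_total a b with hab | hab
  · rw [abs_of_nonneg (sub_nonneg.2 (Real.exp_le_exp.2 (by linarith))), abs_sub_comm,
      abs_of_nonneg (sub_nonneg.2 hab)]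
    exact key a b ha hab
  · rw [abs_sub_comm, abs_of_nonneg (sub_nonneg.2 (Real.exp_le_exp.2 (by linarith))),
      abs_of_nonneg (sub_nonneg.2 hab)]
    exact key b a hb hab

/-- The ball of half the radius touches the boundary at p only, and the squared distance to its
centre then grows quadratically away from p. -/
theorem norm_sq_ge_of_exterior_ball {n : ℕ} {p e x : Eucl n} {r : ℝ} (hr : 0 < r) (he : ‖e‖ = 1)
    (h : 2 * r ≤ ‖x - (p + (2 * r) • e)‖) : r ^ 2 + ‖x - p‖ ^ 2 / 2 ≤ ‖x - (p + r • e)‖ ^ 2 := by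
  have e1 : ∀ s : ℝ, ‖x - (p + s • e)‖ ^ 2 = ‖x - p‖ ^ 2 - 2 * s * inner ℝ (x - p) e + s ^ 2 := by
    intro s
    rw [show x - (p + s • e) = (x - p) - s • e by abel, norm_sub_sq_real, inner_smul_right,
      norm_smul, he, mul_one, Real.norm_eq_abs, sq_abs]
    ring
  have h1 : (2 * r) ^ 2 ≤ ‖x - (p + (2 * r) • e)‖ ^ 2 := by gcongr
  rw [e1] at h1 ⊢
  linarith

/-- A Gaussian is a strict subsolution of the nonlocal heat equation away from its centre. -/
theorem IsKernel.exists_gaussian_jump {n : ℕ} {J : Eucl n → ℝ} (hJ : IsKernel J) {R : ℝ}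
    (hR : 0 < R) (hrange : ∀ z, R ≤ ‖z‖ → J z = 0) {l D ρ : ℝ} (hl : 0 < l) (hD : 0 < D)
    (hlρ : n + 1 ≤ l * ρ ^ 2) (hρ : 0 < ρ) :
    ∃ ε₁ > 0, ∀ ε, 0 < ε → ε < ε₁ → ∀ ξ : Eucl n, ρ ≤ ‖ξ‖ → ‖ξ‖ ≤ D →
      ε ^ 2 * (secondMoment J * (l * (n + 1) / 2)) * Real.exp (-(l * D ^ 2)) ≤
        ∫ z, J z * (Real.exp (-(l * ‖ξ + ε • z‖ ^ 2)) - Real.exp (-(l * ‖ξ‖ ^ 2))) := by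
  have hC := hJ.secondMoment_pos
  -- εC₁ bounds the change of the exponent in one jump; ε³C₄ collects the third-order errors, which
  -- for small ε take up half of the guaranteed second-order gain.
  set C₁ := l * (2 * D * R + R ^ 2) with hC₁
  have hC₁0 : 0 < C₁ := by positivity
  set C₄ := 2 * l ^ 2 * (D * R ^ 3) + C₁ ^ 3 with hC₄
  have hC₄0 : 0 < C₄ := by positivity
  refine ⟨min 1 (min (1 / C₁) (secondMoment J * (l * (n + 1) / 2) / C₄)), by positivity, ?_⟩
  intro ε hε hlt ξ hξρ hξD
  have hε1 : ε ≤ 1 := hlt.le.trans (min_le_left _ _)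
  have hεC₁ : ε * C₁ ≤ 1 := by
    have := hlt.le.trans ((min_le_right _ _).trans (min_le_left _ _))
    rwa [le_div_iff₀ hC₁0] at this
  have hεC₄ : ε * C₄ ≤ secondMoment J * (l * (n + 1) / 2) := by
    have := hlt.le.trans ((min_le_right _ _).trans (min_le_right _ _))
    rwa [le_div_iff₀ hC₄0] at this
  set E := Real.exp (-(l * ‖ξ‖ ^ 2)) with hE
  have hED : Real.exp (-(l * D ^ 2)) ≤ E := by
    rw [hE]; gcongr
  have hE0 : 0 < E := Real.exp_pos _
  have hpt : ∀ z, J z * (E * (-(2 * l * ε) * inner ℝ ξ z - l * ε ^ 2 * ‖z‖ ^ 2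
      + 2 * l ^ 2 * ε ^ 2 * inner ℝ ξ z ^ 2 - ε ^ 3 * C₄))
      ≤ J z * (Real.exp (-(l * ‖ξ + ε • z‖ ^ 2)) - E) := by
    intro z
    by_cases hz : R ≤ ‖z‖
    · simp [hrange z hz]
    refine mul_le_mul_of_nonneg_left ?_ (hJ.nonneg z)
    have hzR : ‖z‖ ≤ R := (not_le.1 hz).le
    set I := inner ℝ ξ z with hI
    have hIle : |I| ≤ D * R := (abs_real_inner_le_norm ξ z).trans (by gcongr)
    set s := -(l * (2 * ε * I + ε ^ 2 * ‖z‖ ^ 2)) with hs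
    have hexp : Real.exp (-(l * ‖ξ + ε • z‖ ^ 2)) = E * Real.exp s := by
      rw [hE, ← Real.exp_add, norm_add_sq_real, inner_smul_right, norm_smul, mul_pow,
        Real.norm_eq_abs, sq_abs, hs]
      congr 1
      ring
    have hsle : |s| ≤ ε * C₁ := by
      rw [hs, abs_neg, abs_mul, abs_of_pos hl, hC₁]
      have h1 : |2 * ε * I + ε ^ 2 * ‖z‖ ^ 2| ≤ 2 * ε * |I| + ε ^ 2 * ‖z‖ ^ 2 := by
        refine (abs_add_le _ _).trans (le_of_eq ?_)
        rw [abs_mul, abs_of_nonneg (by positivity : 0 ≤ 2 * ε),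
          abs_of_nonneg (by positivity : 0 ≤ ε ^ 2 * ‖z‖ ^ 2)]
      have h2 : ε ^ 2 * ‖z‖ ^ 2 ≤ ε * R ^ 2 := by
        have : ε ^ 2 ≤ ε := by nlinarith
        gcongr
      calc l * |2 * ε * I + ε ^ 2 * ‖z‖ ^ 2| ≤ l * (2 * ε * (D * R) + ε * R ^ 2) := by
            gcongr
            refine h1.trans (add_le_add ?_ h2)
            gcongr
        _ = _ := by ring
    have h3 := exp_quadratic_lower (hsle.trans hεC₁)
    have h4 : |s| ^ 3 ≤ ε ^ 3 * C₁ ^ 3 := by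
      rw [← mul_pow]; gcongr
    have h5 : 4 * l ^ 2 * ε ^ 2 * I ^ 2 - 4 * l ^ 2 * ε ^ 3 * (D * R ^ 3) ≤ s ^ 2 := by
      have h6 : -(D * R ^ 3) ≤ I * ‖z‖ ^ 2 := by
        have h7 : |I * ‖z‖ ^ 2| ≤ D * R * R ^ 2 := by
          rw [abs_mul, abs_of_nonneg (by positivity : 0 ≤ ‖z‖ ^ 2)]
          gcongr
        have := (abs_le.1 h7).1
        linarith
      have h8 : s ^ 2 = 4 * l ^ 2 * ε ^ 2 * I ^ 2 + 4 * l ^ 2 * ε ^ 3 * (I * ‖z‖ ^ 2)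
          + l ^ 2 * ε ^ 4 * ‖z‖ ^ 4 := by rw [hs]; ring
      have h9 : 4 * l ^ 2 * ε ^ 3 * (-(D * R ^ 3)) ≤ 4 * l ^ 2 * ε ^ 3 * (I * ‖z‖ ^ 2) := by gcongr
      have h10 : 0 ≤ l ^ 2 * ε ^ 4 * ‖z‖ ^ 4 := by positivity
      linarith
    rw [hexp, show E * Real.exp s - E = E * (Real.exp s - 1) by ring]
    refine mul_le_mul_of_nonneg_left ?_ hE0.le
    have e1 : s = -(2 * l * ε) * I - l * ε ^ 2 * ‖z‖ ^ 2 := by rw [hs]; ring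
    have e2 : ε ^ 3 * C₄ = 2 * l ^ 2 * ε ^ 3 * (D * R ^ 3) + ε ^ 3 * C₁ ^ 3 := by rw [hC₄]; ring
    linarith
  have hlow : ∫ z, J z * (E * (-(2 * l * ε) * inner ℝ ξ z - l * ε ^ 2 * ‖z‖ ^ 2
      + 2 * l ^ 2 * ε ^ 2 * inner ℝ ξ z ^ 2 - ε ^ 3 * C₄))
      = E * (ε ^ 2 * secondMoment J * (2 * l ^ 2 * ‖ξ‖ ^ 2 - l * (n + 1)) - ε ^ 3 * C₄) := by
    have e : ∀ z, J z * (E * (-(2 * l * ε) * inner ℝ ξ z - l * ε ^ 2 * ‖z‖ ^ 2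
      + 2 * l ^ 2 * ε ^ 2 * inner ℝ ξ z ^ 2 - ε ^ 3 * C₄))
      = E * (-(2 * l * ε)) * (J z * inner ℝ ξ z) + (-(E * (l * ε ^ 2))) * (J z * ‖z‖ ^ 2)
        + E * (2 * l ^ 2 * ε ^ 2) * (J z * inner ℝ ξ z ^ 2) + (-(E * (ε ^ 3 * C₄))) * J z :=
      fun z => by ring
    simp only [e]
    have i1 : Integrable fun z => J z * inner ℝ ξ z := hJ.integrable_mul (by fun_prop)
    have i2 : Integrable fun z => J z * ‖z‖ ^ 2 := hJ.integrable_mul (by fun_prop)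
    have i3 : Integrable fun z => J z * inner ℝ ξ z ^ 2 := hJ.integrable_mul (by fun_prop)
    have i4 : Integrable fun z => E * (-(2 * l * ε)) * (J z * inner ℝ ξ z)
        + (-(E * (l * ε ^ 2))) * (J z * ‖z‖ ^ 2) := (i1.const_mul _).add (i2.const_mul _)
    have i5 : Integrable fun z => E * (-(2 * l * ε)) * (J z * inner ℝ ξ z)
        + (-(E * (l * ε ^ 2))) * (J z * ‖z‖ ^ 2) + E * (2 * l ^ 2 * ε ^ 2)
          * (J z * inner ℝ ξ z ^ 2) := i4.add (i3.const_mul _)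
    rw [integral_add i5 (hJ.integrable.const_mul _), integral_add i4 (i3.const_mul _),
      integral_add (i1.const_mul _) (i2.const_mul _)]
    simp only [integral_const_mul]
    rw [hJ.integral_mul_odd (fun z => by simp), hJ.integral_mul_norm_sq, hJ.integral_mul_inner_sq,
      hJ.integral_eq_one]
    ring
  have hmono := integral_mono (hJ.integrable_mul (by fun_prop)) (hJ.integrable_mul (by fun_prop))
    hpt
  rw [hlow] at hmono
  refine le_trans ?_ hmono
  -- The condition on lρ² makes the convexity of the Gaussian in the radial direction outweigh the
  -- negative terms.
  have hk : l * (n + 1) ≤ 2 * l ^ 2 * ‖ξ‖ ^ 2 - l * (n + 1) := by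
    have h1 : l * (n + 1) ≤ l * (l * ‖ξ‖ ^ 2) := by
      have : l * ρ ^ 2 ≤ l * ‖ξ‖ ^ 2 := by gcongr
      have := hlρ.trans this
      gcongr
    nlinarith
  have hk2 : ε ^ 2 * (secondMoment J * (l * (n + 1) / 2))
      ≤ ε ^ 2 * secondMoment J * (2 * l ^ 2 * ‖ξ‖ ^ 2 - l * (n + 1)) - ε ^ 3 * C₄ := by
    have h1 : ε ^ 2 * secondMoment J * (l * (n + 1))
        ≤ ε ^ 2 * secondMoment J * (2 * l ^ 2 * ‖ξ‖ ^ 2 - l * (n + 1)) := by gcongr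
    have h2 : ε ^ 2 * (ε * C₄) ≤ ε ^ 2 * (secondMoment J * (l * (n + 1) / 2)) := by gcongr
    nlinarith
  calc ε ^ 2 * (secondMoment J * (l * (n + 1) / 2)) * Real.exp (-(l * D ^ 2))
      ≤ ε ^ 2 * (secondMoment J * (l * (n + 1) / 2)) * E := by gcongr
    _ = E * (ε ^ 2 * (secondMoment J * (l * (n + 1) / 2))) := mul_comm _ _
    _ ≤ _ := by gcongr

theorem IsMildSolution.initial {n : ℕ} {Ω S : Set (Eucl n)} {T : ℝ} (hT : 0 ≤ T) {k : Eucl n → ℝ}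
    {Φ h : Eucl n → ℝ → ℝ} {u₀ : Eucl n → ℝ} {u : Eucl n → ℝ → ℝ}
    (hu : IsMildSolution Ω S T k Φ h u₀ u) : ∀ᵐ x ∂volume.restrict Ω, u x 0 = u₀ x :=
  hu.equation.mono fun x hx => by
    rw [hx.2 0 ⟨le_rfl, hT⟩, intervalIntegral.integral_same, add_zero]

namespace LimitSetting

variable {n : ℕ} {α T ε₀ R r M l₁ l₂ K m₀ : ℝ} {Ω : Set (Eucl n)} {J : Eucl n → ℝ}
  {Φ : Eucl n → ℝ → ℝ} {μ : Eucl n → ℝ} {v h : Eucl n → ℝ → ℝ}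

set_option maxHeartbeats 600000 in
/-- Near the lateral boundary the nonlocal solutions lie below `v`, up to a small error that is
uniform in `ε`. -/
theorem exists_boundary (H : LimitSetting α T ε₀ R r M l₁ l₂ K m₀ Ω J Φ μ v h) (hε₀ : 0 < ε₀)
    {δ : ℝ} (hδ : 0 < δ) :
    ∃ η > 0, ∃ ε₁ > 0, ∀ ε, 0 < ε → ε < ε₁ → ∀ u,
      IsMildSolution Ω (seenRegion Ω J ε) T (diffusiveKernel J ε) Φ h (fun x => v x 0) u →
      ∀ t₀ ∈ Icc 0 T, ∀ᵐ x ∂volume.restrict Ω, Metric.infDist x Ωᶜ < η →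
        u x t₀ ≤ v x t₀ + 4 * δ := by
  obtain ⟨m, hm, s₀, hs₀, hexp⟩ := exists_flux_le_exp (c₀ := 2 / secondMoment J)
    (by have := H.kernel.secondMoment_pos; positivity) H.exponent.1 H.K_nonneg H.m₀_nonneg
  obtain ⟨B₀, hB₀0, hB₀⟩ := H.exists_bound
  obtain ⟨ρ, hρ0, hρ⟩ := H.exists_modulus hδ
  obtain ⟨d, hd0, hd⟩ := H.exists_diam
  have hT := H.time_pos
  have hC := H.kernel.secondMoment_pos
  -- Halving the radius gives strict separation from all boundary points except p.
  set r' := r / 2 with hr'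
  have hr'0 : 0 < r' := by have := H.radius_pos; positivity
  set D := d + r' with hD
  have hD0 : 0 < D := by positivity
  set l := (n + 1 : ℝ) / r' ^ 2 with hl
  have hl0 : 0 < l := by positivity
  have hlr : (n : ℝ) + 1 ≤ l * r' ^ 2 := le_of_eq (by rw [hl]; field_simp)
  obtain ⟨ε₂, hε₂, hgauss⟩ := H.kernel.exists_gaussian_jump H.range_pos H.range hl0 hD0 hlr hr'0
  -- The rate at which the linear nonlocal operator lowers minus the Gaussian, uniformly on the
  -- closure of Ω and in small ε; the barrier may therefore decrease in time at this speed.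
  set κ := Real.exp (-(l * D ^ 2)) * (l * (n + 1)) with hκ
  have hκ0 : 0 < κ := by positivity
  set γ := min (Real.exp (-(l * r' ^ 2)) - Real.exp (-(l * (r' ^ 2 + ρ ^ 2 / 2)))) (κ * ρ) with hγ
  have hγ0 : 0 < γ := lt_min (sub_pos.2 (Real.exp_lt_exp.2 (by
    have : 0 < l * (ρ ^ 2 / 2) := by positivity
    linarith))) (by positivity)
  set A := Real.exp (2 * m * B₀) / γ with hA
  have hA0 : 0 < A := by positivity
  set Lq := l * (2 * D + 1) with hLq
  have hLq0 : 0 < Lq := by positivity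
  obtain ⟨ε₁, hε₁, hsmall⟩ := exists_barrier_scale (R := R) (M := M) hε₀ hs₀ hδ m A Lq
  set η := min (min (1 / 2) (ρ / 2)) (m * δ / (A * Lq * 2)) with hη
  have hη0 : 0 < η := by positivity
  have hη1 : η + η ≤ 1 := by
    have := (min_le_left (min (1 / 2) (ρ / 2)) (m * δ / (A * Lq * 2))).trans (min_le_left _ _)
    linarith
  have hηρ : η + η ≤ ρ := by
    have := (min_le_left (min (1 / 2) (ρ / 2)) (m * δ / (A * Lq * 2))).trans (min_le_right _ _)
    linarith
  have hηA : A * (Lq * (η + η)) ≤ m * δ := by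
    have := min_le_right (min (1 / 2) (ρ / 2)) (m * δ / (A * Lq * 2))
    rw [← hη, le_div_iff₀ (by positivity)] at this
    linarith
  refine ⟨η, hη0, min ε₁ ε₂, lt_min hε₁ hε₂, fun ε hε hlt u hu t₀ ht₀ => ?_⟩
  obtain ⟨hεI, k1, k2, k3, k4⟩ := hsmall ε hε (hlt.trans_le (min_le_left _ _))
  have hin0 := hu.initial hT.le
  rcases ht₀.1.eq_or_lt with rfl | ht₀pos
  · filter_upwards [hin0] with x hx _
    rw [hx]; linarith
  have hIT : ∀ t ∈ Icc 0 t₀, t ∈ Icc 0 T := fun t ht => ⟨ht.1, ht.2.trans ht₀.2⟩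
  have hpoint : ∀ p ∈ frontier Ω, ∀ᵐ x ∂volume.restrict Ω, ‖x - p‖ < η + η →
      u x t₀ ≤ v p t₀ + 3 * δ := by
    intro p hp
    obtain ⟨e, he, hball⟩ := H.exteriorBalls p hp
    set c := p + r' • e with hc
    have hpc := frontier_subset_closure hp
    have hfarC : ∀ x ∈ closure Ω, r' ^ 2 + ‖x - p‖ ^ 2 / 2 ≤ ‖x - c‖ ^ 2 := by
      intro x hx
      have hcl : r ≤ ‖x - (p + r • e)‖ :=
        closure_minimal (s := Ω) (t := {x | r ≤ ‖x - (p + r • e)‖}) hball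
          (isClosed_le (by fun_prop) (by fun_prop)) hx
      refine norm_sq_ge_of_exterior_ball hr'0 he ?_
      rwa [show 2 * r' = r by rw [hr']; ring]
    have hsq : ∀ x ∈ closure Ω, r' ^ 2 ≤ ‖x - c‖ ^ 2 := fun x hx =>
      (le_add_of_nonneg_right (by positivity)).trans (hfarC x hx)
    have hxc : ∀ x ∈ closure Ω, ‖x - c‖ ≤ D := by
      intro x hx
      have h1 := norm_sub_le (x - p) (r' • e)
      rw [norm_smul, he, mul_one, Real.norm_of_nonneg hr'0.le] at h1
      have h2 := hd x hx p hpc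
      rw [hc, show x - (p + r' • e) = x - p - r' • e by abel]
      linarith
    -- On the closure of Ω, for times up to t₀, this is nonnegative and vanishes only at (p,t₀); γ
    -- is its minimum gain once x or t is at distance ρ from that point.
    set q : Eucl n → ℝ → ℝ := fun x t =>
      Real.exp (-(l * r' ^ 2)) - Real.exp (-(l * ‖x - c‖ ^ 2)) + κ * (t₀ - t) with hq
    have hq0 : ∀ x ∈ closure Ω, ∀ t ∈ Icc 0 t₀, 0 ≤ q x t := by
      intro x hx t ht
      have h1 := hsq x hx
      have h2 : Real.exp (-(l * ‖x - c‖ ^ 2)) ≤ Real.exp (-(l * r' ^ 2)) := by gcongr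
      have h3 : 0 ≤ κ * (t₀ - t) := mul_nonneg hκ0.le (sub_nonneg.2 ht.2)
      simp only [hq]
      linarith
    have hfar : ∀ x ∈ closure Ω, ∀ t ∈ Icc 0 t₀, ρ ≤ ‖x - p‖ ∨ ρ ≤ |t - t₀| → γ ≤ q x t := by
      intro x hx t ht hor
      have h0 := hfarC x hx
      have h3 : 0 ≤ κ * (t₀ - t) := mul_nonneg hκ0.le (sub_nonneg.2 ht.2)
      simp only [hq]
      rcases hor with h1 | h1
      · have h2 : Real.exp (-(l * ‖x - c‖ ^ 2)) ≤ Real.exp (-(l * (r' ^ 2 + ρ ^ 2 / 2))) := by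
          have : ρ ^ 2 ≤ ‖x - p‖ ^ 2 := by gcongr
          have : r' ^ 2 + ρ ^ 2 / 2 ≤ ‖x - c‖ ^ 2 := by linarith
          gcongr
        have := min_le_left (Real.exp (-(l * r' ^ 2)) - Real.exp (-(l * (r' ^ 2 + ρ ^ 2 / 2))))
          (κ * ρ)
        linarith
      · have h2 : Real.exp (-(l * ‖x - c‖ ^ 2)) ≤ Real.exp (-(l * r' ^ 2)) := by
          have := hsq x hx
          gcongr
        rw [abs_sub_comm, abs_of_nonneg (sub_nonneg.2 ht.2)] at h1
        have h4 : κ * ρ ≤ κ * (t₀ - t) := by gcongr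
        have := min_le_right (Real.exp (-(l * r' ^ 2)) - Real.exp (-(l * (r' ^ 2 + ρ ^ 2 / 2))))
          (κ * ρ)
        linarith
    have hqL : ∀ x ∈ closure Ω, ∀ t, ∀ y, ‖y - x‖ ≤ 1 → |q y t - q x t| ≤ Lq * ‖y - x‖ := by
      intro x hx t y hy
      have e1 : q y t - q x t
          = Real.exp (-(l * ‖x - c‖ ^ 2)) - Real.exp (-(l * ‖y - c‖ ^ 2)) := by
        simp only [hq]; ring
      rw [e1]
      refine (abs_exp_neg_sub_le (by positivity) (by positivity)).trans ?_
      rw [← mul_sub, abs_mul, abs_of_pos hl0, abs_sub_comm, hLq, mul_assoc]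
      exact mul_le_mul_of_nonneg_left (abs_norm_sq_sub_le (hxc x hx) hy) hl0.le
    have hbar := H.le_log_barrier (q := q) (q' := -κ) (Lq := Lq) (Bq := 1 + κ * t₀) (A := A)
      (c := v p t₀ + 2 * δ) (δ := δ) hm hexp hεI hu le_rfl ht₀pos ht₀.2 hA0.le
      (fun t => by simp only [hq]; fun_prop) (fun x t => ?_) hq0 (fun x hx t ht => ?_)
      (fun x hx t _ y hy => hqL x hx t y hy) (fun x hx t _ => ?_) k1 hLq0.le k2 k3 k4
      (fun p' hp' t ht => ?_) ?_
    · filter_upwards [hbar, ae_restrict_mem H.isOpen.measurableSet] with x hx hxΩ hxp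
      have ht₀I : t₀ ∈ Icc 0 t₀ := ⟨ht₀pos.le, le_rfl⟩
      have hqp : q p t₀ = 0 := by
        simp only [hq, hc]
        rw [show p - (p + r' • e) = -(r' • e) by abel, norm_neg, norm_smul, he, mul_one,
          Real.norm_of_nonneg hr'0.le]
        ring
      have h1 := (abs_le.1 (hqL p hpc t₀ x (hxp.le.trans hη1))).2
      rw [hqp, sub_zero] at h1
      have h2 := log_term_le (m := m) (A := A) (q := q x t₀) (δ := δ) hm
        (mul_nonneg hA0.le (hq0 x (subset_closure hxΩ) t₀ ht₀I)) (by
          refine le_trans ?_ hηA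
          have : Lq * ‖x - p‖ ≤ Lq * (η + η) := by gcongr
          exact mul_le_mul_of_nonneg_left (h1.trans this) hA0.le)
      have := hx t₀ ht₀I
      linarith
    · exact ((((hasDerivAt_id' t).const_sub t₀).const_mul κ).const_add
        (Real.exp (-(l * r' ^ 2)) - Real.exp (-(l * ‖x - c‖ ^ 2)))).congr_deriv (by ring)
    · have h1 : Real.exp (-(l * r' ^ 2)) ≤ 1 := Real.exp_le_one_iff.2 (by
        have : 0 ≤ l * r' ^ 2 := by positivity
        linarith)
      have h2 := Real.exp_pos (-(l * ‖x - c‖ ^ 2))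
      have h3 : κ * (t₀ - t) ≤ κ * t₀ := by
        have := ht.1
        gcongr
        linarith
      simp only [hq]
      linarith
    · have hcl := subset_closure hx
      have hxr : r' ≤ ‖x - c‖ := le_of_sq_le_sq (hsq x hcl) (norm_nonneg _)
      have hg := hgauss ε hε (hlt.trans_le (min_le_right _ _)) (x - c) hxr (hxc x hcl)
      have e1 : ∀ z, J z * (q (x + ε • z) t - q x t) = -(J z *
          (Real.exp (-(l * ‖x - c + ε • z‖ ^ 2)) - Real.exp (-(l * ‖x - c‖ ^ 2)))) := fun z => by
        simp only [hq]
        rw [show x + ε • z - c = x - c + ε • z by abel]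
        ring
      simp only [e1]
      rw [integral_neg]
      have h1 := mul_le_mul_of_nonneg_left hg
        (by positivity : 0 ≤ (ε ^ 2)⁻¹ * (2 / secondMoment J))
      have e2 : (ε ^ 2)⁻¹ * (2 / secondMoment J) * (ε ^ 2 * (secondMoment J * (l * (n + 1) / 2))
          * Real.exp (-(l * D ^ 2))) = κ := by
        rw [hκ]; field_simp
      rw [e2] at h1
      linarith
    · have ht' := Ioo_subset_Icc_self ht
      exact add_le_barrier hB₀ hρ hm hγ0 hδ.le (frontier_subset_closure hp') hpc (hIT t ht') ht₀
        (hq0 p' (frontier_subset_closure hp') t ht') (hfar p' (frontier_subset_closure hp') t ht')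
    · filter_upwards [hin0, ae_restrict_mem H.isOpen.measurableSet] with x hx hxΩ
      have h0I : (0 : ℝ) ∈ Icc 0 t₀ := ⟨le_rfl, ht₀pos.le⟩
      have := add_le_barrier hB₀ hρ hm hγ0 hδ.le (subset_closure hxΩ) hpc (hIT 0 h0I) ht₀
        (hq0 x (subset_closure hxΩ) 0 h0I) (hfar x (subset_closure hxΩ) 0 h0I)
      rw [hx]
      linarith
  -- A finite net of boundary points keeps the exceptional set null. A point within η of the
  -- boundary is within 2η of the net, and the last δ comes from moving v from the net point to x.
  obtain ⟨F, hFsub, hFfin, hFcov⟩ :=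
    (H.isBounded.isCompact_closure.of_isClosed_subset isClosed_frontier
      frontier_subset_closure).finite_cover_balls hη0
  have hall : ∀ᵐ x ∂volume.restrict Ω, ∀ p ∈ F, ‖x - p‖ < η + η → u x t₀ ≤ v p t₀ + 3 * δ :=
    (ae_ball_iff hFfin.countable).2 fun p hp => hpoint p (hFsub hp)
  filter_upwards [hall, ae_restrict_mem H.isOpen.measurableSet] with x hx hxΩ hdist
  obtain ⟨p₀, hp₀, hp₀x⟩ := exists_nearest_frontier H.isOpen H.isBounded hxΩ
  obtain ⟨p, hp, hpp₀⟩ := mem_iUnion₂.1 (hFcov hp₀)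
  rw [Metric.mem_ball, dist_eq_norm] at hpp₀
  have hxp : ‖x - p‖ < η + η := by
    have := norm_sub_le_norm_sub_add_norm_sub x p₀ p
    linarith
  have h1 := hx p hp hxp
  have h2 := (abs_le.1 (hρ p (frontier_subset_closure (hFsub hp)) x (subset_closure hxΩ) t₀ ht₀ t₀
    ht₀ (by rw [norm_sub_rev]; linarith) (by simpa using hρ0))).2
  linarith

end LimitSetting

/-! ### Convergence from above -/

theorem SolvesAt.mono {n : ℕ} {α r s L L' : ℝ} {v : Eucl n → ℝ → ℝ} {μ : Eucl n → ℝ} {x : Eucl n}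
    {t : ℝ} (h : SolvesAt α r L v μ x t) (hsr : s ≤ r) (hL : L ≤ L') :
    SolvesAt α s L' v μ x t := by
  obtain ⟨a, B, v', h1, h2, h3⟩ := h
  refine ⟨a, B, v', h1, ⟨h2.norm_le.trans hL, h2.norm_hess_le.trans hL, fun z hz => ?_⟩, h3⟩
  exact (h2.remainder z (hz.trans_le hsr)).trans (by gcongr)

theorem jumpOp_add_const {n : ℕ} (S : Set (Eucl n)) (k : Eucl n → ℝ) (Φ : Eucl n → ℝ → ℝ)
    (w : Eucl n → ℝ) (c : ℝ) (x : Eucl n) :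
    jumpOp S k Φ (fun y => w y + c) x = jumpOp S k Φ w x := by
  simp only [jumpOp, add_sub_add_right_eq_sub]

namespace LimitSetting

variable {n : ℕ} {α T ε₀ R r M l₁ l₂ K m₀ : ℝ} {Ω : Set (Eucl n)} {J : Eucl n → ℝ}
  {Φ : Eucl n → ℝ → ℝ} {μ : Eucl n → ℝ} {v h : Eucl n → ℝ → ℝ}

theorem exists_uniform_solvesAt (H : LimitSetting α T ε₀ R r M l₁ l₂ K m₀ Ω J Φ μ v h)
    {Q : Set (Eucl n × ℝ)} (hQ : IsCompact Q) (hsub : Q ⊆ Ω ×ˢ Ioo 0 T) :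
    ∃ s > 0, ∃ L ≥ 0, ∀ q ∈ Q, SolvesAt α s L v μ q.1 q.2 := by
  refine hQ.induction_on (p := fun Q => ∃ s > 0, ∃ L ≥ 0, ∀ q ∈ Q, SolvesAt α s L v μ q.1 q.2)
    ⟨1, one_pos, 0, le_rfl, fun q hq => hq.elim⟩ ?_ ?_ fun p hp => ?_
  · rintro A B hAB ⟨s, hs, L, hL, hB⟩
    exact ⟨s, hs, L, hL, fun q hq => hB q (hAB hq)⟩
  · rintro A B ⟨s, hs, L, hL, hA⟩ ⟨s', hs', L', hL', hB⟩
    refine ⟨min s s', lt_min hs hs', max L L', hL.le.trans (le_max_left _ _), ?_⟩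
    rintro q (hq | hq)
    · exact (hA q hq).mono (min_le_left _ _) (le_max_left _ _)
    · exact (hB q hq).mono (min_le_right _ _) (le_max_right _ _)
  · obtain ⟨U, hU, h⟩ := H.interior p (hsub hp)
    exact ⟨U, mem_nhdsWithin_of_mem_nhds hU, h⟩

/-- Upper bounds by `v + c` at time `a` and near the boundary propagate to later times. -/
theorem exists_middle (H : LimitSetting α T ε₀ R r M l₁ l₂ K m₀ Ω J Φ μ v h) (hε₀ : 0 < ε₀)
    {η a b δ : ℝ} (hη : 0 < η) (ha : 0 < a) (hab : a < b) (hb : b < T) (hδ : 0 < δ) :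
    ∃ ε₁ > 0, ∀ ε, 0 < ε → ε < ε₁ → ∀ u₀ u c,
      IsMildSolution Ω (seenRegion Ω J ε) T (diffusiveKernel J ε) Φ h u₀ u → 0 ≤ c →
      (∀ t ∈ Icc 0 T, ∀ᵐ x ∂volume.restrict Ω, Metric.infDist x Ωᶜ < η → u x t ≤ v x t + c) →
      (∀ᵐ x ∂volume.restrict Ω, u x a ≤ v x a + c) →
      ∀ t ∈ Icc a b, ∀ᵐ x ∂volume.restrict Ω, u x t ≤ v x t + (c + δ) := by
  have hT := H.time_pos
  have hR := H.range_pos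
  -- Comparison is run on this compact set only: the strip around it inside Ω is covered by the
  -- assumed boundary estimate and the exterior by the datum, so regularity of v is needed on a
  -- compact set alone.
  set D := {x : Eucl n | η ≤ Metric.infDist x Ωᶜ} with hD
  have hDcl : IsClosed D := isClosed_le continuous_const (Metric.continuous_infDist_pt _)
  have hDΩ : D ⊆ Ω := fun x hx => by
    by_contra hcon
    have := Metric.infDist_zero_of_mem (s := Ωᶜ) hcon
    change η ≤ Metric.infDist x Ωᶜ at hx
    rw [this] at hx
    linarith
  have hDc : IsCompact D :=
    H.isBounded.isCompact_closure.of_isClosed_subset hDcl (hDΩ.trans subset_closure)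
  have hsubT : Ioo a b ⊆ Ioo 0 T := Ioo_subset_Ioo ha.le hb.le
  obtain ⟨s, hs, L, hL, hsol⟩ := H.exists_uniform_solvesAt (hDc.prod (isCompact_Icc (a := a)
    (b := b))) (prod_mono hDΩ fun t ht => ⟨ha.trans_le ht.1, ht.2.trans_lt hb⟩)
  obtain ⟨C, hC, hcons⟩ := H.exists_consistency hL
  obtain ⟨B, hB0, hB⟩ := H.exists_glue_bound
  have hlim : ∀ c : ℝ, Tendsto (fun ε : ℝ => c * (ε * R)) (𝓝 0) (𝓝 0) := fun c => by
    have : Continuous fun ε : ℝ => c * (ε * R) := by fun_prop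
    simpa using this.tendsto 0
  have hlimα : Tendsto (fun ε : ℝ => C * ε ^ α) (𝓝 0) (𝓝 0) := by
    have := ((Real.continuousAt_rpow_const 0 α (Or.inr H.exponent.1.le)).tendsto).const_mul C
    rwa [Real.zero_rpow H.exponent.1.ne', mul_zero] at this
  have e1 := (tendsto_order.1 (hlim 1)).2 (min 1 (min s η)) (by positivity)
  have e2 := (tendsto_order.1 (hlim (3 * L))).2 1 one_pos
  -- The barrier v + c + (δ/T)t has a spare slope δ/T, which absorbs the consistency error once ε is
  -- small.
  have e3 := (tendsto_order.1 hlimα).2 (δ / T) (by positivity)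
  obtain ⟨ε₁, hε₁, hsmall⟩ := Metric.eventually_nhds_iff.1 (e1.and (e2.and e3))
  refine ⟨min ε₁ ε₀, lt_min hε₁ hε₀, fun ε hε hlt u₀ u c hu hc hbdry hinit => ?_⟩
  obtain ⟨f1, f2, f3⟩ := hsmall (y := ε) (by
    rw [Real.dist_eq, sub_zero, abs_of_pos hε]
    exact hlt.trans_le (min_le_left _ _))
  rw [one_mul, lt_min_iff, lt_min_iff] at f1
  have hε' : ε ∈ Ioc 0 ε₀ := ⟨hε, hlt.le.trans (min_le_right _ _)⟩
  have hδT : 0 < δ / T := by positivity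
  set w : Eucl n → ℝ → ℝ := fun y t => glue Ω v h y t + (c + δ / T * t) with hw
  have hshift : ∀ t, 0 ≤ t → t ≤ T → 0 ≤ δ / T * t ∧ δ / T * t ≤ δ := fun t h0 h1 => by
    refine ⟨by positivity, ?_⟩
    calc δ / T * t ≤ δ / T * T := by gcongr
      _ = δ := by field_simp
  have hcomp := H.comparison hε hu hDcl.measurableSet hDΩ ha.le hab hb.le
    (w := w) (B := B + (c + δ)) (fun t ht => ?_) (fun t ht y hy => ?_) ?_ (fun t ht => ?_) ?_
  · intro t ht
    have hcompΩ := (ae_restrict_iff' hDcl.measurableSet).1 hcomp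
    filter_upwards [ae_restrict_of_ae hcompΩ, hbdry t ⟨ha.le.trans ht.1, ht.2.trans hb.le⟩,
      ae_restrict_mem H.isOpen.measurableSet] with x h1 h2 hxΩ
    have h3 := hshift t (ha.le.trans ht.1) (ht.2.trans hb.le)
    by_cases hxD : x ∈ D
    · have h4 := h1 hxD t ht
      simp only [hw, glue, hxΩ, if_true] at h4
      linarith
    · have := h2 (not_le.1 hxD)
      linarith
  · exact (H.aestronglyMeasurable_of_continuousOn
      (H.continuousOn_glue (Ioo_subset_Icc_self (hsubT ht)))
      (H.continuousOn_glue_compl hε' (hsubT ht))).add aestronglyMeasurable_const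
  · have h1 := hB ε hε' f1.1.le t (hsubT ht) y hy
    have h2 := hshift t (hsubT ht).1.le (hsubT ht).2.le
    refine (abs_add_le _ _).trans (add_le_add h1 ?_)
    rw [abs_of_nonneg (by linarith)]
    linarith
  · filter_upwards [ae_restrict_of_ae_restrict_of_subset hDΩ H.flux,
      ae_restrict_mem hDcl.measurableSet] with x hΦ hxD
    have hx := hDΩ hxD
    have hgx : ∀ t, glue Ω v h x t = v x t := fun t => by simp [glue, hx]
    constructor
    · have h1 := (H.continuousOn_time (subset_closure hx)).mono (Icc_subset_Icc ha.le hb.le)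
      simp only [hw, hgx]
      fun_prop
    · intro t ht
      obtain ⟨v', hv', hle⟩ := hcons ε hε' f1.1.le f2.le x hx hΦ t (hsubT ht) (min s η)
        (le_min f1.2.1.le f1.2.2.le) ((min_le_right _ _).trans hxD)
        ((hsol (x, t) ⟨hxD, Ioo_subset_Icc_self ht⟩).mono (min_le_left _ _) le_rfl)
      refine ⟨v' + δ / T, ?_, ?_⟩
      · simp only [hw, hgx]
        exact (hv'.add (((hasDerivAt_id' t).const_mul (δ / T)).const_add c)).congr_deriv (by ring)
      · simp only [hw]
        rw [jumpOp_add_const]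
        linarith
  · have hext := (ae_restrict_iff' ((H.measurableSet_seenRegion ε).diff
      H.isOpen.measurableSet)).1 (hu.exterior t (hsubT ht))
    have hbd := (ae_restrict_iff' H.isOpen.measurableSet).1
      (hbdry t (Ioo_subset_Icc_self (hsubT ht)))
    filter_upwards [ae_restrict_of_ae hext, ae_restrict_of_ae hbd,
      ae_restrict_mem ((H.measurableSet_seenRegion ε).diff hDcl.measurableSet)] with y h1 h2 hy
    have h3 := hshift t (hsubT ht).1.le (hsubT ht).2.le
    by_cases hyΩ : y ∈ Ω
    · have := h2 hyΩ (not_le.1 hy.2)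
      simp only [hw, glue, hyΩ, if_true]
      linarith
    · rw [h1 ⟨hy.1, hyΩ⟩]
      simp only [hw, glue, hyΩ, if_false]
      linarith
  · filter_upwards [ae_restrict_of_ae_restrict_of_subset hDΩ hinit,
      ae_restrict_mem hDcl.measurableSet] with x h1 hxD
    have h3 := hshift a ha.le (hab.le.trans hb.le)
    simp only [hw, glue, hDΩ hxD, if_true]
    linarith

/-- Short-time propagation covers [0,a] and [T-a,T], where v may be irregular in time; in between,
the lateral estimate and interior consistency combine. -/
theorem exists_upper (H : LimitSetting α T ε₀ R r M l₁ l₂ K m₀ Ω J Φ μ v h) (hε₀ : 0 < ε₀)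
    {δ : ℝ} (hδ : 0 < δ) :
    ∃ ε₁ > 0, ∀ ε, 0 < ε → ε < ε₁ → ∀ u,
      IsMildSolution Ω (seenRegion Ω J ε) T (diffusiveKernel J ε) Φ h (fun x => v x 0) u →
      ∀ t ∈ Icc 0 T, ∀ᵐ x ∂volume.restrict Ω, u x t ≤ v x t + δ := by
  have hT := H.time_pos
  -- The error budget: four units for the initial stretch or the lateral strip, one for the middle,
  -- four for the final stretch.
  have hδ9 : 0 < δ / 9 := by positivity
  obtain ⟨η, hη, ε₁, hε₁, hfwd⟩ := H.exists_forward hε₀ hδ9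
  obtain ⟨η', hη', ε₂, hε₂, hbdry⟩ := H.exists_boundary hε₀ hδ9
  set a := min η (T / 3) with ha
  have ha0 : 0 < a := by positivity
  have haη : a ≤ η := min_le_left _ _
  have haT : a ≤ T / 3 := min_le_right _ _
  obtain ⟨ε₃, hε₃, hmid⟩ := H.exists_middle hε₀ hη' ha0 (by linarith : a < T - a) (by linarith) hδ9
  refine ⟨min ε₁ (min ε₂ ε₃), by positivity, fun ε hε hlt u hu => ?_⟩
  rw [lt_min_iff, lt_min_iff] at hlt
  have h1 := hfwd ε hε hlt.1 _ u hu 0 a 0 le_rfl ha0 (by linarith) (by linarith) le_rfl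
    ((hu.initial hT.le).mono fun x hx => by rw [hx, add_zero])
  rw [zero_add] at h1
  have h2 := hmid ε hε hlt.2.2 _ u (4 * (δ / 9)) hu (by positivity) (hbdry ε hε hlt.2.1 u hu)
    (h1.mono fun x hx => hx a (right_mem_Icc.2 ha0.le))
  have h3 := hfwd ε hε hlt.1 _ u hu (T - a) T (4 * (δ / 9) + δ / 9) (by linarith) (by linarith)
    le_rfl (by linarith) (by positivity) (h2 (T - a) ⟨by linarith, le_rfl⟩)
  intro t ht
  rcases le_or_gt t a with hta | hta
  · exact h1.mono fun x hx => (hx t ⟨ht.1, hta⟩).trans (by linarith)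
  rcases le_or_gt t (T - a) with htb | htb
  · exact (h2 t ⟨hta.le, htb⟩).mono fun x hx => hx.trans (by linarith)
  · exact h3.mono fun x hx => (hx t ⟨htb.le, ht.2⟩).trans (by linarith)

end LimitSetting

/-! ### Taylor expansions of functions with Hölder second derivatives -/

theorem norm_snd_fderiv_sub_le {n : ℕ} (w : Eucl n → ℝ) (x y : Eucl n) :
    ‖fderiv ℝ (fderiv ℝ w) y - fderiv ℝ (fderiv ℝ w) x‖
      ≤ ‖iteratedFDeriv ℝ 2 w y - iteratedFDeriv ℝ 2 w x‖ := by
  refine ContinuousLinearMap.opNorm_le_bound₂ _ (norm_nonneg _) fun a b => ?_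
  have h := (iteratedFDeriv ℝ 2 w y - iteratedFDeriv ℝ 2 w x).le_opNorm ![a, b]
  simpa [iteratedFDeriv_two_apply, Fin.prod_univ_two, mul_assoc] using h

theorem norm_snd_fderiv_le {n : ℕ} (w : Eucl n → ℝ) (x : Eucl n) :
    ‖fderiv ℝ (fderiv ℝ w) x‖ ≤ ‖iteratedFDeriv ℝ 2 w x‖ := by
  refine ContinuousLinearMap.opNorm_le_bound₂ _ (norm_nonneg _) fun a b => ?_
  have h := (iteratedFDeriv ℝ 2 w x).le_opNorm ![a, b]
  simpa [iteratedFDeriv_two_apply, Fin.prod_univ_two, mul_assoc] using h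

theorem norm_gradient {n : ℕ} (w : Eucl n → ℝ) (x : Eucl n) :
    ‖gradient w x‖ = ‖fderiv ℝ w x‖ := by
  rw [gradient, LinearIsometryEquiv.norm_map]

theorem laplacian_eq_sum {n : ℕ} (w : Eucl n → ℝ) (x : Eucl n) :
    Δ w x = ∑ i, fderiv ℝ (fderiv ℝ w) x (EuclideanSpace.single i 1)
      (EuclideanSpace.single i 1) := by
  rw [InnerProductSpace.laplacian_eq_iteratedFDeriv_orthonormalBasis w
    (EuclideanSpace.basisFun (Fin (n + 1)) ℝ)]
  simp [iteratedFDeriv_two_apply]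

/-- Two mean value inequalities: Hölder continuity of the Hessian linearises the gradient with error
of order 1+α, and integrating along the segment gains one more order. -/
theorem hasTaylorBound_of_holder {n : ℕ} {α r L : ℝ} (hα : 0 < α) {w : Eucl n → ℝ} {x : Eucl n}
    (hw : ∀ y ∈ Metric.ball x r, ContDiffAt ℝ 2 w y) (h1 : ‖fderiv ℝ w x‖ ≤ L)
    (h2 : ‖iteratedFDeriv ℝ 2 w x‖ ≤ L)
    (hH : ∀ y ∈ Metric.ball x r,
      ‖iteratedFDeriv ℝ 2 w y - iteratedFDeriv ℝ 2 w x‖ ≤ L * ‖y - x‖ ^ α) :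
    HasTaylorBound α r L w x (gradient w x) (fderiv ℝ (fderiv ℝ w) x) where
  norm_le := (norm_gradient w x).trans_le h1
  norm_hess_le := (norm_snd_fderiv_le w x).trans h2
  remainder z hz := by
    have hL : 0 ≤ L := (norm_nonneg _).trans h1
    set B := fderiv ℝ (fderiv ℝ w) x with hB
    have hmem : ∀ s ∈ Icc (0 : ℝ) 1, x + s • z ∈ Metric.closedBall x ‖z‖ := fun s hs => by
      rw [mem_closedBall_iff_norm, add_sub_cancel_left, norm_smul, Real.norm_of_nonneg hs.1]
      exact mul_le_of_le_one_left (norm_nonneg z) hs.2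
    have hsub : Metric.closedBall x ‖z‖ ⊆ Metric.ball x r := Metric.closedBall_subset_ball hz
    have hgrad : ∀ y ∈ Metric.closedBall x ‖z‖,
        ‖fderiv ℝ w y - fderiv ℝ w x - B (y - x)‖ ≤ L * ‖z‖ ^ α * ‖y - x‖ := by
      intro y hy
      refine (convex_closedBall x ‖z‖).norm_image_sub_le_of_norm_hasFDerivWithin_le'
        (f' := fderiv ℝ (fderiv ℝ w)) (fun y hy => ?_) (fun y hy => ?_)
        (Metric.mem_closedBall_self (norm_nonneg z)) hy
      · exact (((hw y (hsub hy)).fderiv_right (m := 1) (by norm_num)).differentiableAt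
          (by norm_num)).hasFDerivAt.hasFDerivWithinAt
      · refine (norm_snd_fderiv_sub_le w x y).trans ((hH y (hsub hy)).trans ?_)
        rw [mem_closedBall_iff_norm] at hy
        gcongr
    have hline : ∀ s : ℝ, HasDerivAt (fun s : ℝ => x + s • z) z s := fun s => by
      simpa using ((hasDerivAt_id' s).smul_const z).const_add x
    have hd : ∀ s ∈ Icc (0 : ℝ) 1, HasDerivWithinAt
        (fun s : ℝ => w (x + s • z) - s * fderiv ℝ w x z - s ^ 2 / 2 * B z z)
        (fderiv ℝ w (x + s • z) z - fderiv ℝ w x z - s * B z z) (Icc 0 1) s := by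
      intro s hs
      have e1 := ((hw _ (hsub (hmem s hs))).differentiableAt (by norm_num)).hasFDerivAt.comp_hasDerivAt
        s (hline s)
      have e2 := (hasDerivAt_id' s).mul_const (fderiv ℝ w x z)
      have e3 := (((hasDerivAt_id' s).pow 2).div_const 2).mul_const (B z z)
      refine (((e1.sub e2).sub e3).congr_deriv ?_).hasDerivWithinAt
      simp
    have hfin := norm_image_sub_le_of_norm_deriv_le_segment_01' (C := L * ‖z‖ ^ (2 + α)) hd ?_
    · have hi : inner ℝ (gradient w x) z = fderiv ℝ w x z := by
        rw [gradient, InnerProductSpace.toDual_symm_apply]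
      rw [Real.norm_eq_abs] at hfin
      rw [hi]
      convert hfin using 2
      simp
      ring
    · intro s hs
      have hs' := Ico_subset_Icc_self hs
      have e := hgrad _ (hmem s hs')
      rw [add_sub_cancel_left] at e
      have e1 := (ContinuousLinearMap.le_opNorm
        (fderiv ℝ w (x + s • z) - fderiv ℝ w x - B (s • z)) z).trans
        (mul_le_mul_of_nonneg_right e (norm_nonneg z))
      have e2 : fderiv ℝ w (x + s • z) z - fderiv ℝ w x z - s * B z z
          = (fderiv ℝ w (x + s • z) - fderiv ℝ w x - B (s • z)) z := by simp
      rw [e2]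
      refine e1.trans ?_
      have e3 : ‖z‖ ^ (2 + α) = ‖z‖ ^ α * ‖z‖ * ‖z‖ := by
        rw [add_comm 2 α, Real.rpow_add_of_nonneg (norm_nonneg z) hα.le (by norm_num), Real.rpow_two]
        ring
      rw [e3, norm_smul, Real.norm_of_nonneg hs'.1]
      have e4 : s * ‖z‖ ≤ ‖z‖ := mul_le_of_le_one_left (norm_nonneg z) hs'.2
      calc L * ‖z‖ ^ α * (s * ‖z‖) * ‖z‖ ≤ L * ‖z‖ ^ α * ‖z‖ * ‖z‖ := by gcongr
        _ = _ := by ring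

section Regularity

variable {n : ℕ} {α T : ℝ} {Ω : Set (Eucl n)} {μ : Eucl n → ℝ} {h₀ : Eucl n → ℝ → ℝ}
  {v₀ : Eucl n → ℝ} {v : Eucl n → ℝ → ℝ}

theorem ParabolicHolderOn.exists_solvesAt (hα : 0 < α) {Q : Set (Eucl n × ℝ)}
    (hQ : ParabolicHolderOn α v Q) :
    ∃ L ≥ 0, (∀ p ∈ Q, DifferentiableAt ℝ (fun y => v y p.2) p.1 ∧
        ‖fderiv ℝ (fun y => v y p.2) p.1‖ ≤ L) ∧
      ∀ x t r, 0 < r → (∀ y ∈ Metric.ball x r, (y, t) ∈ Q) →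
        deriv (v x) t = Δ (fun y => v y t) x + μ x * ‖gradient (fun y => v y t) x‖ ^ 2 →
        SolvesAt α r L v μ x t := by
  obtain ⟨hreg, L, hb, hH⟩ := hQ
  have hL : ∀ p ∈ Q, 0 ≤ L := fun p hp => (abs_nonneg _).trans (hb p hp).1
  refine ⟨max L 0, le_max_right _ _, fun p hp => ⟨(hreg p hp).1.differentiableAt (by norm_num),
    (hb p hp).2.1.trans (le_max_left _ _)⟩, fun x t r hr hball heq => ?_⟩
  have hx := hball x (Metric.mem_ball_self hr)
  refine SolvesAt.mono (L := L) ⟨gradient (fun y => v y t) x,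
    fderiv ℝ (fderiv ℝ fun y => v y t) x, deriv (v x) t, (hreg _ hx).2.hasDerivAt, ?_, ?_⟩ le_rfl
    (le_max_left _ _)
  · refine hasTaylorBound_of_holder hα (fun y hy => (hreg _ (hball y hy)).1) (hb _ hx).2.1
      (hb _ hx).2.2.1 fun y hy => ?_
    have := (hH _ (hball y hy) _ hx).1
    simpa using this
  · rw [heq, laplacian_eq_sum]

theorem IsClassicalSolution.exists_nhds_solvesAt (hα : 0 < α) (hΩ : IsOpen Ω)
    (hv : IsClassicalSolution α Ω T μ h₀ v₀ v) {p : Eucl n × ℝ} (hp : p ∈ Ω ×ˢ Ioo 0 T) :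
    ∃ U ∈ 𝓝 p, ∃ s > 0, ∃ L ≥ 0, ∀ q ∈ U, SolvesAt α s L v μ q.1 q.2 := by
  obtain ⟨U, hU, hQ⟩ := hv.regular p hp
  obtain ⟨L, hL, -, hsol⟩ := hQ.exists_solvesAt (μ := μ) hα
  obtain ⟨s, hs, hsub⟩ := Metric.mem_nhds_iff.1 (inter_mem hU ((hΩ.prod isOpen_Ioo).mem_nhds hp))
  -- Halving the radius leaves room for a spatial ball of fixed size around every point of the
  -- neighbourhood.
  refine ⟨Metric.ball p (s / 2), Metric.ball_mem_nhds p (by positivity), s / 2, by positivity, L,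
    hL, fun q hq => ?_⟩
  have hball : ∀ y ∈ Metric.ball q.1 (s / 2), (y, q.2) ∈ U ∩ Ω ×ˢ Ioo 0 T := fun y hy => by
    refine hsub ?_
    have h1 : dist (y, q.2) q < s / 2 := by
      rw [Prod.dist_eq, dist_self]
      exact max_lt hy (by positivity)
    have h2 := dist_triangle (y, q.2) q p
    rw [Metric.mem_ball] at hq ⊢
    linarith
  have hq' := (hball q.1 (Metric.mem_ball_self (by positivity))).2
  exact hsol q.1 q.2 (s / 2) (by positivity) hball (hv.equation q.1 hq'.1 q.2 hq'.2)

theorem IsClassicalSolution.exists_global_solvesAt (hα : 0 < α) (hΩ : IsOpen Ω)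
    (hΩb : Bornology.IsBounded Ω) (hv : IsClassicalSolution α Ω T μ h₀ v₀ v)
    (hQ : ParabolicHolderOn α v (Ω ×ˢ Ioo 0 T)) :
    ∃ L ≥ 0, (∀ x ∈ Ω, ∀ t ∈ Ioo 0 T, SolvesAt α (Metric.infDist x Ωᶜ) L v μ x t) ∧
      ∀ x ∈ Ω, ∀ p ∈ frontier Ω, ‖x - p‖ = Metric.infDist x Ωᶜ → ∀ t ∈ Ioo 0 T,
        |v x t - v p t| ≤ L * ‖x - p‖ := by
  obtain ⟨L, hL, hdiff, hsol⟩ := hQ.exists_solvesAt (μ := μ) hα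
  have hball : ∀ x, Metric.ball x (Metric.infDist x Ωᶜ) ⊆ Ω := fun x =>
    Metric.ball_infDist_compl_subset
  refine ⟨L, hL, fun x hx t ht => hsol x t _ (infDist_compl_pos hΩ hΩb hx)
    (fun y hy => ⟨hball x hy, ht⟩) (hv.equation x hx t ht), fun x hx p hp hxp t ht => ?_⟩
  have hd := infDist_compl_pos hΩ hΩb hx
  have hp' : p ∈ closure (Metric.ball x (Metric.infDist x Ωᶜ)) := by
    rw [closure_ball x hd.ne', mem_closedBall_iff_norm, norm_sub_rev, hxp]
  have hcont : ContinuousOn (fun y => v y t) (closure Ω) :=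
    hv.continuousOn.comp (f := fun y => (y, t)) (by fun_prop) fun _ hy =>
      ⟨hy, Ioo_subset_Icc_self ht⟩
  have hvp : ContinuousWithinAt (fun y => v y t) (Metric.ball x (Metric.infDist x Ωᶜ)) p :=
    (hcont p (frontier_subset_closure hp)).mono ((hball x).trans subset_closure)
  -- The gradient bound holds in the open ball around x inside Ω; the boundary point p lies on its
  -- sphere and is reached by continuity.
  refine ContinuousWithinAt.closure_le (f := fun y => |v x t - v y t|) (g := fun y => L * ‖x - y‖)
    hp' ?_ (by fun_prop) fun y hy => ?_
  · exact (continuousWithinAt_const.sub hvp).abs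
  · rw [← Real.norm_eq_abs]
    exact (convex_ball x _).norm_image_sub_le_of_norm_hasFDerivWithin_le
      (f := fun y => v y t) (f' := fderiv ℝ fun y => v y t)
      (fun z hz => (hdiff (z, t) ⟨hball x hz, ht⟩).1.hasFDerivAt.hasFDerivWithinAt)
      (fun z hz => (hdiff (z, t) ⟨hball x hz, ht⟩).2) hy (Metric.mem_ball_self hd)

end Regularity

/-! ### From weak and regular solutions to mild solutions -/

theorem nonlocalOp_eq_jumpOp {n : ℕ} {Ω : Set (Eucl n)} {J : Eucl n → ℝ} (hJ : IsKernel J)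
    {G : Eucl n → ℝ → ℝ} {ε : ℝ} {x : Eucl n} (hx : x ∈ Ω) (w : Eucl n → ℝ) :
    nonlocalOp Ω (rescaledKernel J ε) (rescaledG J G ε) w x
      = jumpOp (seenRegion Ω J ε) (diffusiveKernel J ε) (flux J G) w x := by
  have hzero : ∀ y ∉ reach Ω (rescaledKernel J ε), rescaledKernel J ε (x - y) = 0 := fun y hy => by
    by_contra hne
    exact hy (mem_reach_of_ne_zero hJ hx hne)
  rw [nonlocalOp, jumpOp,
    setIntegral_eq_integral_of_forall_compl_eq_zero fun y hy => by rw [hzero y hy, zero_mul],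
    setIntegral_eq_integral_of_forall_compl_eq_zero fun y hy => by
      rw [diffusiveKernel, hzero y fun h => hy (Or.inr h), mul_zero, zero_mul]]
  congr 1 with y
  simp only [diffusiveKernel, rescaledG, flux]
  ring

section Solutions

variable {n : ℕ} {Ω : Set (Eucl n)} {T : ℝ} {J : Eucl n → ℝ} {G : Eucl n → ℝ → ℝ} {ε : ℝ}
  {h : Eucl n → ℝ → ℝ} {u₀ : Eucl n → ℝ} {u : Eucl n → ℝ → ℝ}

theorem seenRegion_sdiff : seenRegion Ω J ε \ Ω = reach Ω (rescaledKernel J ε) \ Ω :=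
  union_sdiff_left

theorem IsWeakSolution.isL1Solution (hΩ : IsOpen Ω) (hJ : IsKernel J)
    (hu : IsWeakSolution Ω T (rescaledKernel J ε) (rescaledG J G ε) h u₀ u) :
    IsL1Solution Ω (seenRegion Ω J ε) T (diffusiveKernel J ε) (flux J G) h u₀ u where
  measurable := hu.measurable
  integrable := hu.integrable
  continuous := hu.continuous
  equation t ht := by
    filter_upwards [hu.equation t ht, ae_restrict_mem hΩ.measurableSet] with x hx hxΩ
    simpa only [nonlocalOp_eq_jumpOp hJ hxΩ] using hx
  exterior t ht := by
    rw [seenRegion_sdiff]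
    exact hu.exterior t ht

/-- Joint continuity gives continuity into L¹ by dominated convergence. The datum is prescribed off
the closure only, and the frontier it misses is null. -/
theorem IsRegularSolution.isL1Solution (hΩ : IsOpen Ω) (hΩb : Bornology.IsBounded Ω)
    (hΩf : volume (frontier Ω) = 0) (hJ : IsKernel J)
    (hu : IsRegularSolution Ω T (rescaledKernel J ε) (rescaledG J G ε) h u₀ u) :
    IsL1Solution Ω (seenRegion Ω J ε) T (diffusiveKernel J ε) (flux J G) h u₀ u := by
  have hslice : ∀ t ∈ Icc 0 T, ContinuousOn (fun x => u x t) (closure Ω) := fun t ht =>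
    hu.continuousOn.comp (f := fun y => (y, t)) (by fun_prop) fun _ hy => ⟨hy, ht⟩
  have hfin : IsFiniteMeasure (volume.restrict Ω) :=
    isFiniteMeasure_restrict.2 hΩb.measure_lt_top.ne
  refine ⟨?_, fun t ht => ?_, fun t ht => ?_, fun t ht => ?_, fun t ht => ?_⟩
  · exact (hu.continuousOn.mono (prod_mono subset_closure Ioo_subset_Icc_self)).aestronglyMeasurable
      (hΩ.measurableSet.prod measurableSet_Ioo)
  · exact ((hslice t ht).integrableOn_compact hΩb.isCompact_closure).mono_set subset_closure
  · obtain ⟨B, hB⟩ := (hΩb.isCompact_closure.prod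
      (isCompact_Icc (a := (0 : ℝ)) (b := T))).exists_bound_of_continuousOn hu.continuousOn
    have hlim := tendsto_integral_filter_of_dominated_convergence (μ := volume.restrict Ω)
      (l := 𝓝[Icc 0 T] t) (F := fun s x => |u x s - u x t|) (f := fun _ => 0) (fun _ => B + B)
      ?_ ?_ (integrable_const _) ?_
    · simpa using hlim
    · filter_upwards [self_mem_nhdsWithin] with s hs
      exact (((hslice s hs).sub (hslice t ht)).abs.mono subset_closure).aestronglyMeasurable
        hΩ.measurableSet
    · filter_upwards [self_mem_nhdsWithin] with s hs
      filter_upwards [ae_restrict_mem hΩ.measurableSet] with x hx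
      rw [Real.norm_eq_abs, abs_abs]
      exact (abs_sub _ _).trans (add_le_add (hB (x, s) ⟨subset_closure hx, hs⟩)
        (hB (x, t) ⟨subset_closure hx, ht⟩))
    · filter_upwards [ae_restrict_mem hΩ.measurableSet] with x hx
      have hc : ContinuousWithinAt (u x) (Icc 0 T) t :=
        (hu.continuousOn.comp (f := fun s => (x, s)) (by fun_prop) fun _ hs =>
          ⟨subset_closure hx, hs⟩) t ht
      simpa using (hc.tendsto.sub_const (u x t)).abs
  · filter_upwards [ae_restrict_mem hΩ.measurableSet] with x hx
    simpa only [nonlocalOp_eq_jumpOp hJ hx] using hu.equation t ht x (subset_closure hx)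
  · rw [seenRegion_sdiff]
    have hf : ∀ᵐ y : Eucl n, y ∉ frontier Ω := measure_eq_zero_iff_ae_notMem.1 hΩf
    filter_upwards [ae_restrict_of_ae hf, ae_restrict_mem
      ((isOpen_reach hΩ (rescaledKernel J ε)).measurableSet.diff hΩ.measurableSet)] with y hy hyS
    refine hu.exterior t ht y ⟨hyS.1, fun hcl => hy ⟨hcl, ?_⟩⟩
    rw [hΩ.interior_eq]
    exact hyS.2

theorem IsMildSolution.congr_initial {S : Set (Eucl n)} {k : Eucl n → ℝ} {Φ : Eucl n → ℝ → ℝ}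
    {u₁ : Eucl n → ℝ} (hu : IsMildSolution Ω S T k Φ h u₀ u) (hΩ : MeasurableSet Ω)
    (he : EqOn u₀ u₁ Ω) : IsMildSolution Ω S T k Φ h u₁ u where
  measurable := hu.measurable
  bounded := hu.bounded
  exterior := hu.exterior
  equation := by
    filter_upwards [hu.equation, ae_restrict_mem hΩ] with x hx hxΩ
    rwa [← he hxΩ]

theorem aemeasurable_flux (hG : IsCaratheodory Ω G) (s : ℝ) :
    AEMeasurable (fun x => flux J G x s) (volume.restrict Ω) :=
  (((hG.measurable 0).const_mul _).inv.mul (hG.measurable s)).mul_const s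

end Solutions

/-! ### Consequences of the C^{1+α} bound on data -/

section Datum

variable {n : ℕ} {α M : ℝ} {f : Eucl n → ℝ} {S : Set (Eucl n)}

theorem C1HolderOn.abs_le (hf : C1HolderOn α M f S) {x : Eucl n} (hx : x ∈ S) : |f x| ≤ M := by
  obtain ⟨g, hg, -, hb, -⟩ := hf
  rw [hg hx]
  exact hb x

theorem C1HolderOn.nonneg (hf : C1HolderOn α M f S) : 0 ≤ M := by
  obtain ⟨g, -, -, hb, -⟩ := hf
  exact (abs_nonneg _).trans (hb 0)

theorem C1HolderOn.continuousOn (hf : C1HolderOn α M f S) : ContinuousOn f S := by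
  obtain ⟨g, hg, hd, -⟩ := hf
  exact hd.continuous.continuousOn.congr hg

theorem C1HolderOn.abs_sub_le (hf : C1HolderOn α M f S) {x y : Eucl n} (hx : x ∈ S) (hy : y ∈ S) :
    |f x - f y| ≤ M * ‖x - y‖ := by
  obtain ⟨g, hg, hd, -, hb, -⟩ := hf
  rw [hg hx, hg hy, ← Real.norm_eq_abs]
  exact convex_univ.norm_image_sub_le_of_norm_fderiv_le
    (fun z _ => hd.differentiable (by norm_num) z) (fun z _ => hb z) (mem_univ y) (mem_univ x)

end Datum

theorem IsKernel.exists_ne_zero {n : ℕ} {J : Eucl n → ℝ} (hJ : IsKernel J) :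
    ∃ z, z ≠ 0 ∧ J z ≠ 0 := by
  by_contra! hcon
  have h0 : ∫ z, J z = 0 := integral_eq_zero_of_ae (by
    filter_upwards [Measure.ae_ne volume (0 : Eucl n)] with z hz
    exact hcon z hz)
  rw [hJ.integral_eq_one] at h0
  exact one_ne_zero h0

/-- For x in Ω close to p, the scale ε = ‖p - x‖/‖z‖ brings p - x to the length of a vector z with
J(z) ≠ 0, and J is radial. Thus the Lipschitz bound on h extends up to the frontier, where it also
controls v. -/
theorem frontier_subset_exteriorCollar {n : ℕ} {Ω : Set (Eucl n)} (hΩ : IsOpen Ω)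
    {J : Eucl n → ℝ} (hJ : IsKernel J) {ε₀ : ℝ} (hε₀ : 0 < ε₀) :
    frontier Ω ⊆ exteriorCollar Ω J ε₀ := by
  intro p hp
  have hpΩ : p ∉ Ω := by
    have := hp.2
    rwa [hΩ.interior_eq] at this
  obtain ⟨z, hz, hJz⟩ := hJ.exists_ne_zero
  have hz' : 0 < ‖z‖ := norm_pos_iff.2 hz
  obtain ⟨x, hx, hxp⟩ := Metric.mem_closure_iff.1 hp.1 (ε₀ * ‖z‖) (by positivity)
  rw [dist_eq_norm] at hxp
  have hne : 0 < ‖p - x‖ := norm_pos_iff.2 (sub_ne_zero.2 fun h => hpΩ (h ▸ hx))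
  set ε := ‖p - x‖ / ‖z‖ with hε
  have hε' : 0 < ε := by positivity
  have hJ' : J (ε⁻¹ • (p - x)) ≠ 0 := by
    rwa [hJ.radial _ z]
    rw [norm_smul, norm_inv, Real.norm_of_nonneg hε'.le, hε]
    field_simp
  have := add_mem_reach hε' hx hJ'
  rw [smul_smul, mul_inv_cancel₀ hε'.ne', one_smul, add_sub_cancel] at this
  exact ⟨mem_biUnion ⟨hε', (div_le_iff₀ hz').2 hxp.le⟩ this, hpΩ⟩

/-! ### The main theorem -/

theorem supDist_le {n : ℕ} {Ω : Set (Eucl n)} {T C : ℝ} {u v : Eucl n → ℝ → ℝ}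
    (h : ∀ t ∈ Icc 0 T, ∀ᵐ x ∂volume.restrict Ω, |u x t - v x t| ≤ C) :
    supDist Ω T u v ≤ ENNReal.ofReal C :=
  iSup₂_le fun t ht => by
    rw [eLpNorm_exponent_top]
    exact eLpNormEssSup_le_of_ae_bound (h t ht)

theorem exists_limitSetting {n : ℕ} {α : ℝ} (hα : α ∈ Ioo (0 : ℝ) 1)
    {Ω : Set (Eucl n)} (hΩ : IsC2HolderDomain α Ω) {T : ℝ} (hT : 0 < T)
    {J : Eucl n → ℝ} (hJ : IsKernel J) {G : Eucl n → ℝ → ℝ} (hGm : StronglyMonotone Ω G)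
    (hGs : C1HolderInS α Ω G) {μ : Eucl n → ℝ}
    (hμ : ∀ᵐ x ∂volume.restrict Ω, μ x = 2 * deriv (G x) 0 / G x 0)
    {h₀ : Eucl n → ℝ → ℝ} {v₀ : Eucl n → ℝ} {v : Eucl n → ℝ → ℝ}
    (hv : IsClassicalSolution α Ω T μ h₀ v₀ v) {ε₀ : ℝ} (hε₀ : 0 < ε₀) {h : Eucl n → ℝ → ℝ} {M : ℝ}
    (hhs : ∀ t ∈ Ioc 0 T, C1HolderOn α M (fun x => h x t) (exteriorCollar Ω J ε₀))
    (hh₀ : ∀ x ∈ frontier Ω, ∀ t ∈ Ioo 0 T, h x t = h₀ x t) :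
    ∃ R r l₁ l₂ K m₀, LimitSetting α T ε₀ R r M l₁ l₂ K m₀ Ω J (flux J G) μ v h := by
  obtain ⟨R, hR, hrange⟩ := hJ.exists_radius
  obtain ⟨r, hr, hballs⟩ := hΩ.exists_exteriorBalls
  obtain ⟨l₁, hl₁, l₂, hl₂, K, hK, m₀, hm₀, hflux⟩ := exists_fluxBounds hα.1 hJ hGm hGs hμ
  have hfr := frontier_subset_exteriorCollar hΩ.isOpen hJ hε₀
  have hvh : ∀ p ∈ frontier Ω, ∀ t ∈ Ioo 0 T, v p t = h p t := fun p hp t ht =>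
    (hv.boundary p hp t ht).trans (hh₀ p hp t ht).symm
  refine ⟨R, r, l₁, l₂, K, m₀, ?_⟩
  exact
  { exponent := hα
    time_pos := hT
    isOpen := hΩ.isOpen
    isBounded := hΩ.isBounded
    radius_pos := hr
    exteriorBalls := hballs
    kernel := hJ
    range_pos := hR
    range := hrange
    lip_nonneg := (hhs T ⟨hT, le_rfl⟩).nonneg
    l₁_pos := hl₁
    l₂_nonneg := hl₂
    K_nonneg := hK
    m₀_nonneg := hm₀
    flux := hflux
    continuousOn := hv.continuousOn
    interior := fun p hp => hv.exists_nhds_solvesAt hα.1 hΩ.isOpen hp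
    exterior := fun y hy p hp t ht => by
      rw [hvh p hp t ht]
      exact (hhs t (Ioo_subset_Ioc_self ht)).abs_sub_le hy (hfr hp)
    exterior_continuousOn := fun t ht => (hhs t (Ioo_subset_Ioc_self ht)).continuousOn
    frontier_lip := fun p hp q hq t ht => by
      rw [hvh p hp t ht, hvh q hq t ht]
      exact (hhs t (Ioo_subset_Ioc_self ht)).abs_sub_le (hfr hp) (hfr hq) }

theorem exists_isMildSolution {n : ℕ} {α T ε₀ R r M l₁ l₂ K m₀ M₀ : ℝ} {Ω : Set (Eucl n)}
    {J : Eucl n → ℝ} {G : Eucl n → ℝ → ℝ} {μ v₀ : Eucl n → ℝ} {v h : Eucl n → ℝ → ℝ}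
    (H : LimitSetting α T ε₀ R r M l₁ l₂ K m₀ Ω J (flux J G) μ v h) (hG : IsCaratheodory Ω G)
    (hv₀ : C1HolderOn α M₀ v₀ (closure Ω)) (hv : ∀ x ∈ Ω, v x 0 = v₀ x)
    (hhc : ContinuousOn (fun p : Eucl n × ℝ => h p.1 p.2) (exteriorCollar Ω J ε₀ ×ˢ Ioc 0 T))
    (hhM : ∀ t ∈ Ioc 0 T, ∀ y ∈ exteriorCollar Ω J ε₀, |h y t| ≤ M)
    {ε : ℝ} (hε : ε ∈ Ioc 0 ε₀) {u : Eucl n → ℝ → ℝ}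
    (hu : IsWeakSolution Ω T (rescaledKernel J ε) (rescaledG J G ε) h v₀ u ∨
      IsRegularSolution Ω T (rescaledKernel J ε) (rescaledG J G ε) h v₀ u) :
    ∃ w, IsMildSolution Ω (seenRegion Ω J ε) T (diffusiveKernel J ε) (flux J G) h
      (fun x => v x 0) w ∧ ∀ t ∈ Icc 0 T, ∀ᵐ x ∂volume.restrict Ω, w x t = u x t := by
  have hL1 : IsL1Solution Ω (seenRegion Ω J ε) T (diffusiveKernel J ε) (flux J G) h v₀ u :=
    hu.elim (fun h => h.isL1Solution H.isOpen H.kernel) fun h =>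
      h.isL1Solution H.isOpen H.isBounded (H.exteriorBalls.volume_frontier H.radius_pos) H.kernel
  have hsub : seenRegion Ω J ε \ Ω ⊆ exteriorCollar Ω J ε₀ := fun y hy => (H.collar hε hy).1
  obtain ⟨w, hw, hwu⟩ := hL1.exists_mild (M := max M M₀) H.time_pos H.isOpen.measurableSet
    H.isBounded.measure_lt_top.ne (H.measurableSet_seenRegion ε) subset_seenRegion
    (continuous_diffusiveKernel H.kernel) (hasCompactSupport_diffusiveKernel H.kernel hε.1)
    (diffusiveKernel_nonneg H.kernel hε.1) (aemeasurable_flux hG) H.l₂_nonneg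
    (H.flux.mono fun x hx => ⟨hx.continuous H.l₁_pos.le, hx.abs_apply_le H.l₁_pos.le⟩)
    (hhc.mono (prod_mono hsub Ioo_subset_Ioc_self)) (H.lip_nonneg.trans (le_max_left _ _))
    (fun t ht y hy => (hhM t (Ioo_subset_Ioc_self ht) y (hsub hy)).trans (le_max_left _ _))
    ((hv₀.continuousOn.mono subset_closure).aestronglyMeasurable H.isOpen.measurableSet)
    (fun x hx => (hv₀.abs_le (subset_closure hx)).trans (le_max_right _ _))
  exact ⟨w, hw.congr_initial H.isOpen.measurableSet fun x hx => (hv x hx).symm, hwu⟩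

theorem theorem2p7 {n : ℕ} (α : ℝ) (hα : α ∈ Ioo (0 : ℝ) 1)
    (Ω : Set (Eucl n)) (hΩ : IsC2HolderDomain α Ω)
    (T : ℝ) (hT : 0 < T)
    (J : Eucl n → ℝ) (hJ : IsKernel J)
    (G : Eucl n → ℝ → ℝ) (hGc : IsCaratheodory Ω G) (hGm : StronglyMonotone Ω G)
    (hGs : C1HolderInS α Ω G)
    (μ : Eucl n → ℝ)
    (hμ : ∀ᵐ x ∂volume.restrict Ω, μ x = 2 * deriv (G x) 0 / G x 0)
    (h₀ : Eucl n → ℝ → ℝ) (v₀ : Eucl n → ℝ) (hv₀ : ∃ M, C1HolderOn α M v₀ (closure Ω))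
    (v : Eucl n → ℝ → ℝ) (hv : IsClassicalSolution α Ω T μ h₀ v₀ v)
    (ε₀ : ℝ) (hε₀ : 0 < ε₀)
    (h : Eucl n → ℝ → ℝ)
    (hhc : ContinuousOn (fun p : Eucl n × ℝ => h p.1 p.2) (exteriorCollar Ω J ε₀ ×ˢ Ioc 0 T))
    (hhs : ∃ M, ∀ t ∈ Ioc 0 T, C1HolderOn α M (fun x => h x t) (exteriorCollar Ω J ε₀))
    (hh₀ : ∀ x ∈ frontier Ω, ∀ t ∈ Ioo 0 T, h x t = h₀ x t)
    (u : ℝ → Eucl n → ℝ → ℝ)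
    (hu : ∀ ε ∈ Ioc 0 ε₀,
      IsWeakSolution Ω T (rescaledKernel J ε) (rescaledG J G ε) h v₀ (u ε) ∨
      IsRegularSolution Ω T (rescaledKernel J ε) (rescaledG J G ε) h v₀ (u ε)) :
    Tendsto (fun ε => supDist Ω T (u ε) v) (𝓝[>] 0) (𝓝 0) ∧
    (ParabolicHolderOn α v (Ω ×ˢ Ioo 0 T) →
      ∃ K : ℝ, ∀ᶠ ε in 𝓝[>] (0 : ℝ), supDist Ω T (u ε) v ≤ ENNReal.ofReal (K * ε ^ α)) := by

  obtain ⟨M, hhs⟩ := hhs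
  obtain ⟨M₀, hv₀⟩ := hv₀
  obtain ⟨R, r, l₁, l₂, K, m₀, H⟩ := exists_limitSetting hα hΩ hT hJ hGm hGs hμ hv hε₀ hhs hh₀
  have hmild := fun ε (hε : ε ∈ Ioc 0 ε₀) => exists_isMildSolution H hGc hv₀ hv.initial hhc
    (fun t ht y hy => (hhs t ht).abs_le hy) hε (hu ε hε)
  constructor
  · rw [ENNReal.tendsto_nhds_zero]
    intro δ hδ
    obtain ⟨d, hd0, hd⟩ : ∃ d : ℝ, 0 < d ∧ ENNReal.ofReal d ≤ δ := by
      rcases eq_or_ne δ ⊤ with rfl | htop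
      · exact ⟨1, one_pos, le_top⟩
      · exact ⟨δ.toReal, ENNReal.toReal_pos hδ.ne' htop, (ENNReal.ofReal_toReal htop).le⟩
    obtain ⟨ε₁, hε₁, hup⟩ := H.exists_upper hε₀ hd0
    -- The lower bound is the upper bound for the reflected problem, applied to the negated mild
    -- solution.
    obtain ⟨ε₂, hε₂, hlo⟩ := H.neg.exists_upper hε₀ hd0
    filter_upwards [Ioo_mem_nhdsGT (lt_min hε₀ (lt_min hε₁ hε₂))] with ε hε
    simp only [mem_Ioo, lt_min_iff] at hε
    obtain ⟨w, hw, hwu⟩ := hmild ε ⟨hε.1, hε.2.1.le⟩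
    refine (supDist_le fun t ht => ?_).trans hd
    filter_upwards [hup ε hε.1 hε.2.2.1 w hw t ht, hlo ε hε.1 hε.2.2.2 _ hw.neg t ht, hwu t ht]
      with x h1 h2 h3
    rw [← h3, abs_le]
    constructor <;> linarith
  · intro hQ
    obtain ⟨L, hL, hsol, hlip⟩ := hv.exists_global_solvesAt hα.1 hΩ.isOpen hΩ.isBounded hQ
    obtain ⟨C₁, hC₁, ε₁, hε₁, hup⟩ := H.exists_rate hε₀ hL hsol hlip
    obtain ⟨C₂, hC₂, ε₂, hε₂, hlo⟩ := H.neg.exists_rate hε₀ hL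
      (fun x hx t ht => (hsol x hx t ht).neg) (fun x hx p hp hxp t ht => by
        rw [neg_sub_neg, abs_sub_comm]
        exact hlip x hx p hp hxp t ht)
    refine ⟨max C₁ C₂, ?_⟩
    filter_upwards [Ioo_mem_nhdsGT (lt_min hε₀ (lt_min hε₁ hε₂))] with ε hε
    simp only [mem_Ioo, lt_min_iff] at hε
    obtain ⟨w, hw, hwu⟩ := hmild ε ⟨hε.1, hε.2.1.le⟩
    refine supDist_le fun t ht => ?_
    have hεα : 0 < ε ^ α := Real.rpow_pos_of_pos hε.1 α
    have k1 : C₁ * ε ^ α ≤ max C₁ C₂ * ε ^ α := by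
      have := le_max_left C₁ C₂
      gcongr
    have k2 : C₂ * ε ^ α ≤ max C₁ C₂ * ε ^ α := by
      have := le_max_right C₁ C₂
      gcongr
    filter_upwards [hup ε hε.1 hε.2.2.1 w hw, hlo ε hε.1 hε.2.2.2 _ hw.neg, hwu t ht]
      with x h1 h2 h3
    have h4 := h1 t ht
    have h5 := h2 t ht
    rw [← h3, abs_le]
    constructor <;> linarith
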